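/- Let $S^1=\mathbb R/\mathbb Z$ with Lebesgue measure of total mass one. Let $f:S^1\to S^1$ and $h:S^1\times S^1\to\mathbb R$ be of class $C^5$. Assume that $|f'(x)|>\omega$ for all $x\in S^1$, for some $\omega>1$, and that $$N\Big(\frac{\max|f''|}{\omega^3}+\frac1{\omega^2}\Big)<1,$$ where $N$ is the number of preimages under $f$ of a point of $S^1$. Let $P$ be the transfer operator of $f$, $P\varphi(x)=\sum_{f(y)=x}\varphi(y)/|f'(y)|$. For $t\in\mathbb R$ and a function $\psi$ on $S^1$ put $$A_\psi(x)=\int_{S^1}h(x,y)\psi(y)\,dy,\qquad \Phi_{t,\psi}(x)=x+tA_\psi(x),\qquad Q_{t,\psi}\varphi=\frac{\varphi}{\Phi_{t,\psi}'}\circ\Phi_{t,\psi}^{-1},\qquad \mathcal L_t\psi=PQ_{t,\psi}\psi .$$ Then there is $\varepsilon_0>0$ such that, for all $|t|\le\varepsilon_0$, the map $\Phi_{t,\psi}$ is a $C^5$ diffeomorphism of $S^1$ with $\Phi'_{t,\psi}>0$ for every continuous probability density $\psi$ on $S^1$, the operator $\mathcal L_t$ has a unique fixed point $\rho(t)$ among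 the positive Lipschitz probability densities on $S^1$, and the following hold. (i) $\rho(t)\in C^3(S^1,\mathbb R)$ for all $|t|\le\varepsilon_0$. (ii) There is $\varepsilon_2\in(0,\varepsilon_0]$ such that $t\mapsto\rho(t)$ belongs to $C^1([-\varepsilon_2,\varepsilon_2],C^1(S^1,\mathbb R))$. (iii) Put $P_t=PQ_{t,\rho(t)}$ and $$\Theta_t(g)=\Big(\Big(\frac{\rho(t)}{\Phi_{t,\rho(t)}'}\,A_g\Big)\circ\Phi_{t,\rho(t)}^{-1}\Big)',\qquad g\in C^1(S^1,\mathbb R),$$ and let $C^1_0$ be the Banach space of all $g\in C^1(S^1,\mathbb R)$ with $\int_{S^1} g=0$. There is $\varepsilon_3\in(0,\varepsilon_2]$ such that for every $|\hat t|<\varepsilon_3$ the operator $1-P_{\hat t}+\hat tP\Theta_{\hat t}$ is a bounded operator on $C^1_0$ with a bounded inverse, $P\Theta_{\hat t}(\rho(\hat t))\in C^1_0$, and $$\partial_t\rho(t)\big|_{t=\hat t}=-\big(1-P_{\hat t}+\hat tP\Theta_{\hat t}\big)^{-1}P\Theta_{\hat t}(\rho(\hat t)),$$ the derivative being taken in $C^1(S^1,\mathbb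 R)$. In particular, $1-P$ is a bounded operator on $C^1_0$ with a bounded inverse, $P\big((\rho(0)A_{\rho(0)})'\big)\in C^1_0$, and $$\partial_t\rho(t)\big|_{t=0}=-(1-P)^{-1}P\big((\rho(0)A_{\rho(0)})'\big).$$ -/

import Mathlib

open MeasureTheory Set

noncomputable section

namespace SelfConsistent

/-- The circle `ℝ / ℤ`; its Haar measure `volume` has total mass one. -/
abbrev S1 : Type := UnitAddCircle

/-! ### Calculus on the circle -/

/-- A real function on the circle is of class `C^n` if its periodic lift to `ℝ` is. -/
def FunContDiff (n : WithTop ℕ∞) (g : S1 → ℝ) : Prop :=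
  ContDiff ℝ n (fun x : ℝ => g (x : S1))

/-- A real function on the torus is of class `C^n` if its doubly periodic lift to `ℝ²` is. -/
def TorusContDiff (n : WithTop ℕ∞) (h : S1 → S1 → ℝ) : Prop :=
  ContDiff ℝ n (fun p : ℝ × ℝ => h (p.1 : S1) (p.2 : S1))

/-- A map of the circle to itself is of class `C^n` if it has a `C^n` lift to `ℝ`. -/
def MapContDiff (n : WithTop ℕ∞) (T : S1 → S1) : Prop :=
  ∃ F : ℝ → ℝ, ContDiff ℝ n F ∧ ∀ x : ℝ, T (x : S1) = (F x : S1)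

/-- `C^n` diffeomorphisms of the circle. -/
def IsDiffeo (n : WithTop ℕ∞) (T : S1 → S1) : Prop :=
  ∃ S : S1 → S1, Function.LeftInverse S T ∧ Function.RightInverse S T ∧
    MapContDiff n T ∧ MapContDiff n S

/-- The derivative `g'` of a real function on the circle. -/
def funDeriv (g : S1 → ℝ) (x : S1) : ℝ :=
  deriv (fun s : ℝ => g (x + (s : S1))) 0

/-- The representative in `[-1/2, 1/2)` of a point of the circle. -/
def rep (z : S1) : ℝ :=
  (AddCircle.equivIco (1 : ℝ) (-(1 / 2)) z : ℝ)

/-- The derivative `T'` of a map of the circle to itself: the increments `T (x + s) - T x`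
are small for small `s` (if `T` is continuous) and are read off as real numbers. -/
def mapDeriv (T : S1 → S1) (x : S1) : ℝ :=
  deriv (fun s : ℝ => rep (T (x + (s : S1)) - T x)) 0

theorem funDeriv_coe (g : S1 → ℝ) (x : ℝ) :
    funDeriv g (x : S1) = deriv (fun y : ℝ => g (y : S1)) x := by
  have h := deriv_comp_const_add (fun y : ℝ => g (y : S1)) x 0
  simpa [funDeriv] using h

theorem rep_coe {r : ℝ} (hr : |r| < 1 / 2) : rep (r : S1) = r := by
  have h1 := abs_lt.1 hr
  unfold rep
  rw [AddCircle.equivIco_coe_of_mem (p := (1 : ℝ)) (a := -(1 / 2)) (y := r)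
    ⟨by linarith, by linarith⟩]

/-- The derivative of a circle map is the derivative of any of its lifts. -/
theorem mapDeriv_coe {T : S1 → S1} {F : ℝ → ℝ} (hF : ∀ x : ℝ, T (x : S1) = (F x : S1))
    {x : ℝ} (hd : DifferentiableAt ℝ F x) : mapDeriv T (x : S1) = deriv F x := by
  have hc : ContinuousAt (fun s : ℝ => F (x + s) - F x) 0 := by
    have h0 : ContinuousAt F (x + 0) := by simpa using hd.continuousAt
    exact (ContinuousAt.comp (f := fun s : ℝ => x + s) h0 (by fun_prop)).sub continuousAt_const
  have hev : ∀ᶠ s in nhds (0 : ℝ), |F (x + s) - F x| < 1 / 2 := by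
    have := hc.abs
    exact this.eventually_lt_const (by simp)
  have heq : (fun s : ℝ => rep (T ((x : S1) + (s : S1)) - T (x : S1)))
      =ᶠ[nhds 0] fun s : ℝ => F (x + s) - F x := by
    filter_upwards [hev] with s hs
    rw [← AddCircle.coe_add, hF, hF, ← AddCircle.coe_sub, rep_coe hs]
  unfold mapDeriv
  rw [heq.deriv_eq, deriv_sub_const]
  simpa using deriv_comp_const_add F x 0

/-! ### The uncoupled map -/

/-- The number of preimages under `f` of a point of the circle; all points have equally many
when `f` is a covering map. -/
def coveringNumber (f : S1 → S1) : ℕ :=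
  (f ⁻¹' {0}).ncard

/-- The transfer operator `P` of `f`:
`(P φ)(x) = ∑ φ(y) / |f'(y)|`, the sum being over the preimages `y` of `x`. -/
def transfer (f : S1 → S1) (φ : S1 → ℝ) (x : S1) : ℝ :=
  ∑ᶠ y : f ⁻¹' {x}, φ y / |mapDeriv f y|

/-! ### The coupling -/

/-- `A_ψ(x) = ∫ h(x, y) ψ(y) dy`. -/
def meanField (h : S1 → S1 → ℝ) (ψ : S1 → ℝ) (x : S1) : ℝ :=
  ∫ y, h x y * ψ y

/-- `Φ_{t,ψ}(x) = x + t A_ψ(x)`. -/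
def couplingMap (h : S1 → S1 → ℝ) (t : ℝ) (ψ : S1 → ℝ) (x : S1) : S1 :=
  x + ((t * meanField h ψ x : ℝ) : S1)

/-- `Φ'_{t,ψ}(x) = 1 + t A'_ψ(x)`. -/
def couplingDeriv (h : S1 → S1 → ℝ) (t : ℝ) (ψ : S1 → ℝ) (x : S1) : ℝ :=
  1 + t * funDeriv (meanField h ψ) x

/-- `Φ_{t,ψ}⁻¹`. -/
def couplingInv (h : S1 → S1 → ℝ) (t : ℝ) (ψ : S1 → ℝ) : S1 → S1 :=
  Function.invFun (couplingMap h t ψ)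

/-- `Q_{t,ψ} φ = (φ / Φ'_{t,ψ}) ∘ Φ_{t,ψ}⁻¹`, the transfer operator of `Φ_{t,ψ}`. -/
def couplingTransfer (h : S1 → S1 → ℝ) (t : ℝ) (ψ φ : S1 → ℝ) (x : S1) : ℝ :=
  φ (couplingInv h t ψ x) / couplingDeriv h t ψ (couplingInv h t ψ x)

/-- `𝓛_{t,ψ} = P Q_{t,ψ}`. -/
def coupledTransfer (f : S1 → S1) (h : S1 → S1 → ℝ) (t : ℝ) (ψ φ : S1 → ℝ) : S1 → ℝ :=
  transfer f (couplingTransfer h t ψ φ)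

/-- The self-consistent transfer operator `𝓛_t ψ = P Q_{t,ψ} ψ`. -/
def selfConsistentTransfer (f : S1 → S1) (h : S1 → S1 → ℝ) (t : ℝ) (ψ : S1 → ℝ) : S1 → ℝ :=
  coupledTransfer f h t ψ ψ

/-- `φ` is a positive Lipschitz probability density fixed by `𝓛_t`. -/
def IsFixedDensity (f : S1 → S1) (h : S1 → S1 → ℝ) (t : ℝ) (φ : S1 → ℝ) : Prop :=
  (∃ K, LipschitzWith K φ) ∧ (∀ x, 0 < φ x) ∧ ∫ x, φ x = 1 ∧
    selfConsistentTransfer f h t φ = φ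

/-- `Θ_t(g) = ((ρ / Φ'_{t,ρ} · A_g) ∘ Φ_{t,ρ}⁻¹)'`. -/
def theta (h : S1 → S1 → ℝ) (t : ℝ) (ρ g : S1 → ℝ) : S1 → ℝ :=
  funDeriv (fun x => ρ (couplingInv h t ρ x) / couplingDeriv h t ρ (couplingInv h t ρ x)
    * meanField h g (couplingInv h t ρ x))

/-! ### The space `C¹(S¹, ℝ)` -/

/-- `C¹(S¹, ℝ)` as the space of pairs `(g, g')` of continuous functions, with the norm
`max (‖g‖_∞, ‖g'‖_∞)`. -/
def c1Submodule : Submodule ℝ (C(S1, ℝ) × C(S1, ℝ)) where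
  carrier := {p | ∀ x : ℝ, HasDerivAt (fun s : ℝ => p.1 (s : S1)) (p.2 (x : S1)) x}
  add_mem' := fun ha hb x => (ha x).add (hb x)
  zero_mem' := fun x => hasDerivAt_const x (0 : ℝ)
  smul_mem' := fun c _ ha x => (ha x).const_mul c

/-- The normed space `C¹(S¹, ℝ)`. -/
abbrev C1 : Type := c1Submodule

/-- The function underlying an element of `C¹(S¹, ℝ)`. -/
def C1.fn (g : C1) : S1 → ℝ := fun x => g.1.1 x

/-- The subspace `C¹₀(S¹, ℝ)` of the functions of zero mean. -/
def c1ZeroMean : Submodule ℝ C1 where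
  carrier := {g | ∫ x, C1.fn g x = 0}
  add_mem' := by
    intro a b ha hb
    have hi : ∀ g : C1, Integrable (C1.fn g) := fun g =>
      g.1.1.continuous.integrable_of_hasCompactSupport (HasCompactSupport.of_compactSpace _)
    have h := integral_add (hi a) (hi b)
    simp only [mem_ofPred_eq] at ha hb ⊢
    rw [ha, hb, add_zero] at h
    exact h
  zero_mem' := by simp [C1.fn]
  smul_mem' := by
    intro c a ha
    have h := integral_const_mul (μ := (volume : Measure S1)) c (C1.fn a)
    simp only [mem_ofPred_eq] at ha ⊢
    rw [ha, mul_zero] at h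
    exact h

end SelfConsistent

end

/-!
On lifts to the line, `φ ↦ P Q_{t,ψ} φ` is the transfer operator `T` of the map `F ∘ (id + u)`,
where `u = t A_ψ`. With `a` the reciprocal of the derivative of this map, `(T φ)' = T ((a φ)')`. The
distortion hypothesis gives `T (|a| + |a'|) ≤ θ < 1`. Since a function of zero mean vanishes
somewhere, it is bounded by its derivative, so `T` contracts `C¹` functions of zero mean by the
factor `θ`; the derivatives of order `j` contract because they are multiplied by `a ^ j`. All this
is uniform over small `u`. Hence `T` has a unique invariant density, which is as smooth as `a` and
depends on `u` in a Lipschitz way, with a loss of derivatives. As `ψ ↦ t A_ψ` is smoothing,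
sending `ψ` to the invariant density of `P Q_{t,ψ}` contracts the sup norm for small `t`; its
fixed point is `ρ(t)`.

Expanding the fixed point equation in `u` gives, with `L = P_t - t P Θ_t`,
`(1 - L) (ρ(s) - ρ(t)) = -(s - t) P Θ_t (ρ(t)) + O((s - t)²)` in `C¹`, uniformly in `s` and `t`.
Since `L` contracts `C¹₀` as well, `1 - L` can be inverted, and a curve with a uniformly quadratic
first order remainder is `C¹`.
-/

namespace SelfConsistent

/-! ### Periodic functions with bounded derivatives -/

/-- The `C^k` norm on the circle, as a relation: `φ` is the lift to `ℝ` of a `C^k` function on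
`ℝ / ℤ`, and its derivatives of order at most `k` are bounded by `M`. -/
structure CkBound (k : ℕ) (φ : ℝ → ℝ) (M : ℝ) : Prop where
  contDiff : ContDiff ℝ k φ
  periodic : Function.Periodic φ 1
  bound : ∀ i ≤ k, ∀ x, |iteratedDeriv i φ x| ≤ M

theorem periodic_deriv {φ : ℝ → ℝ} {c : ℝ} (h : Function.Periodic φ c) :
    Function.Periodic (deriv φ) c := fun x => by
  rw [← deriv_comp_add_const φ c x, funext h]

theorem exists_forall_abs_le_of_periodic {φ : ℝ → ℝ} {c : ℝ} (hφ : Continuous φ) (hc : c ≠ 0)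
    (hp : Function.Periodic φ c) : ∃ M, ∀ x, |φ x| ≤ M := by
  obtain ⟨M, hM⟩ := (hp.isBounded_of_continuous hc hφ).exists_norm_le
  exact ⟨M, fun x => hM _ (mem_range_self x)⟩

theorem abs_sub_le_of_abs_deriv_le {φ : ℝ → ℝ} {K : ℝ} (hd : Differentiable ℝ φ)
    (hK : ∀ x, |deriv φ x| ≤ K) (x y : ℝ) : |φ x - φ y| ≤ K * |x - y| :=
  Convex.norm_image_sub_le_of_norm_deriv_le (s := univ) (fun z _ => hd z) (fun z _ => hK z)
    convex_univ (mem_univ y) (mem_univ x)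

theorem integral_deriv_eq_zero {φ : ℝ → ℝ} (hφ : ContDiff ℝ 1 φ) (hp : Function.Periodic φ 1) :
    ∫ x in (0 : ℝ)..1, deriv φ x = 0 := by
  rw [intervalIntegral.integral_deriv_eq_sub (fun x _ => hφ.differentiable one_ne_zero x)
    ((hφ.continuous_deriv le_rfl).intervalIntegrable _ _), sub_eq_zero]
  simpa using hp 0

theorem abs_le_of_integral_eq_zero {φ : ℝ → ℝ} {K : ℝ} (hφ : Continuous φ)
    (hp : Function.Periodic φ 1) (hK : ∀ x y, |φ x - φ y| ≤ K * |x - y|)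
    (h0 : ∫ x in (0 : ℝ)..1, φ x = 0) (x : ℝ) : |φ x| ≤ K := by
  have hK0 : 0 ≤ K := by simpa using (abs_nonneg _).trans (hK 1 0)
  have hmean : ∫ y in x..x + 1, (φ x - φ y) = φ x := by
    rw [intervalIntegral.integral_sub (by simp) (hφ.intervalIntegrable _ _),
      hp.intervalIntegral_add_eq x 0, zero_add, h0]
    simp
  have hle := intervalIntegral.norm_integral_le_of_norm_le_const (a := x) (b := x + 1)
    (f := fun y => φ x - φ y) (C := K) fun y hy => by
      rw [uIoc_of_le (by linarith)] at hy
      refine (hK x y).trans (mul_le_of_le_one_right hK0 ?_)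
      exact abs_le.2 ⟨by linarith [hy.2], by linarith [hy.1]⟩
  rw [hmean] at hle
  simpa using hle

theorem contDiff_succ_iff_differentiable {k : ℕ} {φ : ℝ → ℝ} :
    ContDiff ℝ (k + 1 : ℕ) φ ↔ Differentiable ℝ φ ∧ ContDiff ℝ k (deriv φ) := by
  push_cast
  simp [contDiff_succ_iff_deriv]

namespace CkBound

variable {k : ℕ} {φ ψ : ℝ → ℝ} {M M' : ℝ}

theorem abs_le (h : CkBound k φ M) (x : ℝ) : |φ x| ≤ M := by
  simpa using h.bound 0 (Nat.zero_le _) x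

theorem nonneg (h : CkBound k φ M) : 0 ≤ M := (abs_nonneg _).trans (h.abs_le 0)

theorem continuous (h : CkBound k φ M) : Continuous φ := h.contDiff.continuous

theorem mono (h : CkBound k φ M) (hM : M ≤ M') : CkBound k φ M' :=
  ⟨h.contDiff, h.periodic, fun i hi x => (h.bound i hi x).trans hM⟩

theorem of_le {j : ℕ} (h : CkBound k φ M) (hj : j ≤ k) : CkBound j φ M :=
  ⟨h.contDiff.of_le (by exact_mod_cast hj), h.periodic, fun i hi => h.bound i (hi.trans hj)⟩

theorem zero_iff : CkBound 0 φ M ↔ Continuous φ ∧ Function.Periodic φ 1 ∧ ∀ x, |φ x| ≤ M := by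
  refine ⟨fun h => ⟨h.continuous, h.periodic, h.abs_le⟩, fun ⟨hc, hp, hb⟩ =>
    ⟨contDiff_zero.2 hc, hp, fun i hi x => ?_⟩⟩
  obtain rfl : i = 0 := Nat.le_zero.1 hi
  simpa using hb x

theorem succ_iff : CkBound (k + 1) φ M ↔ Differentiable ℝ φ ∧ Function.Periodic φ 1 ∧
    (∀ x, |φ x| ≤ M) ∧ CkBound k (deriv φ) M := by
  constructor
  · intro h
    obtain ⟨hd, hd'⟩ := contDiff_succ_iff_differentiable.1 h.contDiff
    refine ⟨hd, h.periodic, h.abs_le, hd', periodic_deriv h.periodic, fun i hi x => ?_⟩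
    rw [← iteratedDeriv_succ']
    exact h.bound (i + 1) (Nat.succ_le_succ hi) x
  · rintro ⟨hd, hp, hb, h⟩
    refine ⟨contDiff_succ_iff_differentiable.2 ⟨hd, h.contDiff⟩, hp, fun i hi x => ?_⟩
    cases i with
    | zero => simpa using hb x
    | succ i =>
      rw [iteratedDeriv_succ']
      exact h.bound i (Nat.le_of_succ_le_succ hi) x

theorem succ_of_deriv (hd : Differentiable ℝ φ) (h : CkBound 0 φ M)
    (h' : CkBound k (deriv φ) M') : CkBound (k + 1) φ (M + M') :=
  succ_iff.2 ⟨hd, h.periodic, fun x => (h.abs_le x).trans (by linarith [h'.nonneg]),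
    h'.mono (by linarith [h.nonneg])⟩

theorem differentiable (h : CkBound (k + 1) φ M) : Differentiable ℝ φ := (succ_iff.1 h).1

protected theorem deriv (h : CkBound (k + 1) φ M) : CkBound k (deriv φ) M := (succ_iff.1 h).2.2.2

theorem abs_deriv_le (h : CkBound (k + 1) φ M) (x : ℝ) : |deriv φ x| ≤ M := h.deriv.abs_le x

theorem contDiff_one (h : CkBound (k + 1) φ M) : ContDiff ℝ 1 φ := by
  exact_mod_cast (h.of_le (j := 1) (Nat.le_add_left 1 k)).contDiff

theorem abs_sub_le (h : CkBound (k + 1) φ M) (x y : ℝ) : |φ x - φ y| ≤ M * |x - y| :=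
  abs_sub_le_of_abs_deriv_le h.differentiable h.abs_deriv_le x y

theorem const (k : ℕ) (c : ℝ) : CkBound k (fun _ => c) |c| := by
  refine ⟨contDiff_const, fun _ => rfl, fun i _ x => ?_⟩
  rw [iteratedDeriv_const]
  split_ifs <;> simp

theorem add (h : CkBound k φ M) (h' : CkBound k ψ M') :
    CkBound k (fun x => φ x + ψ x) (M + M') := by
  refine ⟨h.contDiff.add h'.contDiff, h.periodic.add h'.periodic, fun i hi x => ?_⟩
  rw [iteratedDeriv_fun_add (h.contDiff.contDiffAt.of_le (by exact_mod_cast hi))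
    (h'.contDiff.contDiffAt.of_le (by exact_mod_cast hi))]
  exact (abs_add_le _ _).trans (add_le_add (h.bound i hi x) (h'.bound i hi x))

theorem const_mul (h : CkBound k φ M) (c : ℝ) : CkBound k (fun x => c * φ x) (|c| * M) := by
  refine ⟨contDiff_const.mul h.contDiff, fun x => by simp only [h.periodic x], fun i hi x => ?_⟩
  rw [iteratedDeriv_const_mul_field, abs_mul]
  exact mul_le_mul_of_nonneg_left (h.bound i hi x) (abs_nonneg _)

theorem neg (h : CkBound k φ M) : CkBound k (fun x => -φ x) M := by
  simpa using h.const_mul (-1)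

theorem sub (h : CkBound k φ M) (h' : CkBound k ψ M') :
    CkBound k (fun x => φ x - ψ x) (M + M') := by
  simpa only [sub_eq_add_neg] using h.add h'.neg

theorem mul (h : CkBound k φ M) (h' : CkBound k ψ M') :
    CkBound k (fun x => φ x * ψ x) (2 ^ k * (M * M')) := by
  have hsup (x : ℝ) : |φ x * ψ x| ≤ M * M' := by
    rw [abs_mul]
    exact mul_le_mul (h.abs_le x) (h'.abs_le x) (abs_nonneg _) h.nonneg
  induction k generalizing φ ψ with
  | zero =>
    exact zero_iff.2 ⟨h.continuous.mul h'.continuous, h.periodic.mul h'.periodic,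
      by simpa only [pow_zero, one_mul] using hsup⟩
  | succ k ih =>
    have hderiv : deriv (fun x => φ x * ψ x) = fun x => deriv φ x * ψ x + φ x * deriv ψ x :=
      funext fun x => deriv_fun_mul (h.differentiable x) (h'.differentiable x)
    have hleft := ih h.deriv (h'.of_le k.le_succ) fun x => by
      rw [abs_mul]
      exact mul_le_mul (h.abs_deriv_le x) (h'.abs_le x) (abs_nonneg _) h.nonneg
    have hright := ih (h.of_le k.le_succ) h'.deriv fun x => by
      rw [abs_mul]
      exact mul_le_mul (h.abs_le x) (h'.abs_deriv_le x) (abs_nonneg _) h.nonneg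
    refine succ_iff.2 ⟨h.differentiable.mul h'.differentiable, h.periodic.mul h'.periodic,
      fun x => (hsup x).trans ?_, ?_⟩
    · exact le_mul_of_one_le_left (mul_nonneg h.nonneg h'.nonneg) (one_le_pow₀ one_le_two)
    · rw [hderiv]
      exact (hleft.add hright).mono (by rw [pow_succ]; linarith)

end CkBound

theorem exists_ckBound {k : ℕ} {φ : ℝ → ℝ} (hφ : ContDiff ℝ k φ) (hp : Function.Periodic φ 1) :
    ∃ M, CkBound k φ M := by
  obtain ⟨M, hM⟩ := exists_forall_abs_le_of_periodic hφ.continuous one_ne_zero hp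
  induction k generalizing φ M with
  | zero => exact ⟨M, CkBound.zero_iff.2 ⟨hφ.continuous, hp, hM⟩⟩
  | succ k ih =>
    obtain ⟨hd, hφ'⟩ := contDiff_succ_iff_differentiable.1 hφ
    obtain ⟨N, hN⟩ :=
      exists_forall_abs_le_of_periodic hφ'.continuous one_ne_zero (periodic_deriv hp)
    obtain ⟨M', hM'⟩ := ih hφ' (periodic_deriv hp) N hN
    exact ⟨M + M', CkBound.succ_of_deriv hd (CkBound.zero_iff.2 ⟨hφ.continuous, hp, hM⟩) hM'⟩

/-! ### Transfer operators on periodic functions -/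

/-- Transfer operators of circle maps, acting on functions on `ℝ`; the weight `a` is the
reciprocal `1 / F'` of the derivative of the map. -/
structure IsTransfer (a : ℝ → ℝ) (T : (ℝ → ℝ) → ℝ → ℝ) : Prop where
  add : ∀ φ ψ : ℝ → ℝ, T (fun x => φ x + ψ x) = fun x => T φ x + T ψ x
  const_mul : ∀ (c : ℝ) (φ : ℝ → ℝ), T (fun x => c * φ x) = fun x => c * T φ x
  map_nonneg : ∀ φ : ℝ → ℝ, (∀ x, 0 ≤ φ x) → ∀ x, 0 ≤ T φ x
  periodic : ∀ φ : ℝ → ℝ, Function.Periodic φ 1 → Function.Periodic (T φ) 1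
  continuous : ∀ φ : ℝ → ℝ, Continuous φ → Continuous (T φ)
  hasDerivAt : ∀ φ : ℝ → ℝ, ContDiff ℝ 1 φ → ∀ x,
    HasDerivAt (T φ) (T (deriv fun y => a y * φ y) x) x
  integral : ∀ φ : ℝ → ℝ, Continuous φ → Function.Periodic φ 1 →
    ∫ x in (0 : ℝ)..1, T φ x = ∫ x in (0 : ℝ)..1, φ x

/-- A transfer operator which is bounded on `C^k`, with control only on its value at the constant
function `1` and on its weight. -/
structure IsBoundedTransfer (k : ℕ) (A : ℝ) (a : ℝ → ℝ) (T : (ℝ → ℝ) → ℝ → ℝ) : Prop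
    extends IsTransfer a T where
  map_one_le : ∀ x, T (fun _ => 1) x ≤ A
  weight : CkBound k a A

namespace IsTransfer

variable {a : ℝ → ℝ} {T : (ℝ → ℝ) → ℝ → ℝ} {φ ψ : ℝ → ℝ}

theorem neg (h : IsTransfer a T) (φ : ℝ → ℝ) : T (fun x => -φ x) = fun x => -T φ x := by
  simpa using h.const_mul (-1) φ

theorem sub (h : IsTransfer a T) (φ ψ : ℝ → ℝ) :
    T (fun x => φ x - ψ x) = fun x => T φ x - T ψ x := by
  simpa only [sub_eq_add_neg, h.neg] using h.add φ fun x => -ψ x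

theorem mono (h : IsTransfer a T) (hle : ∀ x, φ x ≤ ψ x) (x : ℝ) : T φ x ≤ T ψ x := by
  have hsub := h.map_nonneg (fun x => ψ x - φ x) (fun x => sub_nonneg.2 (hle x)) x
  rwa [h.sub, sub_nonneg] at hsub

theorem abs_le (h : IsTransfer a T) (φ : ℝ → ℝ) (x : ℝ) : |T φ x| ≤ T (fun y => |φ y|) x := by
  refine abs_le'.2 ⟨h.mono (fun y => le_abs_self (φ y)) x, ?_⟩
  have hneg := h.mono (fun y => neg_le_abs (φ y)) x
  rwa [h.neg] at hneg

theorem abs_mul_le (h : IsTransfer a T) {b : ℝ → ℝ} {B θ : ℝ} (hb : ∀ x, T (fun y => |b y|) x ≤ θ)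
    (hφ : ∀ x, |φ x| ≤ B) (x : ℝ) : |T (fun y => b y * φ y) x| ≤ θ * B := by
  have hB : 0 ≤ B := (abs_nonneg _).trans (hφ 0)
  have hle : T (fun y => |b y * φ y|) x ≤ T (fun y => B * |b y|) x := h.mono (fun y => by
    rw [abs_mul, mul_comm]
    exact mul_le_mul_of_nonneg_right (hφ y) (abs_nonneg _)) x
  rw [h.const_mul] at hle
  rw [mul_comm θ]
  exact (h.abs_le _ x).trans (hle.trans (mul_le_mul_of_nonneg_left (hb x) hB))

theorem deriv_eq (h : IsTransfer a T) (hφ : ContDiff ℝ 1 φ) :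
    deriv (T φ) = T (deriv fun y => a y * φ y) :=
  funext fun x => (h.hasDerivAt φ hφ x).deriv

theorem differentiable (h : IsTransfer a T) (hφ : ContDiff ℝ 1 φ) : Differentiable ℝ (T φ) :=
  fun x => (h.hasDerivAt φ hφ x).differentiableAt

theorem contDiff_one (h : IsTransfer a T) (ha : ContDiff ℝ 1 a) (hφ : ContDiff ℝ 1 φ) :
    ContDiff ℝ 1 (T φ) := by
  refine contDiff_one_iff_deriv.2 ⟨h.differentiable hφ, ?_⟩
  rw [h.deriv_eq hφ]
  exact h.continuous _ ((ha.mul hφ).continuous_deriv le_rfl)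

theorem deriv_mul_eq (h : IsTransfer a T) {b : ℝ → ℝ} (ha : ContDiff ℝ 1 a) (hb : ContDiff ℝ 1 b)
    (hφ : ContDiff ℝ 1 φ) (x : ℝ) : deriv (T fun y => b y * φ y) x =
      T (fun y => (a y * b y) * deriv φ y) x +
        T (fun y => deriv (fun z => a z * b z) y * φ y) x := by
  have hab := ha.mul hb
  have hprod : (deriv fun y => a y * (b y * φ y)) =
      fun y => (a y * b y) * deriv φ y + deriv (fun z => a z * b z) y * φ y := by
    ext y
    simp only [← mul_assoc]
    rw [deriv_fun_mul (hab.differentiable one_ne_zero y) (hφ.differentiable one_ne_zero y),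
      add_comm]
  rw [h.deriv_eq (hb.mul hφ), hprod, h.add]

end IsTransfer

namespace IsBoundedTransfer

variable {k : ℕ} {A θ : ℝ} {a φ : ℝ → ℝ} {T : (ℝ → ℝ) → ℝ → ℝ}

theorem of_le {j : ℕ} (h : IsBoundedTransfer k A a T) (hj : j ≤ k) : IsBoundedTransfer j A a T :=
  ⟨h.toIsTransfer, h.map_one_le, h.weight.of_le hj⟩

theorem abs_le_mul (h : IsBoundedTransfer k A a T) {B : ℝ} (hφ : ∀ x, |φ x| ≤ B) (x : ℝ) :
    |T φ x| ≤ A * B := by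
  simpa using h.abs_mul_le (b := fun _ => 1) (by simpa using h.map_one_le) hφ x

end IsBoundedTransfer

theorem exists_ckBound_transfer (k : ℕ) {A : ℝ} (hA : 0 ≤ A) : ∃ C, 0 ≤ C ∧
    ∀ a T, IsBoundedTransfer k A a T →
    ∀ φ M, CkBound k φ M → CkBound k (T φ) (C * M) := by
  induction k with
  | zero =>
    exact ⟨A, hA, fun a T hT φ M hφ => CkBound.zero_iff.2
      ⟨hT.continuous φ hφ.continuous, hT.periodic φ hφ.periodic, hT.abs_le_mul hφ.abs_le⟩⟩
  | succ k ih =>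
    obtain ⟨C, hC, hbound⟩ := ih
    refine ⟨A + C * (2 ^ (k + 1) * A), by positivity, fun a T hT φ M hφ => ?_⟩
    have hsup : CkBound 0 (T φ) (A * M) := CkBound.zero_iff.2
      ⟨hT.continuous φ hφ.continuous, hT.periodic φ hφ.periodic, hT.abs_le_mul hφ.abs_le⟩
    have hderiv := hbound a T (hT.of_le k.le_succ) _ _ (hT.weight.mul hφ).deriv
    rw [← hT.deriv_eq hφ.contDiff_one] at hderiv
    exact (CkBound.succ_of_deriv (hT.differentiable hφ.contDiff_one) hsup hderiv).mono
      (by linarith)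

/-- In the `k`-th derivative of `T (b φ)`, the term containing the `k`-th derivative of `φ` is
`T (a ^ k b ∂^k φ)`. -/
theorem exists_abs_iteratedDeriv_succ_transfer_le (k : ℕ) {A : ℝ} (hA : 0 ≤ A) {A' : ℝ}
    (hA' : 0 ≤ A') : ∃ C, 0 ≤ C ∧
    ∀ a T, IsBoundedTransfer (k + 1) A a T → (∀ x, |a x| ≤ 1) →
    ∀ b θ, CkBound (k + 1) b A' → (∀ x, T (fun y => |a y * b y|) x ≤ θ) →
    ∀ φ M B, ContDiff ℝ (k + 1 : ℕ) φ → CkBound k φ M → (∀ x, |iteratedDeriv (k + 1) φ x| ≤ B) →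
    ∀ x, |iteratedDeriv (k + 1) (T fun y => b y * φ y) x| ≤ θ * B + C * M := by
  induction k generalizing A' with
  | zero =>
    refine ⟨A * (2 ^ 1 * (A * A')), by positivity, fun a T hT _ b θ hb hθ φ M B hφ hM hB x => ?_⟩
    simp only [zero_add, iteratedDeriv_one] at hB ⊢
    rw [hT.deriv_mul_eq hT.weight.contDiff_one hb.contDiff_one (by exact_mod_cast hφ)]
    refine (abs_add_le _ _).trans (add_le_add (hT.abs_mul_le hθ hB x) ?_)
    have hlow (y : ℝ) : |deriv (fun z => a z * b z) y * φ y| ≤ 2 ^ 1 * (A * A') * M := by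
      rw [abs_mul]
      exact mul_le_mul ((hT.weight.mul hb).abs_deriv_le y) (hM.abs_le y) (abs_nonneg _)
        (by positivity)
    exact (hT.abs_le_mul hlow x).trans_eq (by ring)
  | succ k ih =>
    obtain ⟨C, hC, htop⟩ := ih (A' := 2 ^ (k + 2) * (A * A')) (by positivity)
    obtain ⟨D, hD, hbound⟩ := exists_ckBound_transfer (k + 1) hA
    refine ⟨C + D * (2 ^ (k + 1) * (2 ^ (k + 2) * (A * A'))), by positivity,
      fun a T hT ha b θ hb hθ φ M B hφ hM hB x => ?_⟩
    have hab := hT.weight.mul hb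
    have hT' := hT.of_le (k + 1).le_succ
    obtain ⟨-, hφ'⟩ := contDiff_succ_iff_differentiable.1 hφ
    have habs (y : ℝ) : T (fun z => |a z * (a z * b z)|) y ≤ θ :=
      (hT.mono (fun z => by
        rw [abs_mul]
        exact mul_le_of_le_one_left (abs_nonneg _) (ha z)) y).trans (hθ y)
    have hlead := htop a T hT' ha (fun y => a y * b y) θ (hab.of_le (k + 1).le_succ) habs
      (deriv φ) M B hφ' hM.deriv (by simpa only [← iteratedDeriv_succ'] using hB) x
    have hlow : CkBound (k + 1) (T fun y => deriv (fun z => a z * b z) y * φ y) _ :=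
      hbound a T hT' _ _ (hab.deriv.mul hM)
    have hmain : CkBound (k + 1) (T fun y => (a y * b y) * deriv φ y) _ :=
      hbound a T hT' _ _ ((hab.of_le (k + 1).le_succ).mul
        (exists_ckBound hφ' (periodic_deriv hM.periodic)).choose_spec)
    rw [iteratedDeriv_succ', funext (hT.deriv_mul_eq hT.weight.contDiff_one hb.contDiff_one
      hM.contDiff_one), iteratedDeriv_fun_add hmain.contDiff.contDiffAt hlow.contDiff.contDiffAt]
    refine (abs_add_le _ _).trans ((add_le_add hlead (hlow.bound (k + 1) le_rfl x)).trans_eq ?_)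
    ring

/-! ### Decay of zero-mean functions under contracting transfer operators -/

/-- The lifted transfer operator of an expanding circle map with small distortion. -/
structure IsContracting (k : ℕ) (A θ : ℝ) (a : ℝ → ℝ) (T : (ℝ → ℝ) → ℝ → ℝ) : Prop
    extends IsBoundedTransfer k A a T where
  abs_weight_le_one : ∀ x, |a x| ≤ 1
  distortion : ∀ x, T (fun y => |a y| + |deriv a y|) x ≤ θ

theorem CkBound.tsum {k : ℕ} {G : ℕ → ℝ → ℝ} {v : ℕ → ℝ} (h : ∀ n, CkBound k (G n) (v n))
    (hv : Summable v) : CkBound k (fun x => ∑' n, G n x) (∑' n, v n) := by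
  have hsum (x : ℝ) : |∑' n, G n x| ≤ ∑' n, v n :=
    tsum_of_norm_bounded (f := fun n => G n x) hv.hasSum fun n => (h n).abs_le x
  induction k generalizing G with
  | zero =>
    exact CkBound.zero_iff.2 ⟨continuous_tsum (fun n => (h n).continuous) hv fun n => (h n).abs_le,
      fun x => by simp only [(h _).periodic x], hsum⟩
  | succ k ih =>
    have hderiv : (deriv fun x => ∑' n, G n x) = fun x => ∑' n, deriv (G n) x :=
      deriv_tsum (y₀ := 0) hv (fun n => (h n).differentiable) (fun n => (h n).abs_deriv_le)
        (hv.of_norm_bounded fun n => (h n).abs_le 0)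
    refine CkBound.succ_iff.2 ⟨?_, fun x => by simp only [(h _).periodic x], hsum, ?_⟩
    · exact differentiable_tsum' hv (fun n y => ((h n).differentiable y).hasDerivAt)
        fun n => (h n).abs_deriv_le
    · rw [hderiv]
      exact ih (fun n => (h n).deriv) fun x =>
        tsum_of_norm_bounded (f := fun n => deriv (G n) x) hv.hasSum fun n => (h n).abs_deriv_le x

theorem CkBound.succ_of_iteratedDeriv {k : ℕ} {φ : ℝ → ℝ} {M B : ℝ}
    (hφ : ContDiff ℝ (k + 1 : ℕ) φ) (h : CkBound k φ M)
    (hB : ∀ x, |iteratedDeriv (k + 1) φ x| ≤ B) (hM : M ≤ B) : CkBound (k + 1) φ B :=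
  ⟨hφ, h.periodic, fun i hi x => by
    rcases Nat.lt_succ_iff_lt_or_eq.1 (Nat.lt_succ_of_le hi) with hlt | rfl
    · exact (h.bound i (Nat.le_of_lt_succ hlt) x).trans hM
    · exact hB x⟩

namespace IsTransfer

variable {a φ ψ : ℝ → ℝ} {T : (ℝ → ℝ) → ℝ → ℝ}

theorem iterate_sub (h : IsTransfer a T) (φ ψ : ℝ → ℝ) (n : ℕ) :
    T^[n] (fun x => φ x - ψ x) = fun x => T^[n] φ x - T^[n] ψ x := by
  induction n with
  | zero => rfl
  | succ n ih => simp only [Function.iterate_succ_apply', ih, h.sub]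

theorem iterate_nonneg (h : IsTransfer a T) (hφ : ∀ x, 0 ≤ φ x) (n : ℕ) (x : ℝ) :
    0 ≤ T^[n] φ x := by
  induction n generalizing x with
  | zero => exact hφ x
  | succ n ih =>
    rw [Function.iterate_succ_apply']
    exact h.map_nonneg _ ih x

theorem iterate_continuous (h : IsTransfer a T) (hφ : Continuous φ) (n : ℕ) :
    Continuous (T^[n] φ) := by
  induction n with
  | zero => exact hφ
  | succ n ih =>
    rw [Function.iterate_succ_apply']
    exact h.continuous _ ih

theorem iterate_periodic (h : IsTransfer a T) (hφ : Function.Periodic φ 1) (n : ℕ) :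
    Function.Periodic (T^[n] φ) 1 := by
  induction n with
  | zero => exact hφ
  | succ n ih =>
    rw [Function.iterate_succ_apply']
    exact h.periodic _ ih

theorem integral_iterate (h : IsTransfer a T) (hφ : Continuous φ) (hp : Function.Periodic φ 1)
    (n : ℕ) : ∫ x in (0 : ℝ)..1, T^[n] φ x = ∫ x in (0 : ℝ)..1, φ x := by
  induction n with
  | zero => rfl
  | succ n ih =>
    simp only [Function.iterate_succ_apply']
    rw [h.integral _ (h.iterate_continuous hφ n) (h.iterate_periodic hp n), ih]

theorem integral_abs_iterate_le (h : IsTransfer a T) (hφ : Continuous φ)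
    (hp : Function.Periodic φ 1) (n : ℕ) :
    ∫ x in (0 : ℝ)..1, |T^[n] φ x| ≤ ∫ x in (0 : ℝ)..1, |φ x| := by
  induction n with
  | zero => rfl
  | succ n ih =>
    have hc := h.iterate_continuous hφ n
    simp only [Function.iterate_succ_apply']
    refine le_trans ?_ ih
    rw [← h.integral _ hc.abs fun x => by simp only [h.iterate_periodic hp n x]]
    exact intervalIntegral.integral_mono_on zero_le_one
      ((h.continuous _ hc).abs.intervalIntegrable _ _)
      ((h.continuous _ hc.abs).intervalIntegrable _ _) fun x _ => h.abs_le _ x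

end IsTransfer

namespace IsContracting

variable {k : ℕ} {A θ M : ℝ} {a φ : ℝ → ℝ} {T : (ℝ → ℝ) → ℝ → ℝ}

theorem of_le {j : ℕ} (h : IsContracting k A θ a T) (hj : j ≤ k) : IsContracting j A θ a T :=
  ⟨h.toIsBoundedTransfer.of_le hj, h.abs_weight_le_one, h.distortion⟩

theorem map_abs_weight_le (h : IsContracting k A θ a T) (x : ℝ) : T (fun y => |a y|) x ≤ θ :=
  (h.mono (fun _ => le_add_of_nonneg_right (abs_nonneg _)) x).trans (h.distortion x)

theorem nonneg (h : IsContracting k A θ a T) : 0 ≤ θ :=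
  (h.map_nonneg _ (fun _ => abs_nonneg _) 0).trans (h.map_abs_weight_le 0)

theorem ckBound_one_transfer (h : IsContracting 1 A θ a T) (hφ : CkBound 1 φ M)
    (h0 : ∫ x in (0 : ℝ)..1, φ x = 0) : CkBound 1 (T φ) (θ * M) := by
  have ha := h.weight.contDiff_one
  have hweight (y : ℝ) : |deriv (fun z => a z * φ z) y| ≤ M * (|a y| + |deriv a y|) := by
    rw [deriv_fun_mul (h.weight.differentiable y) (hφ.differentiable y)]
    refine (abs_add_le _ _).trans ?_
    rw [abs_mul, abs_mul, mul_add, mul_comm |deriv a y|, mul_comm |a y|, add_comm]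
    gcongr
    exacts [hφ.abs_deriv_le y, hφ.abs_le y]
  have hderiv (x : ℝ) : |deriv (T φ) x| ≤ θ * M := by
    rw [h.deriv_eq hφ.contDiff_one]
    refine (h.abs_le _ x).trans ((h.mono hweight x).trans ?_)
    rw [h.const_mul, mul_comm θ]
    exact mul_le_mul_of_nonneg_left (h.distortion x) hφ.nonneg
  have hd := h.differentiable hφ.contDiff_one
  have hc1 := h.contDiff_one ha hφ.contDiff_one
  have hp := h.periodic _ hφ.periodic
  refine CkBound.succ_iff.2 ⟨hd, hp, ?_, CkBound.zero_iff.2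
    ⟨hc1.continuous_deriv le_rfl, periodic_deriv hp, hderiv⟩⟩
  exact abs_le_of_integral_eq_zero hc1.continuous hp (abs_sub_le_of_abs_deriv_le hd hderiv)
    (by rw [h.integral _ hφ.continuous hφ.periodic, h0])

end IsContracting

theorem exists_abs_iteratedDeriv_contracting_le (k : ℕ) {A : ℝ} (hA : 0 ≤ A) : ∃ C, 0 ≤ C ∧
    ∀ θ a T, IsContracting (k + 1) A θ a T → ∀ φ M B, ContDiff ℝ (k + 1 : ℕ) φ → CkBound k φ M →
    (∀ x, |iteratedDeriv (k + 1) φ x| ≤ B) →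
    ∀ x, |iteratedDeriv (k + 1) (T φ) x| ≤ θ * B + C * M := by
  obtain ⟨C, hC, h⟩ := exists_abs_iteratedDeriv_succ_transfer_le k hA zero_le_one
  refine ⟨C, hC, fun θ a T hT φ M B hφ hM hB => ?_⟩
  simpa using h a T hT.toIsBoundedTransfer hT.abs_weight_le_one (fun _ => 1) θ
    (by simpa using CkBound.const (k + 1) 1) (by simpa using hT.map_abs_weight_le) φ M B hφ hM hB

theorem exists_ckBound_iterate_succ (k : ℕ) {A θ s C : ℝ} (hA : 0 ≤ A) (hs : 0 ≤ s) (hθ : θ < s)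
    (hC : 0 ≤ C) : ∃ D, 0 ≤ D ∧ ∀ a T, IsContracting (k + 1) A θ a T →
    ∀ φ M, CkBound (k + 1) φ M → (∀ n, CkBound k (T^[n] φ) (C * s ^ n * M)) →
    ∀ n, CkBound (k + 1) (T^[n] φ) (D * s ^ n * M) := by
  obtain ⟨E, hE, htop⟩ := exists_abs_iteratedDeriv_contracting_le k hA
  obtain ⟨F, -, hbound⟩ := exists_ckBound_transfer (k + 1) hA
  have hθs : 0 < s - θ := sub_pos.2 hθ
  -- The choice of `D` gives `θ D + E C ≤ s D`, so that the bound propagates along the iteration.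
  set D : ℝ := 1 + C + E * C / (s - θ)
  have hEC : 0 ≤ E * C / (s - θ) := by positivity
  have hDE : θ * D + E * C ≤ s * D := by
    have hle : E * C ≤ D * (s - θ) := (div_le_iff₀ hθs).1 (by linarith)
    linarith
  refine ⟨D, by positivity, fun a T hT φ M hφ hlow n => ?_⟩
  induction n with
  | zero =>
    refine hφ.mono (le_mul_of_one_le_left hφ.nonneg ?_)
    rw [pow_zero, mul_one]
    linarith
  | succ n ih =>
    have hnext := hbound a T hT.toIsBoundedTransfer _ _ ih
    rw [← Function.iterate_succ_apply' T] at hnext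
    refine .succ_of_iteratedDeriv hnext.contDiff (hlow (n + 1)) (fun x => ?_) ?_
    · rw [Function.iterate_succ_apply']
      refine (htop θ a T hT _ _ _ ih.contDiff (hlow n) (ih.bound (k + 1) le_rfl) x).trans ?_
      have hscale := mul_le_mul_of_nonneg_left hDE (mul_nonneg (pow_nonneg hs n) hφ.nonneg)
      rw [pow_succ]
      linarith
    · have := hφ.nonneg
      gcongr
      linarith

theorem exists_ckBound_iterate (k : ℕ) {A θ : ℝ} (hA : 0 ≤ A) (h0 : 0 ≤ θ) (h1 : θ < 1) :
    ∃ C r : ℝ, 0 ≤ C ∧ 0 ≤ r ∧ r < 1 ∧ ∀ a T, IsContracting (k + 1) A θ a T →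
    ∀ φ M, CkBound (k + 1) φ M → (∫ x in (0 : ℝ)..1, φ x = 0) →
    ∀ n, CkBound (k + 1) (T^[n] φ) (C * r ^ n * M) := by
  induction k with
  | zero =>
    refine ⟨1, θ, zero_le_one, h0, h1, fun a T hT φ M hφ hφ0 n => ?_⟩
    induction n with
    | zero => simpa using hφ
    | succ n ih =>
      rw [Function.iterate_succ_apply']
      exact (hT.ckBound_one_transfer ih
        (by rw [hT.integral_iterate hφ.continuous hφ.periodic, hφ0])).mono
        (by rw [pow_succ]; linarith)
  | succ k ih =>
    obtain ⟨C, r, hC, hr0, hr1, hlow⟩ := ih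
    obtain ⟨s, hs, hs1⟩ := exists_between (max_lt hr1 h1)
    have hrs : r ≤ s := (le_max_left r θ).trans hs.le
    have hs0 : 0 ≤ s := hr0.trans hrs
    obtain ⟨D, hD, hiterate⟩ :=
      exists_ckBound_iterate_succ (k + 1) hA hs0 ((le_max_right r θ).trans_lt hs) hC
    refine ⟨D, s, hD, hs0, hs1, fun a T hT φ M hφ hφ0 => hiterate a T hT φ M hφ fun n => ?_⟩
    exact (hlow a T (hT.of_le (k + 1).le_succ) φ M (hφ.of_le (k + 1).le_succ) hφ0 n).mono
      (by have := hφ.nonneg; gcongr)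

/-! ### Solving `φ - T φ = g` on zero-mean functions -/

theorem uniformContinuous_of_periodic {φ : ℝ → ℝ} (hφ : Continuous φ)
    (hp : Function.Periodic φ 1) : UniformContinuous φ := by
  have hlift : Continuous (hp.lift : UnitAddCircle → ℝ) := continuous_coinduced_dom.2 hφ
  exact (CompactSpace.uniformContinuous_of_continuous hlift).comp
    (uniformContinuous_addMonoidHom_of_continuous
      (f := QuotientAddGroup.mk' (AddSubgroup.zmultiples (1 : ℝ))) continuous_quotient_mk')

theorem periodic_intervalIntegral {φ : ℝ → ℝ} (hφ : Continuous φ) (hp : Function.Periodic φ 1)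
    (h0 : ∫ x in (0 : ℝ)..1, φ x = 0) :
    Function.Periodic (fun x => ∫ y in (0 : ℝ)..x, φ y) 1 := fun x => by
  have hadd := intervalIntegral.integral_add_adjacent_intervals (a := 0) (b := x) (c := x + 1)
    (hφ.intervalIntegrable (μ := volume) _ _) (hφ.intervalIntegrable _ _)
  rw [hp.intervalIntegral_add_eq x 0, zero_add, h0, add_zero] at hadd
  exact hadd.symm

theorem abs_sub_average_le {φ : ℝ → ℝ} {ε δ : ℝ} (hφ : Continuous φ) (hδ : 0 < δ) {x : ℝ}
    (h : ∀ y ∈ Ioc x (x + δ), |φ x - φ y| ≤ ε) : |φ x - δ⁻¹ * ∫ y in x..x + δ, φ y| ≤ ε := by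
  have hdiff : ∫ y in x..x + δ, (φ x - φ y) = δ * (φ x - δ⁻¹ * ∫ y in x..x + δ, φ y) := by
    rw [intervalIntegral.integral_sub (by simp) (hφ.intervalIntegrable _ _)]
    simp [mul_sub, hδ.ne']
  have hle := intervalIntegral.norm_integral_le_of_norm_le_const (a := x) (b := x + δ)
    (f := fun y => φ x - φ y) (C := ε) fun y hy => by
      rw [uIoc_of_le (by linarith)] at hy
      exact h y hy
  rw [hdiff, add_sub_cancel_left, norm_mul, Real.norm_eq_abs, Real.norm_eq_abs, abs_of_pos hδ,
    mul_comm ε] at hle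
  exact le_of_mul_le_mul_left hle hδ

theorem exists_contDiff_abs_sub_le {φ : ℝ → ℝ} (hφ : Continuous φ) (hp : Function.Periodic φ 1)
    (h0 : ∫ x in (0 : ℝ)..1, φ x = 0) {ε : ℝ} (hε : 0 < ε) :
    ∃ ψ : ℝ → ℝ, ContDiff ℝ 1 ψ ∧ Function.Periodic ψ 1 ∧ (∫ x in (0 : ℝ)..1, ψ x = 0) ∧
      ∀ x, |φ x - ψ x| ≤ ε := by
  obtain ⟨r, hr, hunif⟩ := Metric.uniformContinuous_iff.1 (uniformContinuous_of_periodic hφ hp) ε hε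
  obtain ⟨δ, hδ, hδr⟩ := exists_between hr
  set W : ℝ → ℝ := fun x => ∫ y in (0 : ℝ)..x, φ y
  have hWd (x : ℝ) : HasDerivAt W (φ x) x :=
    intervalIntegral.integral_hasDerivAt_right (hφ.intervalIntegrable _ _)
      (hφ.stronglyMeasurableAtFilter _ _) hφ.continuousAt
  have hWp : Function.Periodic W 1 := periodic_intervalIntegral hφ hp h0
  have hWc : ContDiff ℝ 1 W :=
    contDiff_one_iff_deriv.2 ⟨fun x => (hWd x).differentiableAt, by
      rwa [funext fun x => (hWd x).deriv]⟩
  have hWδ (x : ℝ) : W (x + δ) - W x = ∫ y in x..x + δ, φ y :=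
    intervalIntegral.integral_interval_sub_left (hφ.intervalIntegrable _ _)
      (hφ.intervalIntegrable _ _)
  refine ⟨fun x => δ⁻¹ * (W (x + δ) - W x), by fun_prop, fun x => ?_, ?_, fun x => ?_⟩
  · simp only [add_right_comm x 1 δ, hWp _]
  · have hshift : Continuous fun x => W (x + δ) := hWc.continuous.comp (by fun_prop)
    rw [intervalIntegral.integral_const_mul, intervalIntegral.integral_sub
      (hshift.intervalIntegrable _ _) (hWc.continuous.intervalIntegrable _ _),
      intervalIntegral.integral_comp_add_right, zero_add, add_comm 1 δ,
      hWp.intervalIntegral_add_eq δ 0, zero_add, sub_self, mul_zero]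
  · simp only [hWδ]
    refine abs_sub_average_le hφ hδ fun y hy => (hunif ?_).le
    rw [Real.dist_eq, abs_sub_comm, abs_of_nonneg (by linarith [hy.1])]
    linarith [hy.2]

theorem eq_zero_of_integral_abs_eq_zero {φ : ℝ → ℝ} (hφ : Continuous φ)
    (hp : Function.Periodic φ 1) (h : ∫ x in (0 : ℝ)..1, |φ x| = 0) (x : ℝ) : φ x = 0 := by
  by_contra hx
  have hp' : Function.Periodic (fun x => |φ x|) 1 := fun x => by simp only [hp x]
  have hpos : 0 < ∫ y in x..x + 1, |φ y| :=
    intervalIntegral.integral_pos (by linarith) hφ.abs.continuousOn (fun _ _ => abs_nonneg _)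
      ⟨x, ⟨le_rfl, by linarith⟩, abs_pos.2 hx⟩
  rw [hp'.intervalIntegral_add_eq x 0, zero_add, h] at hpos
  exact hpos.false

theorem integral_abs_le {φ : ℝ → ℝ} {M : ℝ} (hφ : Continuous φ) (h : ∀ x, |φ x| ≤ M) :
    ∫ x in (0 : ℝ)..1, |φ x| ≤ M := by
  simpa using intervalIntegral.integral_mono_on (μ := volume) zero_le_one
    (hφ.abs.intervalIntegrable _ _) (intervalIntegrable_const (c := M)) fun x _ => h x

theorem IsBoundedTransfer.hasSum {k : ℕ} {A : ℝ} {a : ℝ → ℝ} {T : (ℝ → ℝ) → ℝ → ℝ}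
    (hT : IsBoundedTransfer k A a T) {G : ℕ → ℝ → ℝ} {v : ℕ → ℝ} (hv : Summable v)
    (hG : ∀ n x, |G n x| ≤ v n) (x : ℝ) :
    HasSum (fun n => T (G n) x) (T (fun y => ∑' n, G n y) x) := by
  have hGs (y : ℝ) : Summable fun n => G n y := hv.of_norm_bounded fun n => hG n y
  have htail (n : ℕ) (y : ℝ) :
      |∑' i, G i y - ∑ i ∈ Finset.range n, G i y| ≤ ∑' i, v (i + n) := by
    rw [← (hGs y).sum_add_tsum_nat_add n, add_sub_cancel_left]
    exact tsum_of_norm_bounded (f := fun i => G (i + n) y) ((summable_nat_add_iff n).2 hv).hasSum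
      fun i => hG (i + n) y
  have hpart (n : ℕ) :
      T (fun y => ∑ i ∈ Finset.range n, G i y) = fun y => ∑ i ∈ Finset.range n, T (G i) y := by
    induction n with
    | zero => simpa using hT.const_mul 0 (fun _ => 0)
    | succ n ih => simp only [Finset.sum_range_succ, hT.add, ih]
  refine ((hv.mul_left A).of_norm_bounded
    fun n => hT.abs_le_mul (hG n) x).hasSum_iff_tendsto_nat.2 ?_
  rw [tendsto_iff_norm_sub_tendsto_zero]
  refine squeeze_zero (fun _ => norm_nonneg _) (fun n => ?_)
    (by simpa using (tendsto_sum_nat_add v).const_mul A)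
  have htailT := hT.abs_le_mul (htail n) x
  rw [hT.sub, hpart] at htailT
  rwa [Real.norm_eq_abs, abs_sub_comm]

theorem integral_tsum_eq_zero {G : ℕ → ℝ → ℝ} {v : ℕ → ℝ} (hv : Summable v)
    (hc : ∀ n, Continuous (G n)) (hG : ∀ n x, |G n x| ≤ v n)
    (h0 : ∀ n, ∫ x in (0 : ℝ)..1, G n x = 0) : ∫ x in (0 : ℝ)..1, ∑' n, G n x = 0 := by
  have hsum := intervalIntegral.hasSum_integral_of_dominated_convergence (μ := volume)
    (a := 0) (b := 1) (F := G) (f := fun x => ∑' n, G n x) (fun n _ => v n)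
    (fun n => (hc n).aestronglyMeasurable) (fun n => .of_forall fun x _ => hG n x)
    (.of_forall fun _ _ => hv) (by simp)
    (.of_forall fun x _ => (hv.of_norm_bounded fun n => hG n x).hasSum)
  simp only [h0] at hsum
  exact hsum.unique hasSum_zero

section Contracting

variable {k : ℕ} {A θ : ℝ}

theorem exists_sub_transfer_eq (k : ℕ) (hA : 0 ≤ A) (hθ0 : 0 ≤ θ) (hθ : θ < 1) : ∃ C, 0 ≤ C ∧
    ∀ a T, IsContracting (k + 1) A θ a T →
    ∀ g M, CkBound (k + 1) g M → (∫ x in (0 : ℝ)..1, g x = 0) →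
    ∃ φ, CkBound (k + 1) φ (C * M) ∧ (∫ x in (0 : ℝ)..1, φ x = 0) ∧
      ∀ x, φ x - T φ x = g x := by
  obtain ⟨C, r, hC, hr0, hr1, hdecay⟩ := exists_ckBound_iterate k hA hθ0 hθ
  have hgeom : Summable fun n => C * r ^ n := (summable_geometric_of_lt_one hr0 hr1).mul_left C
  refine ⟨∑' n, C * r ^ n, tsum_nonneg fun n => by positivity, fun a T hT g M hg hg0 => ?_⟩
  have hbound (n : ℕ) := hdecay a T hT g M hg hg0 n
  have hsum := hgeom.mul_right M
  refine ⟨fun x => ∑' n, T^[n] g x, ?_, ?_, fun x => ?_⟩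
  · rw [← tsum_mul_right]
    exact CkBound.tsum hbound hsum
  · refine integral_tsum_eq_zero hsum (fun n => (hbound n).continuous)
      (fun n => (hbound n).abs_le) fun n => ?_
    rw [hT.integral_iterate hg.continuous hg.periodic, hg0]
  · have hshift := hT.hasSum hsum (fun n => (hbound n).abs_le) x
    simp only [← Function.iterate_succ_apply' T] at hshift
    have hgx : Summable fun n => T^[n] g x := hsum.of_norm_bounded fun n => (hbound n).abs_le x
    simp only [← hshift.tsum_eq, hgx.tsum_eq_zero_add]
    exact add_sub_cancel_right _ _

namespace IsContracting

variable {a φ : ℝ → ℝ} {T : (ℝ → ℝ) → ℝ → ℝ}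

/-- The iterates of `T` contract the `L^1` norm, and send a `C^1` approximation of `φ` to `0`. -/
theorem eq_zero_of_transfer_eq (hT : IsContracting 1 A θ a T) (hθ : θ < 1) (hφ : Continuous φ)
    (hp : Function.Periodic φ 1) (h0 : ∫ x in (0 : ℝ)..1, φ x = 0) (hfix : T φ = φ) (x : ℝ) :
    φ x = 0 := by
  have hA : 0 ≤ A := hT.weight.nonneg
  obtain ⟨C, r, -, hr0, hr1, hdecay⟩ := exists_ckBound_iterate 0 hA hT.nonneg hθ
  refine eq_zero_of_integral_abs_eq_zero hφ hp (le_antisymm ?_ ?_) x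
  swap; · exact intervalIntegral.integral_nonneg zero_le_one fun _ _ => abs_nonneg _
  refine le_of_forall_pos_le_add fun ε hε => ?_
  obtain ⟨ψ, hψ, hψp, hψ0, hclose⟩ := exists_contDiff_abs_sub_le hφ hp h0 hε
  obtain ⟨M, hM⟩ := exists_ckBound (k := 1) (by exact_mod_cast hψ) hψp
  have hle (n : ℕ) : ∫ x in (0 : ℝ)..1, |φ x| ≤ C * r ^ n * M + ε := by
    have hψn := hdecay a T hT ψ M hM hψ0 n
    have hdiff := (hT.integral_abs_iterate_le (hφ.sub hψ.continuous) (hp.sub hψp) n).trans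
      (integral_abs_le (hφ.sub hψ.continuous) hclose)
    have hφn : T^[n] φ = φ := Function.iterate_fixed hfix n
    have hsub : T^[n] (φ - ψ) = fun x => φ x - T^[n] ψ x := by
      rw [← hφn, ← hT.iterate_sub, hφn]; rfl
    rw [hsub] at hdiff
    have hdc : Continuous fun x => φ x - T^[n] ψ x := hφ.sub hψn.continuous
    have hψle := integral_abs_le hψn.continuous hψn.abs_le
    have htri : ∫ x in (0 : ℝ)..1, |φ x| ≤
        ∫ x in (0 : ℝ)..1, (|T^[n] ψ x| + |φ x - T^[n] ψ x|) :=
      intervalIntegral.integral_mono_on zero_le_one (hφ.abs.intervalIntegrable _ _)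
        ((hψn.continuous.abs.add hdc.abs).intervalIntegrable _ _)
        fun x _ => by simpa using abs_add_le (T^[n] ψ x) (φ x - T^[n] ψ x)
    rw [intervalIntegral.integral_add (hψn.continuous.abs.intervalIntegrable _ _)
      (hdc.abs.intervalIntegrable _ _)] at htri
    linarith
  have hlim : Filter.Tendsto (fun n : ℕ => C * r ^ n * M + ε) Filter.atTop (nhds (C * 0 * M + ε)) :=
    (((tendsto_pow_atTop_nhds_zero_of_lt_one hr0 hr1).const_mul C).mul_const M).add_const ε
  simpa using ge_of_tendsto' hlim hle

end IsContracting

theorem exists_ckBound_of_sub_transfer (k : ℕ) (hA : 0 ≤ A) (hθ0 : 0 ≤ θ) (hθ : θ < 1) :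
    ∃ C, 0 ≤ C ∧ ∀ a T, IsContracting (k + 1) A θ a T →
    ∀ φ M, Continuous φ → Function.Periodic φ 1 → (∫ x in (0 : ℝ)..1, φ x = 0) →
    CkBound (k + 1) (fun x => φ x - T φ x) M → CkBound (k + 1) φ (C * M) := by
  obtain ⟨C, hC, hsolve⟩ := exists_sub_transfer_eq k hA hθ0 hθ
  refine ⟨C, hC, fun a T hT φ M hφ hp h0 hM => ?_⟩
  obtain ⟨ψ, hψ, hψ0, heq⟩ := hsolve a T hT _ M hM (by
    rw [intervalIntegral.integral_sub (hφ.intervalIntegrable _ _)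
      ((hT.continuous _ hφ).intervalIntegrable _ _), hT.integral _ hφ hp, sub_self])
  have hzero := (hT.of_le (Nat.le_add_left 1 k)).eq_zero_of_transfer_eq hθ
    (hφ.sub hψ.continuous) (hp.sub hψ.periodic)
    (by simp [intervalIntegral.integral_sub (hφ.intervalIntegrable _ _)
      (hψ.continuous.intervalIntegrable _ _), h0, hψ0])
    (by
      change T (fun x => φ x - ψ x) = fun x => φ x - ψ x
      rw [hT.sub]
      funext x
      linarith [heq x])
  rwa [show φ = ψ from funext fun x => sub_eq_zero.1 (hzero x)]

/-! ### Invariant densities -/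

/-- Continuous invariant functions of mean one, on the universal cover. -/
structure IsInvariant (T : (ℝ → ℝ) → ℝ → ℝ) (ρ : ℝ → ℝ) : Prop where
  continuous : Continuous ρ
  periodic : Function.Periodic ρ 1
  integral : ∫ x in (0 : ℝ)..1, ρ x = 1
  eq : T ρ = ρ

theorem IsInvariant.integral_sub_one {T : (ℝ → ℝ) → ℝ → ℝ} {ρ : ℝ → ℝ} (h : IsInvariant T ρ) :
    ∫ x in (0 : ℝ)..1, (ρ x - 1) = 0 := by
  rw [intervalIntegral.integral_sub (h.continuous.intervalIntegrable _ _) (by simp), h.integral]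
  simp

theorem IsInvariant.periodic_sub_one {T : (ℝ → ℝ) → ℝ → ℝ} {ρ : ℝ → ℝ} (h : IsInvariant T ρ) :
    Function.Periodic (fun x => ρ x - 1) 1 := fun x => by simp only [h.periodic x]

theorem IsContracting.exists_isInvariant {a : ℝ → ℝ} {T : (ℝ → ℝ) → ℝ → ℝ}
    (hT : IsContracting 1 A θ a T) (hθ : θ < 1) : ∃ ρ, IsInvariant T ρ := by
  have hA : 0 ≤ A := hT.weight.nonneg
  obtain ⟨_, -, hbound⟩ := exists_ckBound_transfer 1 hA
  obtain ⟨_, -, hsolve⟩ := exists_sub_transfer_eq 0 hA hT.nonneg hθ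
  have hone := hbound a T hT.toIsBoundedTransfer _ _ (CkBound.const 1 1)
  obtain ⟨φ, hφ, hφ0, heq⟩ := hsolve a T hT _ _ (hone.sub (CkBound.const 1 1)) (by
    rw [intervalIntegral.integral_sub (hone.continuous.intervalIntegrable _ _) (by simp),
      hT.integral _ continuous_const fun _ => rfl, sub_self])
  refine ⟨fun x => 1 + φ x, continuous_const.add hφ.continuous, fun x => by
    simp only [hφ.periodic x], ?_, ?_⟩
  · rw [intervalIntegral.integral_add (by simp) (hφ.continuous.intervalIntegrable _ _), hφ0]
    simp
  · rw [hT.add]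
    funext x
    linarith [heq x]

theorem IsContracting.nonneg_of_isInvariant {a ρ : ℝ → ℝ} {T : (ℝ → ℝ) → ℝ → ℝ}
    (hT : IsContracting 1 A θ a T) (hθ : θ < 1) (h : IsInvariant T ρ) (hρ : ContDiff ℝ 1 ρ)
    (x : ℝ) : 0 ≤ ρ x := by
  obtain ⟨C, r, -, hr0, hr1, hdecay⟩ := exists_ckBound_iterate 0 hT.weight.nonneg hT.nonneg hθ
  obtain ⟨M, hM⟩ := exists_ckBound (k := 1)
    (φ := fun x => ρ x - 1) (by exact_mod_cast hρ.sub contDiff_const) h.periodic_sub_one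
  have hlow (n : ℕ) : -(C * r ^ n * M) ≤ ρ x := by
    have habs := (hdecay a T hT _ M hM h.integral_sub_one n).abs_le x
    rw [hT.iterate_sub, Function.iterate_fixed h.eq n] at habs
    linarith [(abs_le.1 habs).1, hT.iterate_nonneg (φ := fun _ => 1) (fun _ => zero_le_one) n x]
  have hlim : Filter.Tendsto (fun n : ℕ => -(C * r ^ n * M)) Filter.atTop (nhds (-(C * 0 * M))) :=
    (((tendsto_pow_atTop_nhds_zero_of_lt_one hr0 hr1).const_mul C).mul_const M).neg
  simpa using le_of_tendsto' hlim hlow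

theorem exists_ckBound_of_isInvariant (k : ℕ) (hA : 0 ≤ A) (hθ0 : 0 ≤ θ) (hθ : θ < 1) :
    ∃ C, 0 ≤ C ∧ ∀ a T, IsContracting (k + 1) A θ a T →
    ∀ ρ, IsInvariant T ρ → CkBound (k + 1) ρ C := by
  obtain ⟨C, hC, hbound⟩ := exists_ckBound_transfer (k + 1) hA
  obtain ⟨D, hD, hinv⟩ := exists_ckBound_of_sub_transfer k hA hθ0 hθ
  refine ⟨1 + D * (C * 1 + 1), by positivity, fun a T hT ρ h => ?_⟩
  have hone : CkBound (k + 1) (fun _ => (1 : ℝ)) 1 := by simpa using CkBound.const (k + 1) 1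
  have hsub : CkBound (k + 1) (fun x => (ρ x - 1) - T (fun y => ρ y - 1) x) (C * 1 + 1) := by
    rw [hT.sub, h.eq]
    simpa only [sub_sub_sub_cancel_left] using
      (hbound a T hT.toIsBoundedTransfer _ _ hone).sub hone
  simpa using hone.add (hinv a T hT _ _ (h.continuous.sub continuous_const)
    h.periodic_sub_one h.integral_sub_one hsub)

end Contracting

/-! ### Perturbations of the identity -/

/-- The inverse of `x ↦ x + u x`. -/
noncomputable def perturbInv (u : ℝ → ℝ) : ℝ → ℝ := Function.invFun fun x => x + u x

/-- The weight of the transfer operator of `x ↦ x + u x`. -/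
noncomputable def perturbWeight (u : ℝ → ℝ) (x : ℝ) : ℝ := 1 / (1 + deriv u x)

/-- The transfer operator of `x ↦ x + u x`. -/
noncomputable def perturbTransfer (u φ : ℝ → ℝ) (x : ℝ) : ℝ :=
  perturbWeight u (perturbInv u x) * φ (perturbInv u x)

/-- The map `x ↦ x + u x` is the lift of an orientation-preserving circle diffeomorphism, with
bounds for `u` in `C^k` and for the derivative of the inverse. -/
structure IsPerturbation (k : ℕ) (A : ℝ) (u : ℝ → ℝ) : Prop where
  ckBound : CkBound k u A
  one_le : ∀ x, 1 ≤ A * (1 + deriv u x)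

namespace IsPerturbation

variable {k : ℕ} {A : ℝ} {u : ℝ → ℝ}

theorem of_le {j : ℕ} (h : IsPerturbation k A u) (hj : j ≤ k) : IsPerturbation j A u :=
  ⟨h.ckBound.of_le hj, h.one_le⟩

theorem mono {A' : ℝ} (h : IsPerturbation k A u) (hA : A ≤ A') : IsPerturbation k A' u := by
  refine ⟨h.ckBound.mono hA, fun x => (h.one_le x).trans (mul_le_mul_of_nonneg_right hA ?_)⟩
  exact (pos_of_mul_pos_right (one_pos.trans_le (h.one_le x)) h.ckBound.nonneg).le

theorem pos (h : IsPerturbation k A u) (x : ℝ) : 0 < 1 + deriv u x :=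
  pos_of_mul_pos_right (one_pos.trans_le (h.one_le x)) h.ckBound.nonneg

theorem weight_pos (h : IsPerturbation k A u) (x : ℝ) : 0 < perturbWeight u x :=
  one_div_pos.2 (h.pos x)

theorem abs_weight_le (h : IsPerturbation k A u) (x : ℝ) : |perturbWeight u x| ≤ A := by
  rw [abs_of_pos (h.weight_pos x), perturbWeight, div_le_iff₀ (h.pos x)]
  exact h.one_le x

theorem weight_mul (h : IsPerturbation k A u) (x : ℝ) :
    perturbWeight u x * (1 + deriv u x) = 1 :=
  one_div_mul_cancel (h.pos x).ne'

theorem periodic_weight (h : IsPerturbation k A u) : Function.Periodic (perturbWeight u) 1 :=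
  fun x => by simp only [perturbWeight, periodic_deriv h.ckBound.periodic x]

theorem hasDerivAt (h : IsPerturbation (k + 1) A u) (x : ℝ) :
    HasDerivAt (fun x => x + u x) (1 + deriv u x) x :=
  (hasDerivAt_id x).add (h.ckBound.differentiable x).hasDerivAt

theorem strictMono (h : IsPerturbation (k + 1) A u) : StrictMono fun x => x + u x :=
  strictMono_of_deriv_pos fun x => by rw [(h.hasDerivAt x).deriv]; exact h.pos x

theorem surjective (h : IsPerturbation k A u) : Function.Surjective fun x => x + u x := by
  have hb := fun x => abs_le.1 (h.ckBound.abs_le x)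
  refine (continuous_id.add h.ckBound.continuous).surjective ?_ ?_
  · exact Filter.tendsto_atTop_mono (fun x => (by linarith [(hb x).1] : x + -A ≤ x + u x))
      (Filter.tendsto_atTop_add_const_right _ (-A) Filter.tendsto_id)
  · exact Filter.tendsto_atBot_mono (fun x => (by linarith [(hb x).2] : x + u x ≤ x + A))
      (Filter.tendsto_atBot_add_const_right _ A Filter.tendsto_id)

theorem perturbInv_add (h : IsPerturbation k A u) (x : ℝ) :
    perturbInv u x + u (perturbInv u x) = x :=
  Function.rightInverse_invFun h.surjective x

theorem perturbInv_apply (h : IsPerturbation (k + 1) A u) (x : ℝ) : perturbInv u (x + u x) = x :=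
  Function.leftInverse_invFun h.strictMono.injective x

theorem contDiff_perturbInv (h : IsPerturbation (k + 1) A u) {n : WithTop ℕ∞}
    (hu : ContDiff ℝ n u) : ContDiff ℝ n (perturbInv u) := by
  let e : ℝ ≃ₜ ℝ := (h.strictMono.orderIsoOfSurjective _ h.surjective).toHomeomorph
  have he : (e.symm : ℝ → ℝ) = perturbInv u :=
    funext fun x => e.symm_apply_eq.2 (h.perturbInv_add x).symm
  rw [← he]
  exact e.contDiff_symm_deriv (fun x => (h.pos x).ne') h.hasDerivAt (contDiff_id.add hu)

theorem continuous_perturbInv (h : IsPerturbation (k + 1) A u) : Continuous (perturbInv u) :=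
  (h.contDiff_perturbInv h.ckBound.contDiff).continuous

theorem perturbInv_add_one (h : IsPerturbation (k + 1) A u) (x : ℝ) :
    perturbInv u (x + 1) = perturbInv u x + 1 := by
  apply h.strictMono.injective
  simp only
  rw [h.perturbInv_add, h.ckBound.periodic, add_right_comm, h.perturbInv_add]

theorem hasDerivAt_perturbInv (h : IsPerturbation (k + 1) A u) (x : ℝ) :
    HasDerivAt (perturbInv u) (perturbWeight u (perturbInv u x)) x := by
  have hinv := HasDerivAt.of_local_left_inverse (f := fun x => x + u x) (g := perturbInv u) (a := x)
    h.continuous_perturbInv.continuousAt (h.hasDerivAt _) (h.pos _).ne'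
    (Filter.Eventually.of_forall h.perturbInv_add)
  rwa [perturbWeight, one_div]

theorem abs_perturbInv_sub_le (h : IsPerturbation k A u) {ζ : ℝ} (hu : ∀ x, |u x| ≤ ζ) (x : ℝ) :
    |perturbInv u x - x| ≤ ζ := by
  have hx : perturbInv u x - x = -u (perturbInv u x) := by linarith [h.perturbInv_add x]
  rw [hx, abs_neg]
  exact hu _

theorem continuous_weight (h : IsPerturbation (k + 1) A u) : Continuous (perturbWeight u) :=
  continuous_const.div (continuous_const.add h.ckBound.deriv.continuous) fun x => (h.pos x).ne'

theorem hasDerivAt_weight (h : IsPerturbation (k + 2) A u) (x : ℝ) : HasDerivAt (perturbWeight u)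
    (-(deriv (deriv u) x * (perturbWeight u x * perturbWeight u x))) x := by
  refine ((hasDerivAt_const x (1 : ℝ)).fun_div
    ((h.ckBound.deriv.differentiable x).hasDerivAt.const_add 1) (h.pos x).ne').congr_deriv ?_
  rw [perturbWeight]
  field_simp
  ring

theorem isTransfer (h : IsPerturbation (k + 2) A u) :
    IsTransfer (perturbWeight u) (perturbTransfer u) where
  add φ ψ := by funext x; simp only [perturbTransfer]; ring
  const_mul c φ := by funext x; simp only [perturbTransfer]; ring
  map_nonneg φ hφ x := mul_nonneg (h.weight_pos _).le (hφ _)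
  periodic φ hφ x := by
    simp only [perturbTransfer, h.perturbInv_add_one, hφ _, h.periodic_weight _]
  continuous φ hφ :=
    (h.continuous_weight.comp h.continuous_perturbInv).mul (hφ.comp h.continuous_perturbInv)
  hasDerivAt φ hφ x := by
    have hd : DifferentiableAt ℝ (fun y => perturbWeight u y * φ y) (perturbInv u x) :=
      (h.hasDerivAt_weight _).differentiableAt.mul (hφ.differentiable one_ne_zero _)
    exact (hd.hasDerivAt.comp x (h.hasDerivAt_perturbInv x)).congr_deriv (mul_comm _ _)
  integral φ hφ hp := by
    have hsubst := intervalIntegral.integral_comp_mul_deriv (a := 0) (b := 1) (f := perturbInv u)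
      (fun x _ => h.hasDerivAt_perturbInv x)
      (h.continuous_weight.comp h.continuous_perturbInv).continuousOn hφ
    have hone := h.perturbInv_add_one 0
    rw [zero_add] at hone
    rw [hone, hp.intervalIntegral_add_eq _ 0, zero_add] at hsubst
    rw [← hsubst]
    exact intervalIntegral.integral_congr fun x _ => mul_comm _ _

end IsPerturbation

theorem exists_ckBound_perturbWeight (k : ℕ) {A : ℝ} (hA : 0 ≤ A) : ∃ C, 0 ≤ C ∧
    ∀ u, IsPerturbation (k + 1) A u → CkBound k (perturbWeight u) C := by
  induction k with
  | zero =>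
    exact ⟨A, hA, fun u hu =>
      CkBound.zero_iff.2 ⟨hu.continuous_weight, hu.periodic_weight, hu.abs_weight_le⟩⟩
  | succ k ih =>
    obtain ⟨C, hC, hbound⟩ := ih
    refine ⟨A + 2 ^ k * (A * (2 ^ k * (C * C))), by positivity, fun u hu => ?_⟩
    have hweight := hbound u (hu.of_le (k + 1).le_succ)
    refine CkBound.succ_of_deriv (fun x => (hu.hasDerivAt_weight x).differentiableAt)
      (CkBound.zero_iff.2 ⟨hu.continuous_weight, hu.periodic_weight, hu.abs_weight_le⟩) ?_
    rw [funext fun x => (hu.hasDerivAt_weight x).deriv]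
    exact (hu.ckBound.deriv.deriv.mul (hweight.mul hweight)).neg

theorem exists_isBoundedTransfer_perturbTransfer (k : ℕ) {A : ℝ} (hA : 0 ≤ A) : ∃ C, 0 ≤ C ∧
    ∀ u, IsPerturbation (k + 2) A u →
    IsBoundedTransfer (k + 1) C (perturbWeight u) (perturbTransfer u) := by
  obtain ⟨C, hC, hweight⟩ := exists_ckBound_perturbWeight (k + 1) hA
  refine ⟨A + C, by positivity, fun u hu => ⟨hu.isTransfer, fun x => ?_,
    (hweight u hu).mono (by linarith)⟩⟩
  simp only [perturbTransfer, mul_one]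
  exact (le_abs_self _).trans ((hu.abs_weight_le _).trans (by linarith))

theorem exists_ckBound_perturbTransfer (k : ℕ) {A : ℝ} (hA : 0 ≤ A) : ∃ C, 0 ≤ C ∧
    ∀ u, IsPerturbation (k + 2) A u → ∀ φ M, CkBound (k + 1) φ M →
    CkBound (k + 1) (perturbTransfer u φ) (C * M) := by
  obtain ⟨B, hB, htransfer⟩ := exists_isBoundedTransfer_perturbTransfer k hA
  obtain ⟨C, hC, hbound⟩ := exists_ckBound_transfer (k + 1) hB
  exact ⟨C, hC, fun u hu => hbound _ _ (htransfer u hu)⟩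

/-! ### Dependence of the transfer operator on the perturbation -/

theorem IsPerturbation.abs_perturbTransfer_sub_le {k : ℕ} {A ζ M : ℝ} {v φ : ℝ → ℝ}
    (h : IsPerturbation (k + 1) A v) (hv : CkBound 1 v ζ) (hφ : CkBound 1 φ M) (x : ℝ) :
    |perturbTransfer v φ x - φ x| ≤ (A + 1) * (ζ * M) := by
  set y := perturbInv v x with hy
  have hsplit : perturbTransfer v φ x - φ x =
      (φ y - φ x) - perturbWeight v y * (deriv v y * φ y) := by
    rw [perturbTransfer, ← hy]
    linear_combination φ y * h.weight_mul y
  have hfar : |φ y - φ x| ≤ M * ζ := (hφ.abs_sub_le y x).trans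
    (mul_le_mul_of_nonneg_left (h.abs_perturbInv_sub_le hv.abs_le x) hφ.nonneg)
  have hweight : |perturbWeight v y * (deriv v y * φ y)| ≤ A * (ζ * M) := by
    rw [abs_mul, abs_mul]
    exact mul_le_mul (h.abs_weight_le y) (mul_le_mul (hv.abs_deriv_le y) (hφ.abs_le y)
      (abs_nonneg _) hv.nonneg) (by positivity) h.ckBound.nonneg
  rw [hsplit]
  exact (abs_sub _ _).trans (by linarith)

theorem IsPerturbation.deriv_perturbTransfer_sub {k : ℕ} {A : ℝ} {v φ : ℝ → ℝ}
    (h : IsPerturbation (k + 2) A v) (hφ : ContDiff ℝ 1 φ) (x : ℝ) :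
    deriv (fun x => perturbTransfer v φ x - φ x) x = perturbTransfer v (deriv φ) x - deriv φ x -
      perturbTransfer v (deriv fun y => perturbWeight v y * (deriv v y * φ y)) x := by
  have hφd := hφ.differentiable one_ne_zero
  have hcorr : Differentiable ℝ fun y => perturbWeight v y * (deriv v y * φ y) := fun y =>
    (h.hasDerivAt_weight y).differentiableAt.mul ((h.ckBound.deriv.differentiable y).mul (hφd y))
  have hprod : (deriv fun y => perturbWeight v y * φ y) =
      fun y => deriv φ y - deriv (fun y => perturbWeight v y * (deriv v y * φ y)) y := by
    ext y
    rw [← deriv_fun_sub (hφd y) (hcorr y)]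
    congr 1
    ext z
    linear_combination φ z * h.weight_mul z
  rw [deriv_fun_sub (h.isTransfer.differentiable hφ x) (hφd x), h.isTransfer.deriv_eq hφ, hprod,
    h.isTransfer.sub]
  ring

theorem exists_ckBound_perturbTransfer_sub (k : ℕ) {A : ℝ} (hA : 0 ≤ A) : ∃ C, 0 ≤ C ∧
    ∀ v ζ, IsPerturbation (k + 2) A v → CkBound (k + 2) v ζ → ∀ φ M, CkBound (k + 1) φ M →
    CkBound k (fun x => perturbTransfer v φ x - φ x) (C * (ζ * M)) := by
  have hzero {k : ℕ} {v φ : ℝ → ℝ} {ζ M : ℝ} (hv : IsPerturbation (k + 2) A v)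
      (hζ : CkBound (k + 2) v ζ) (hφ : CkBound (k + 1) φ M) :
      CkBound 0 (fun x => perturbTransfer v φ x - φ x) ((A + 1) * (ζ * M)) :=
    CkBound.zero_iff.2 ⟨(hv.isTransfer.continuous φ hφ.continuous).sub hφ.continuous,
      (hv.isTransfer.periodic φ hφ.periodic).sub hφ.periodic,
      hv.abs_perturbTransfer_sub_le (hζ.of_le (by lia)) (hφ.of_le (by lia))⟩
  induction k with
  | zero => exact ⟨A + 1, by positivity, fun v ζ hv hζ φ M hφ => hzero hv hζ hφ⟩
  | succ k ih =>
    obtain ⟨C, hC, hsub⟩ := ih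
    obtain ⟨W, hW, hweight⟩ := exists_ckBound_perturbWeight (k + 1) hA
    obtain ⟨B, hB, htransfer⟩ := exists_isBoundedTransfer_perturbTransfer k hA
    obtain ⟨D, hD, hbound⟩ := exists_ckBound_transfer k hB
    refine ⟨A + 1 + (C + D * (2 ^ (k + 1) * (W * 2 ^ (k + 1)))), by positivity,
      fun v ζ hv hζ φ M hφ => ?_⟩
    have hv' := hv.of_le (k + 2).le_succ
    have hmain := hsub v ζ hv' (hζ.of_le (k + 2).le_succ) _ _ hφ.deriv
    have hcorr := hbound _ _ ((htransfer v hv').of_le k.le_succ) _ _ ((hweight v hv').mul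
      ((hζ.deriv.of_le (k + 1).le_succ).mul (hφ.of_le (k + 1).le_succ))).deriv
    have hderiv := hmain.sub hcorr
    rw [← funext (hv.deriv_perturbTransfer_sub hφ.contDiff_one)] at hderiv
    exact (CkBound.succ_of_deriv ((hv.isTransfer.differentiable hφ.contDiff_one).sub
      hφ.differentiable) (hzero hv hζ hφ) hderiv).mono (by linarith)

theorem abs_taylor_le {φ : ℝ → ℝ} {M : ℝ} (h : CkBound 2 φ M) (x y : ℝ) :
    |φ y - φ x - deriv φ x * (y - x)| ≤ M * (y - x) ^ 2 := by
  have hmean := Convex.norm_image_sub_le_of_norm_hasDerivWithin_le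
    (f := fun s => φ s - deriv φ x * s) (f' := fun s => deriv φ s - deriv φ x)
    (s := uIcc x y) (C := M * |y - x|) (x := x) (y := y)
    (fun s _ => ((h.differentiable s).hasDerivAt.sub
      (((hasDerivAt_id s).const_mul (deriv φ x)).congr_deriv (mul_one _))).hasDerivWithinAt)
    (fun s hs => (h.deriv.abs_sub_le s x).trans
      (mul_le_mul_of_nonneg_left (abs_sub_left_of_mem_uIcc hs) h.nonneg))
    (convex_uIcc x y) left_mem_uIcc right_mem_uIcc
  rw [Real.norm_eq_abs, Real.norm_eq_abs, mul_assoc, abs_mul_abs_self, ← sq] at hmean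
  rwa [mul_sub, sub_sub_sub_comm]

/-- The remainder of the first order expansion of the transfer operator of `x ↦ x + v x` at
`v = 0`. -/
noncomputable def perturbRemainder (v φ : ℝ → ℝ) (x : ℝ) : ℝ :=
  perturbTransfer v φ x - φ x + deriv (fun y => v y * φ y) x

namespace IsPerturbation

variable {k : ℕ} {A ζ M : ℝ} {v φ : ℝ → ℝ}

theorem abs_perturbRemainder_le (h : IsPerturbation 2 A v) (hv : CkBound 2 v ζ)
    (hφ : CkBound 2 φ M) (x : ℝ) : |perturbRemainder v φ x| ≤ (A + 4) * (ζ ^ 2 * M) := by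
  set y := perturbInv v x with hy
  have hyx : y - x = -v y := by linarith [h.perturbInv_add x]
  have hdist : |y - x| ≤ ζ := h.abs_perturbInv_sub_le hv.abs_le x
  have hv'φ := hv.deriv.mul (hφ.of_le one_le_two)
  have hsplit : perturbRemainder v φ x = (φ y - φ x - deriv φ x * (y - x)) -
      (deriv v y * φ y - deriv v x * φ x) - (v y - v x) * deriv φ x +
      perturbWeight v y * (deriv v y * (deriv v y * φ y)) := by
    rw [perturbRemainder, perturbTransfer, ← hy,
      deriv_fun_mul (hv.differentiable x) (hφ.differentiable x), hyx]
    linear_combination (φ y * (1 - deriv v y)) * h.weight_mul y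
  have htaylor : |φ y - φ x - deriv φ x * (y - x)| ≤ M * ζ ^ 2 :=
    (abs_taylor_le hφ x y).trans (mul_le_mul_of_nonneg_left
      (sq_le_sq' (by linarith [(abs_le.1 hdist).1]) (abs_le.1 hdist).2) hφ.nonneg)
  have hlip : |deriv v y * φ y - deriv v x * φ x| ≤ 2 ^ 1 * (ζ * M) * ζ :=
    (hv'φ.abs_sub_le y x).trans (mul_le_mul_of_nonneg_left hdist hv'φ.nonneg)
  have hcross : |(v y - v x) * deriv φ x| ≤ ζ * ζ * M := by
    rw [abs_mul]
    exact mul_le_mul ((hv.abs_sub_le y x).trans (mul_le_mul_of_nonneg_left hdist hv.nonneg))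
      (hφ.abs_deriv_le x) (abs_nonneg _) (mul_nonneg hv.nonneg hv.nonneg)
  have hweight : |perturbWeight v y * (deriv v y * (deriv v y * φ y))| ≤ A * (ζ * (ζ * M)) := by
    simp only [abs_mul]
    have := hv.nonneg
    have := h.ckBound.nonneg
    gcongr
    exacts [h.abs_weight_le y, hv.abs_deriv_le y, hv.abs_deriv_le y, hφ.abs_le y]
  rw [hsplit]
  refine (abs_add_le _ _).trans ((add_le_add_left (abs_sub _ _) _).trans ?_)
  have := abs_sub (φ y - φ x - deriv φ x * (y - x)) (deriv v y * φ y - deriv v x * φ x)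
  linarith

theorem differentiable_perturbRemainder (h : IsPerturbation (k + 2) A v)
    (hφ : CkBound (k + 2) φ M) : Differentiable ℝ (perturbRemainder v φ) :=
  ((h.isTransfer.differentiable hφ.contDiff_one).sub hφ.differentiable).add
    (h.ckBound.mul hφ).deriv.differentiable

theorem periodic_perturbRemainder (h : IsPerturbation (k + 2) A v) (hφ : Function.Periodic φ 1) :
    Function.Periodic (perturbRemainder v φ) 1 :=
  ((h.isTransfer.periodic φ hφ).sub hφ).add (periodic_deriv (h.ckBound.periodic.mul hφ))

theorem deriv_perturbRemainder (h : IsPerturbation (k + 2) A v) (hφ : CkBound (k + 2) φ M) (x : ℝ) :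
    deriv (perturbRemainder v φ) x = perturbRemainder v (deriv φ) x -
      deriv (fun y => perturbTransfer v (fun z => deriv v z * φ z) y - deriv v y * φ y) x := by
  have hv := h.ckBound
  have hsub := (h.isTransfer.differentiable hφ.contDiff_one).sub hφ.differentiable
  have hv'φ := hv.deriv.mul (hφ.of_le (k + 1).le_succ)
  have hvφ' := (hv.of_le (k + 1).le_succ).mul hφ.deriv
  have hleibniz : (deriv fun y => v y * φ y) = fun y => deriv v y * φ y + v y * deriv φ y :=
    funext fun y => deriv_fun_mul (hv.differentiable y) (hφ.differentiable y)
  have hR : deriv (perturbRemainder v φ) x = deriv (fun y => perturbTransfer v φ y - φ y) x +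
      deriv (deriv fun y => v y * φ y) x :=
    deriv_fun_add (hsub x) ((hv.mul hφ).deriv.differentiable x)
  rw [hR, h.deriv_perturbTransfer_sub hφ.contDiff_one, hleibniz,
    deriv_fun_add (hv'φ.differentiable x) (hvφ'.differentiable x),
    deriv_fun_sub (h.isTransfer.differentiable hv'φ.contDiff_one x) (hv'φ.differentiable x),
    h.isTransfer.deriv_eq hv'φ.contDiff_one, perturbRemainder]
  ring

end IsPerturbation

theorem exists_ckBound_perturbRemainder (k : ℕ) {A : ℝ} (hA : 0 ≤ A) : ∃ C, 0 ≤ C ∧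
    ∀ v ζ, IsPerturbation (k + 2) A v → CkBound (k + 2) v ζ → ∀ φ M, CkBound (k + 2) φ M →
    CkBound k (perturbRemainder v φ) (C * (ζ ^ 2 * M)) := by
  have hzero {k : ℕ} {v φ : ℝ → ℝ} {ζ M : ℝ} (hv : IsPerturbation (k + 2) A v)
      (hζ : CkBound (k + 2) v ζ) (hφ : CkBound (k + 2) φ M) :
      CkBound 0 (perturbRemainder v φ) ((A + 4) * (ζ ^ 2 * M)) :=
    CkBound.zero_iff.2 ⟨(hv.differentiable_perturbRemainder hφ).continuous,
      hv.periodic_perturbRemainder hφ.periodic, (hv.of_le (by lia)).abs_perturbRemainder_le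
        (hζ.of_le (by lia)) (hφ.of_le (by lia))⟩
  induction k with
  | zero => exact ⟨A + 4, by positivity, fun v ζ hv hζ φ M hφ => hzero hv hζ hφ⟩
  | succ k ih =>
    obtain ⟨C, hC, hrem⟩ := ih
    obtain ⟨D, hD, hsub⟩ := exists_ckBound_perturbTransfer_sub (k + 1) hA
    refine ⟨A + 4 + (C + D * 2 ^ (k + 2)), by positivity, fun v ζ hv hζ φ M hφ => ?_⟩
    have hmain := hrem v ζ (hv.of_le (k + 2).le_succ) (hζ.of_le (k + 2).le_succ) _ _ hφ.deriv
    have hcorr := hsub v ζ hv hζ _ _ (hζ.deriv.mul (hφ.of_le (k + 2).le_succ))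
    have hderiv := hmain.sub hcorr.deriv
    rw [← funext (hv.deriv_perturbRemainder hφ)] at hderiv
    exact (CkBound.succ_of_deriv (hv.differentiable_perturbRemainder hφ) (hzero hv hζ hφ)
      hderiv).mono (by linarith)

/-! ### Perturbations relative to a perturbation -/

/-- The displacement of the map that takes `x + u x` to `x + w x`. -/
noncomputable def relPerturb (u w : ℝ → ℝ) (x : ℝ) : ℝ :=
  w (perturbInv u x) - u (perturbInv u x)

theorem exists_ckBound_relPerturb (k : ℕ) {A : ℝ} (hA : 0 ≤ A) : ∃ C, 0 ≤ C ∧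
    ∀ u w ζ, IsPerturbation (k + 2) A u → CkBound (k + 2) (fun x => w x - u x) ζ →
    CkBound (k + 2) (relPerturb u w) (C * ζ) := by
  obtain ⟨C, hC, hbound⟩ := exists_ckBound_perturbTransfer k hA
  refine ⟨1 + C, by positivity, fun u w ζ hu hζ => ?_⟩
  have hd (x : ℝ) :
      HasDerivAt (relPerturb u w) (perturbTransfer u (deriv fun x => w x - u x) x) x :=
    ((hζ.differentiable _).hasDerivAt.comp x (hu.hasDerivAt_perturbInv x)).congr_deriv
      (mul_comm _ _)
  have hderiv := hbound u hu _ _ hζ.deriv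
  rw [← funext fun x => (hd x).deriv] at hderiv
  refine (CkBound.succ_of_deriv (fun x => (hd x).differentiableAt) (CkBound.zero_iff.2
    ⟨hζ.continuous.comp hu.continuous_perturbInv, fun x => ?_, fun x => hζ.abs_le _⟩)
    hderiv).mono (by linarith)
  rw [relPerturb, hu.perturbInv_add_one]
  exact hζ.periodic _

namespace IsPerturbation

variable {k : ℕ} {A : ℝ} {u w : ℝ → ℝ}

theorem one_add_deriv_relPerturb (hu : IsPerturbation (k + 1) A u) (hw : Differentiable ℝ w)
    (x : ℝ) : 1 + deriv (relPerturb u w) x =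
      (1 + deriv w (perturbInv u x)) * perturbWeight u (perturbInv u x) := by
  have hd := ((hw _).hasDerivAt.sub (hu.ckBound.differentiable _).hasDerivAt).comp x
    (hu.hasDerivAt_perturbInv x)
  have hderiv : deriv (relPerturb u w) x = _ := hd.deriv
  rw [hderiv]
  linear_combination -hu.weight_mul (perturbInv u x)

theorem perturbInv_relPerturb (hu : IsPerturbation k A u) (hw : IsPerturbation (k + 1) A w)
    (h : Function.Surjective fun x => x + relPerturb u w x) (x : ℝ) :
    perturbInv u (perturbInv (relPerturb u w) x) = perturbInv w x := by
  have hx : perturbInv (relPerturb u w) x + relPerturb u w (perturbInv (relPerturb u w) x) = x :=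
    Function.rightInverse_invFun h x
  have hy := hu.perturbInv_add (perturbInv (relPerturb u w) x)
  apply hw.strictMono.injective
  simp only [hw.perturbInv_add]
  rw [relPerturb] at hx
  linarith

theorem perturbTransfer_relPerturb (hu : IsPerturbation (k + 1) A u)
    (hw : IsPerturbation (k + 1) A w) (h : Function.Surjective fun x => x + relPerturb u w x)
    (φ : ℝ → ℝ) :
    perturbTransfer (relPerturb u w) (perturbTransfer u φ) = perturbTransfer w φ := by
  ext x
  have hinv := (hu.of_le k.le_succ).perturbInv_relPerturb hw h x
  have hu0 := (hu.pos (perturbInv w x)).ne'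
  have hw0 := (hw.pos (perturbInv w x)).ne'
  simp only [perturbTransfer]
  rw [hinv, ← mul_assoc]
  congr 1
  simp only [perturbWeight, hu.one_add_deriv_relPerturb hw.ckBound.differentiable, hinv]
  field_simp

end IsPerturbation

theorem relPerturb_mul_perturbTransfer (u w φ : ℝ → ℝ) (x : ℝ) :
    relPerturb u w x * perturbTransfer u φ x =
      perturbTransfer u (fun y => (w y - u y) * φ y) x := by
  simp only [relPerturb, perturbTransfer]
  ring

theorem exists_isPerturbation_relPerturb (k : ℕ) {A : ℝ} (hA : 0 ≤ A) : ∃ C, 0 ≤ C ∧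
    ∀ u w, IsPerturbation (k + 2) A u → IsPerturbation (k + 2) A w →
    IsPerturbation (k + 2) C (relPerturb u w) := by
  obtain ⟨C, hC, hbound⟩ := exists_ckBound_relPerturb k hA
  refine ⟨C * (A + A) + A * (1 + A), by positivity, fun u w hu hw => ⟨(hbound u w _ hu
    (hw.ckBound.sub hu.ckBound)).mono (le_add_of_nonneg_right (by positivity)), fun x => ?_⟩⟩
  set y := perturbInv u x
  have hderiv : 1 + deriv (relPerturb u w) x = (1 + deriv w y) * perturbWeight u y :=
    hu.one_add_deriv_relPerturb hw.ckBound.differentiable x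
  have hweight : 1 ≤ (1 + A) * perturbWeight u y :=
    (hu.weight_mul y).symm.le.trans (by
      rw [mul_comm]
      exact mul_le_mul_of_nonneg_right (by linarith [(abs_le.1 (hu.ckBound.abs_deriv_le y)).2])
        (hu.weight_pos y).le)
  have hprod := one_le_mul_of_one_le_of_one_le (hw.one_le y) hweight
  have hpos : 0 ≤ C * (A + A) * ((1 + deriv w y) * perturbWeight u y) :=
    mul_nonneg (by positivity) (mul_pos (hw.pos y) (hu.weight_pos y)).le
  rw [hderiv]
  linarith

theorem exists_ckBound_perturbTransfer_sub_perturbTransfer (k : ℕ) {A : ℝ} (hA : 0 ≤ A) :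
    ∃ C, 0 ≤ C ∧ ∀ u w ζ, IsPerturbation (k + 2) A u → IsPerturbation (k + 2) A w →
    CkBound (k + 2) (fun x => w x - u x) ζ → ∀ φ M, CkBound (k + 1) φ M →
    CkBound k (fun x => perturbTransfer w φ x - perturbTransfer u φ x) (C * (ζ * M)) := by
  obtain ⟨B, hB, hrel⟩ := exists_isPerturbation_relPerturb k hA
  obtain ⟨C, hC, hrelζ⟩ := exists_ckBound_relPerturb k hA
  obtain ⟨D, hD, hbound⟩ := exists_ckBound_perturbTransfer k hA
  obtain ⟨E, hE, hsub⟩ := exists_ckBound_perturbTransfer_sub k hB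
  refine ⟨E * C * D, by positivity, fun u w ζ hu hw hζ φ M hφ => ?_⟩
  have hrem := hsub _ _ (hrel u w hu hw) (hrelζ u w ζ hu hζ) _ _ (hbound u hu φ M hφ)
  rw [hu.perturbTransfer_relPerturb hw (hrel u w hu hw).surjective] at hrem
  exact hrem.mono (by linarith)

theorem exists_ckBound_perturbTransfer_expansion (k : ℕ) {A : ℝ} (hA : 0 ≤ A) :
    ∃ C, 0 ≤ C ∧ ∀ u w ζ, IsPerturbation (k + 3) A u → IsPerturbation (k + 3) A w →
    CkBound (k + 3) (fun x => w x - u x) ζ → ∀ φ M, CkBound (k + 2) φ M →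
    CkBound k (fun x => perturbTransfer w φ x - perturbTransfer u φ x +
      deriv (perturbTransfer u fun y => (w y - u y) * φ y) x) (C * (ζ ^ 2 * M)) := by
  obtain ⟨B, hB, hrel⟩ := exists_isPerturbation_relPerturb k hA
  obtain ⟨C, -, hrelζ⟩ := exists_ckBound_relPerturb k hA
  obtain ⟨D, hD, hbound⟩ := exists_ckBound_perturbTransfer (k + 1) hA
  obtain ⟨E, hE, hrem⟩ := exists_ckBound_perturbRemainder k hB
  refine ⟨E * C ^ 2 * D, by positivity, fun u w ζ hu hw hζ φ M hφ => ?_⟩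
  have hu' := hu.of_le (k + 2).le_succ
  have hw' := hw.of_le (k + 2).le_succ
  have hexp := hrem _ _ (hrel u w hu' hw') (hrelζ u w ζ hu' (hζ.of_le (k + 2).le_succ)) _ _
    (hbound u hu φ M hφ)
  have heq : perturbRemainder (relPerturb u w) (perturbTransfer u φ) =
      fun x => perturbTransfer w φ x - perturbTransfer u φ x +
        deriv (perturbTransfer u fun y => (w y - u y) * φ y) x := by
    ext x
    rw [perturbRemainder, hu.perturbTransfer_relPerturb hw (hrel u w hu' hw').surjective,
      funext (relPerturb_mul_perturbTransfer u w φ)]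
  rw [heq] at hexp
  exact hexp.mono (by linarith)

/-! ### Transfer operators of perturbed maps -/

theorem IsTransfer.comp {a b G : ℝ → ℝ} {P Q : (ℝ → ℝ) → ℝ → ℝ} (hP : IsTransfer a P)
    (hQ : IsTransfer b Q) (ha : ContDiff ℝ 1 a) (hb : ContDiff ℝ 1 b) (hG : ContDiff ℝ 1 G)
    (hmul : ∀ φ : ℝ → ℝ, (fun x => a x * Q φ x) = Q fun x => a (G x) * φ x) :
    IsTransfer (fun x => b x * a (G x)) fun φ => P (Q φ) where
  add φ ψ := by rw [hQ.add, hP.add]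
  const_mul c φ := by rw [hQ.const_mul, hP.const_mul]
  map_nonneg φ hφ := hP.map_nonneg _ (hQ.map_nonneg φ hφ)
  periodic φ hφ := hP.periodic _ (hQ.periodic φ hφ)
  continuous φ hφ := hP.continuous _ (hQ.continuous φ hφ)
  hasDerivAt φ hφ x := by
    have hderiv := hP.hasDerivAt _ (hQ.contDiff_one hb hφ) x
    rw [hmul, hQ.deriv_eq (φ := fun x => a (G x) * φ x) ((ha.comp hG).mul hφ)] at hderiv
    simpa only [mul_assoc] using hderiv
  integral φ hφ hp := by
    rw [hP.integral _ (hQ.continuous φ hφ) (hQ.periodic φ hp), hQ.integral φ hφ hp]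

theorem exists_ckBound_comp_add (k : ℕ) {A : ℝ} (hA : 0 ≤ A) : ∃ C, 0 ≤ C ∧
    ∀ u, CkBound k u A → ∀ φ M, CkBound k φ M → CkBound k (fun x => φ (x + u x)) (C * M) := by
  have hzero {k : ℕ} {u φ : ℝ → ℝ} {M : ℝ} (hu : CkBound k u A) (hφ : CkBound k φ M) :
      CkBound 0 (fun x => φ (x + u x)) M :=
    CkBound.zero_iff.2 ⟨hφ.continuous.comp (continuous_id.add hu.continuous), fun x => by
      simp only [hu.periodic x, add_right_comm x 1, hφ.periodic _], fun x => hφ.abs_le _⟩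
  induction k with
  | zero => exact ⟨1, zero_le_one, fun u hu φ M hφ => by simpa using hzero hu hφ⟩
  | succ k ih =>
    obtain ⟨C, hC, hbound⟩ := ih
    refine ⟨1 + 2 ^ k * (C * (1 + A)), by positivity, fun u hu φ M hφ => ?_⟩
    have hd (x : ℝ) : HasDerivAt (fun x => φ (x + u x))
        (deriv φ (x + u x) * (1 + deriv u x)) x :=
      (hφ.differentiable _).hasDerivAt.comp x
        ((hasDerivAt_id x).add (hu.differentiable x).hasDerivAt)
    have hone : CkBound k (fun _ => (1 : ℝ)) 1 := by simpa using CkBound.const k 1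
    have hderiv := (hbound u (hu.of_le k.le_succ) _ _ hφ.deriv).mul (hone.add hu.deriv)
    rw [← funext fun x => (hd x).deriv] at hderiv
    exact (CkBound.succ_of_deriv (fun x => (hd x).differentiableAt) (hzero hu hφ) hderiv).mono
      (by linarith)

theorem CkBound.isPerturbation {k : ℕ} {η : ℝ} {u : ℝ → ℝ} (h : CkBound (k + 1) u η) (hη : η < 1) :
    IsPerturbation (k + 1) (1 - η)⁻¹ u := by
  have hpos : 0 < 1 - η := sub_pos.2 hη
  refine ⟨h.mono ?_, fun x => ?_⟩
  · rw [← one_div, le_div_iff₀ hpos]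
    nlinarith [sq_nonneg η]
  · rw [← div_eq_inv_mul, one_le_div hpos]
    linarith [(_root_.abs_le.1 (h.abs_deriv_le x)).1]

theorem CkBound.isPerturbation_two {k : ℕ} {η : ℝ} {u : ℝ → ℝ} (h : CkBound (k + 1) u η)
    (hη : η ≤ 1 / 2) : IsPerturbation (k + 1) 2 u :=
  (h.isPerturbation (by linarith)).mono (inv_le_of_inv_le₀ two_pos (by linarith))

/-- The weight `1 / (F ∘ Φ)'` of the composition of a map `F` of weight `a = 1 / F'` with the
perturbation `Φ x = x + u x`. -/
noncomputable def compWeight (a u : ℝ → ℝ) (x : ℝ) : ℝ := perturbWeight u x * a (x + u x)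

namespace IsPerturbation

variable {k : ℕ} {A : ℝ} {a u φ : ℝ → ℝ}

theorem mul_perturbTransfer (h : IsPerturbation k A u) :
    (fun x => a x * perturbTransfer u φ x) = perturbTransfer u fun x => a (x + u x) * φ x := by
  funext x
  simp only [perturbTransfer, h.perturbInv_add]
  ring

theorem isTransfer_comp {P : (ℝ → ℝ) → ℝ → ℝ} (h : IsPerturbation (k + 2) A u)
    (hP : IsTransfer a P) (ha : ContDiff ℝ 1 a) :
    IsTransfer (compWeight a u) fun φ => P (perturbTransfer u φ) := by
  obtain ⟨C, -, hweight⟩ := exists_ckBound_perturbWeight (k + 1) h.ckBound.nonneg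
  exact hP.comp h.isTransfer ha (hweight u h).contDiff_one
    (contDiff_id.add h.ckBound.contDiff_one) fun φ => h.mul_perturbTransfer

theorem hasDerivAt_compWeight (h : IsPerturbation (k + 2) A u) (ha : ContDiff ℝ 1 a) (x : ℝ) :
    HasDerivAt (compWeight a u) (-(deriv (deriv u) x * (perturbWeight u x * perturbWeight u x)) *
      a (x + u x) + deriv a (x + u x)) x := by
  refine ((h.hasDerivAt_weight x).mul
    ((ha.differentiable one_ne_zero _).hasDerivAt.comp x (h.hasDerivAt x))).congr_deriv ?_
  rw [← mul_assoc _ (deriv a _), mul_right_comm, h.weight_mul, one_mul,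
    Function.comp_apply]

/-- With `a_u = 1 / (F ∘ Φ)'`, `w = 1 / Φ'` and `A ≥ w`, the terms of
`a_u' = w' (a ∘ Φ) + a' ∘ Φ` are controlled by `|w'| = w² |u''|` and the distortion of `a`. -/
theorem abs_compWeight_add_abs_deriv_le (h : IsPerturbation (k + 2) A u) (ha : ContDiff ℝ 1 a)
    (hA : 1 ≤ A) {η : ℝ} (hu : ∀ x, |deriv (deriv u) x| ≤ η) (x : ℝ) :
    |compWeight a u x| + |deriv (compWeight a u) x| ≤
      (A + η * (A * A)) * (|a (x + u x)| + |deriv a (x + u x)|) := by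
  have hη : 0 ≤ η := (abs_nonneg _).trans (hu 0)
  have hw := h.abs_weight_le x
  have hweight : |compWeight a u x| ≤ A * |a (x + u x)| := by
    rw [compWeight, abs_mul]
    gcongr
  have hderiv : |deriv (compWeight a u) x| ≤
      η * (A * A) * |a (x + u x)| + |deriv a (x + u x)| := by
    rw [(h.hasDerivAt_compWeight ha x).deriv]
    refine (abs_add_le _ _).trans (add_le_add_left ?_ _)
    rw [abs_mul, abs_neg, abs_mul, abs_mul]
    gcongr
    exact hu x
  have hrest : 0 ≤ (A + η * (A * A) - 1) * |deriv a (x + u x)| :=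
    mul_nonneg (by linarith [mul_nonneg hη (mul_self_nonneg A)]) (abs_nonneg _)
  linarith

theorem perturbTransfer_comp_le (h : IsPerturbation k A u) (hφ : ∀ x, 0 ≤ φ x) (x : ℝ) :
    perturbTransfer u (fun y => φ (y + u y)) x ≤ A * φ x := by
  rw [perturbTransfer, h.perturbInv_add]
  exact mul_le_mul_of_nonneg_right ((le_abs_self _).trans (h.abs_weight_le _)) (hφ x)

theorem distortion_comp {P : (ℝ → ℝ) → ℝ → ℝ} (h : IsPerturbation (k + 2) A u)
    (hP : IsTransfer a P) (ha : ContDiff ℝ 1 a) (hA : 1 ≤ A) {η θ : ℝ}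
    (hu : ∀ x, |deriv (deriv u) x| ≤ η) (hθ : ∀ x, P (fun y => |a y| + |deriv a y|) x ≤ θ) (x : ℝ) :
    P (perturbTransfer u fun y => |compWeight a u y| + |deriv (compWeight a u) y|) x ≤
      (A + η * (A * A)) * A * θ := by
  have hη : 0 ≤ η := (abs_nonneg _).trans (hu 0)
  have hle (y : ℝ) : perturbTransfer u
      (fun y => |compWeight a u y| + |deriv (compWeight a u) y|) y ≤
        (A + η * (A * A)) * A * (|a y| + |deriv a y|) := by
    refine (h.isTransfer.mono (h.abs_compWeight_add_abs_deriv_le ha hA hu) y).trans ?_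
    rw [h.isTransfer.const_mul, mul_assoc]
    exact mul_le_mul_of_nonneg_left (h.perturbTransfer_comp_le
      (φ := fun y => |a y| + |deriv a y|) (fun y => by positivity) y) (by positivity)
  refine (hP.mono hle x).trans ?_
  rw [hP.const_mul]
  exact mul_le_mul_of_nonneg_left (hθ x) (by positivity)

end IsPerturbation

theorem exists_isBoundedTransfer_comp (k : ℕ) {A B : ℝ} (hA : 0 ≤ A) (hB : 0 ≤ B) : ∃ C, 0 ≤ C ∧
    ∀ a P, IsBoundedTransfer (k + 1) A a P → ∀ u, IsPerturbation (k + 2) B u →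
    IsBoundedTransfer (k + 1) C (compWeight a u) fun φ => P (perturbTransfer u φ) := by
  obtain ⟨C, hC, hweight⟩ := exists_ckBound_perturbWeight (k + 1) hB
  obtain ⟨D, hD, hcomp⟩ := exists_ckBound_comp_add (k + 1) hB
  refine ⟨A * B + 2 ^ (k + 1) * (C * (D * A)), by positivity, fun a P hP u hu =>
    ⟨hu.isTransfer_comp hP.toIsTransfer hP.weight.contDiff_one, fun x => ?_,
      ((hweight u hu).mul (hcomp u (hu.ckBound.of_le (k + 1).le_succ) a A hP.weight)).mono
        (le_add_of_nonneg_left (by positivity))⟩⟩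
  have hone := hP.abs_le_mul (φ := perturbTransfer u fun _ => 1) (B := B) (fun y => by
    simpa [perturbTransfer] using hu.abs_weight_le _) x
  exact (le_abs_self _).trans (hone.trans (le_add_of_nonneg_right (by positivity)))

/-- The rate `(κ + η κ²) κ θ`, with `κ = (1 - η)⁻¹`, tends to `θ` as `η` tends to `0`. -/
theorem exists_perturbation_size {α θ : ℝ} (hα : α < 1) (hθ : θ < 1) : ∃ η, 0 < η ∧ η ≤ 1 / 2 ∧
    α < 1 - η ∧ ((1 - η)⁻¹ + η * ((1 - η)⁻¹ * (1 - η)⁻¹)) * (1 - η)⁻¹ * θ < (1 + θ) / 2 := by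
  have hinv : ContinuousAt (fun η : ℝ => (1 - η)⁻¹) 0 :=
    (continuousAt_const.sub continuousAt_id).inv₀ (by simp)
  have hrate : ContinuousAt
      (fun η : ℝ => ((1 - η)⁻¹ + η * ((1 - η)⁻¹ * (1 - η)⁻¹)) * (1 - η)⁻¹ * θ) 0 :=
    ((hinv.add (continuousAt_id.mul (hinv.mul hinv))).mul hinv).mul continuousAt_const
  have hrate' := hrate.eventually_lt_const (u := (1 + θ) / 2) (by norm_num; linarith)
  have hα' := (by fun_prop : ContinuousAt (fun η : ℝ => 1 - η) 0).eventually_const_lt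
    (u := α) (by simpa using hα)
  have hhalf : ∀ᶠ η : ℝ in nhds 0, η ≤ 1 / 2 := eventually_le_nhds (by norm_num)
  obtain ⟨η, ⟨h1, h2, h3⟩, hη⟩ := (((hhalf.and (hα'.and hrate')).filter_mono
    nhdsWithin_le_nhds).and (self_mem_nhdsWithin (s := Ioi 0))).exists
  exact ⟨η, hη, h1, h2, h3⟩

theorem exists_isContracting_comp (k : ℕ) {A α θ : ℝ} (hA : 0 ≤ A) (hα : α < 1) (hθ : θ < 1) :
    ∃ η A' θ', 0 < η ∧ η ≤ 1 / 2 ∧ α < 1 - η ∧ θ' < 1 ∧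
    ∀ a P, IsContracting (k + 1) A θ a P → (∀ x, |a x| ≤ α) → ∀ u, CkBound (k + 2) u η →
    IsContracting (k + 1) A' θ' (compWeight a u) fun φ => P (perturbTransfer u φ) := by
  obtain ⟨η, hη, hhalf, hαη, hrate⟩ := exists_perturbation_size hα hθ
  obtain ⟨C, -, hbounded⟩ := exists_isBoundedTransfer_comp k hA zero_le_two
  refine ⟨η, C, (1 + θ) / 2, hη, hhalf, hαη, by linarith, fun a P hP ha u hu =>
    ⟨hbounded a P hP.toIsBoundedTransfer u (hu.isPerturbation_two hhalf), fun x => ?_, fun x => ?_⟩⟩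
  · have hpert := hu.isPerturbation (by linarith : η < 1)
    rw [compWeight, abs_mul]
    refine (mul_le_mul (hpert.abs_weight_le x) (ha _) (abs_nonneg _)
      (inv_nonneg.2 (by linarith))).trans ?_
    rw [← div_eq_inv_mul]
    exact div_le_one_of_le₀ hαη.le (by linarith)
  · exact ((hu.isPerturbation (by linarith)).distortion_comp hP.toIsTransfer hP.weight.contDiff_one
      ((one_le_inv₀ (by linarith)).2 (by linarith)) hu.deriv.abs_deriv_le hP.distortion x).trans
      hrate.le

/-! ### Positivity of invariant densities -/

/-- The set where `φ` is positive contains an interval, and contains the images of this interval,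
whose lengths grow until they cover a period. -/
theorem pos_of_expanding {F φ : ℝ → ℝ} {ω : ℝ} (hω : 1 < ω) (hF : Continuous F)
    (hexp : ∀ x y, ω * |x - y| ≤ |F x - F y|) (hφ : Continuous φ) (hp : Function.Periodic φ 1)
    (hpos : ∀ x, 0 < φ x → 0 < φ (F x)) {z : ℝ} (hz : 0 < φ z) (x : ℝ) : 0 < φ x := by
  obtain ⟨δ, hδ, hball⟩ := Metric.eventually_nhds_iff.1 (hφ.continuousAt.eventually_const_lt hz)
  have hinterval (n : ℕ) : ∃ a b, ω ^ n * (δ / 2) ≤ b - a ∧ ∀ y ∈ Icc a b, 0 < φ y := by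
    induction n with
    | zero =>
      refine ⟨z, z + δ / 2, by simp, fun y hy => hball ?_⟩
      rw [Real.dist_eq, abs_of_nonneg (by linarith [hy.1])]
      linarith [hy.2]
    | succ n ih =>
      obtain ⟨a, b, hab, h⟩ := ih
      have hlen : 0 ≤ b - a := le_trans (by positivity) hab
      refine ⟨min (F a) (F b), max (F a) (F b), ?_, fun y hy => ?_⟩
      · rw [max_sub_min_eq_abs, pow_succ', mul_assoc]
        refine le_trans ?_ (hexp b a)
        rw [abs_of_nonneg hlen]
        gcongr
      · obtain ⟨w, hw, rfl⟩ := intermediate_value_uIcc hF.continuousOn hy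
        rw [uIcc_of_le (by linarith)] at hw
        exact hpos w (h w hw)
  obtain ⟨n, hn⟩ := pow_unbounded_of_one_lt (1 / (δ / 2)) hω
  obtain ⟨a, b, hab, h⟩ := hinterval n
  rw [div_lt_iff₀ (by positivity)] at hn
  obtain ⟨y, hy, hxy⟩ := hp.exists_mem_Ico one_pos x a
  rw [hxy]
  exact h y ⟨hy.1, by linarith [hy.2]⟩

/-! ### Densities -/

/-- A continuous probability density on the circle, as a periodic function on the line. -/
structure IsDensity (ψ : ℝ → ℝ) : Prop where
  continuous : Continuous ψ
  periodic : Function.Periodic ψ 1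
  nonneg : ∀ x, 0 ≤ ψ x
  integral : ∫ x in (0 : ℝ)..1, ψ x = 1

theorem IsDensity.integral_abs_le {ψ : ℝ → ℝ} (h : IsDensity ψ) :
    ∫ x in (0 : ℝ)..1, |ψ x| ≤ 1 := by
  simp only [abs_of_nonneg (h.nonneg _), h.integral, le_refl]

theorem IsDensity.exists_pos {ψ : ℝ → ℝ} (h : IsDensity ψ) : ∃ z, 0 < ψ z := by
  by_contra! hle
  have hzero : ψ = fun _ => 0 := funext fun x => le_antisymm (hle x) (h.nonneg x)
  have hone := h.integral
  simp [hzero] at hone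

theorem isClosed_setOf_isDensity :
    IsClosed {ψ : BoundedContinuousFunction ℝ ℝ | IsDensity ψ} := by
  have hint : Continuous fun ψ : BoundedContinuousFunction ℝ ℝ => ∫ x in (0 : ℝ)..1, ψ x := by
    refine LipschitzWith.continuous (K := 1) (LipschitzWith.of_dist_le_mul fun ψ χ => ?_)
    rw [Real.dist_eq, ← intervalIntegral.integral_sub (ψ.continuous.intervalIntegrable _ _)
      (χ.continuous.intervalIntegrable _ _)]
    simpa using intervalIntegral.norm_integral_le_of_norm_le_const (a := 0) (b := 1)
      (f := fun x => ψ x - χ x) (C := dist ψ χ) fun x _ => by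
        rw [← dist_eq_norm]; exact ψ.dist_coe_le_dist x
  have hset : {ψ : BoundedContinuousFunction ℝ ℝ | IsDensity ψ} =
      (⋂ x, {ψ | ψ (x + 1) = ψ x}) ∩ (⋂ x, {ψ | 0 ≤ ψ x}) ∩ {ψ | ∫ x in (0 : ℝ)..1, ψ x = 1} := by
    ext ψ
    simp only [mem_inter_iff, mem_iInter, mem_ofPred_eq]
    exact ⟨fun h => ⟨⟨h.periodic, h.nonneg⟩, h.integral⟩,
      fun h => ⟨ψ.continuous, h.1.1, h.1.2, h.2⟩⟩
  rw [hset]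
  refine ((isClosed_iInter fun x => ?_).inter (isClosed_iInter fun x => ?_)).inter
    (isClosed_eq hint continuous_const)
  · exact isClosed_eq (continuous_eval_const _) (continuous_eval_const _)
  · exact isClosed_le continuous_const (continuous_eval_const _)

theorem exists_isDensity_eq_self {K : NNReal} (hK : K < 1) {R : (ℝ → ℝ) → ℝ → ℝ}
    (hR : ∀ ψ, IsDensity ψ → IsDensity (R ψ))
    (hlip : ∀ ψ χ, IsDensity ψ → IsDensity χ → ∀ D, (∀ x, |χ x - ψ x| ≤ D) →
      ∀ x, |R χ x - R ψ x| ≤ K * D) : ∃ ψ, IsDensity ψ ∧ R ψ = ψ := by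
  have hbdd (ψ : ℝ → ℝ) (h : IsDensity ψ) : ∃ M, ∀ x y, dist (ψ x) (ψ y) ≤ M := by
    obtain ⟨M, hM⟩ := exists_forall_abs_le_of_periodic h.continuous one_ne_zero h.periodic
    exact ⟨M + M, fun x y => (abs_sub _ _).trans (add_le_add (hM x) (hM y))⟩
  let X : Set (BoundedContinuousFunction ℝ ℝ) := {ψ | IsDensity ψ}
  have : CompleteSpace X := isClosed_setOf_isDensity.completeSpace_coe
  have : Nonempty X := ⟨⟨BoundedContinuousFunction.const ℝ 1,
    continuous_const, fun _ => rfl, fun _ => zero_le_one, by simp⟩⟩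
  let G (ψ : X) : X := ⟨⟨⟨R ψ.1, (hR _ ψ.2).continuous⟩, hbdd _ (hR _ ψ.2)⟩, hR _ ψ.2⟩
  have hG : ContractingWith K G := by
    refine ⟨hK, LipschitzWith.of_dist_le_mul fun ψ χ => ?_⟩
    rw [Subtype.dist_eq, BoundedContinuousFunction.dist_le (by positivity)]
    exact hlip χ.1 ψ.1 χ.2 ψ.2 _ fun x => ψ.1.dist_coe_le_dist x
  exact ⟨(hG.fixedPoint G).1, (hG.fixedPoint G).2,
    congrArg (fun ψ : X => (ψ.1 : ℝ → ℝ)) hG.fixedPoint_isFixedPt⟩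

/-! ### Mean field systems -/

/-- The lift to the line of a transfer operator `P` of an expanding map `F` which is coupled to
itself through the mean field `ψ ↦ A_ψ`, called `field`. The operator `P` followed by a perturbation
of the identity of size `η` in `C^{k+4}` is contracting of order `k + 3`, with uniform constants. -/
structure MeanFieldSystem (k : ℕ) where
  (P field : (ℝ → ℝ) → ℝ → ℝ)
  (a F : ℝ → ℝ)
  (A θ η ω H : ℝ)
  lt_one : θ < 1
  η_pos : 0 < η
  le_half : η ≤ 1 / 2
  one_lt : 1 < ω
  continuous_map : Continuous F
  isBoundedTransfer : IsBoundedTransfer (k + 3) A a P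
  isContracting : ∀ u, CkBound (k + 4) u η →
    IsContracting (k + 3) A θ (compWeight a u) fun φ => P (perturbTransfer u φ)
  expanding : ∀ u, CkBound (k + 4) u η → ∀ x y, ω * |x - y| ≤ |F (x + u x) - F (y + u y)|
  map_pos : ∀ φ : ℝ → ℝ, (∀ x, 0 ≤ φ x) → ∀ x, 0 < φ x → 0 < P φ (F x)
  field_add : ∀ ψ χ : ℝ → ℝ, Continuous ψ → Continuous χ →
    field (fun x => ψ x + χ x) = fun x => field ψ x + field χ x
  field_const_mul : ∀ (r : ℝ) (ψ : ℝ → ℝ), field (fun x => r * ψ x) = fun x => r * field ψ x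
  ckBound_field : ∀ (ψ : ℝ → ℝ) (B : ℝ), Continuous ψ → Function.Periodic ψ 1 →
    ∫ x in (0 : ℝ)..1, |ψ x| ≤ B → CkBound (k + 4) (field ψ) (H * B)

namespace MeanFieldSystem

variable {k : ℕ} (S : MeanFieldSystem k)

theorem ckBound_zero : CkBound (k + 4) (fun _ => (0 : ℝ)) S.η := by
  simpa using (CkBound.const (k + 4) 0).mono (by simpa using S.η_pos.le)

theorem A_nonneg : 0 ≤ S.A := (S.isContracting _ S.ckBound_zero).weight.nonneg

theorem θ_nonneg : 0 ≤ S.θ := (S.isContracting _ S.ckBound_zero).nonneg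

theorem H_nonneg : 0 ≤ S.H := by
  simpa using (S.ckBound_field (fun _ => 0) 1 continuous_const (fun _ => rfl) (by simp)).nonneg

theorem field_sub {ψ χ : ℝ → ℝ} (hψ : Continuous ψ) (hχ : Continuous χ) :
    S.field (fun x => ψ x - χ x) = fun x => S.field ψ x - S.field χ x := by
  have hadd := S.field_add ψ (fun x => -1 * χ x) hψ (by fun_prop)
  rw [S.field_const_mul] at hadd
  simpa only [neg_one_mul, ← sub_eq_add_neg] using hadd

theorem ckBound_field_of_abs_le {φ : ℝ → ℝ} {K : ℝ} (hφ : Continuous φ)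
    (hp : Function.Periodic φ 1) (hK : ∀ x, |φ x| ≤ K) : CkBound (k + 4) (S.field φ) (S.H * K) :=
  S.ckBound_field φ K hφ hp (integral_abs_le hφ hK)

/-- The perturbation `t A_ψ` of the identity. -/
def coupling (t : ℝ) (ψ : ℝ → ℝ) (x : ℝ) : ℝ := t * S.field ψ x

/-- The transfer operator `P Q_u` of the map `F` preceded by the perturbation `u` of the
identity. -/
noncomputable def perturbed (u φ : ℝ → ℝ) : ℝ → ℝ := S.P (perturbTransfer u φ)

/-- A density which is a fixed point of the self-consistent transfer operator at time `t`. -/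
structure IsSelfConsistent (t : ℝ) (ρ : ℝ → ℝ) : Prop where
  isDensity : IsDensity ρ
  eq : S.perturbed (S.coupling t ρ) ρ = ρ

variable {S}

theorem IsSelfConsistent.isInvariant {t : ℝ} {ρ : ℝ → ℝ} (h : S.IsSelfConsistent t ρ) :
    IsInvariant (S.perturbed (S.coupling t ρ)) ρ :=
  ⟨h.isDensity.continuous, h.isDensity.periodic, h.isDensity.integral, h.eq⟩

variable (S)

theorem ckBound_coupling_sub {s t D : ℝ} {ψ χ : ℝ → ℝ} (hψ : IsDensity ψ) (hχ : IsDensity χ)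
    (hD : ∀ x, |χ x - ψ x| ≤ D) :
    CkBound (k + 4) (fun x => S.coupling s χ x - S.coupling t ψ x)
      (|s - t| * S.H + |t| * (S.H * D)) := by
  have htime := (S.ckBound_field χ 1 hχ.continuous hχ.periodic hχ.integral_abs_le).const_mul (s - t)
  have hfield := (S.ckBound_field_of_abs_le (hχ.continuous.sub hψ.continuous)
    (hχ.periodic.sub hψ.periodic) hD).const_mul t
  have heq : (fun x => S.coupling s χ x - S.coupling t ψ x) =
      fun x => (s - t) * S.field χ x + t * S.field (χ - ψ) x := by
    ext x
    rw [coupling, coupling, show S.field (χ - ψ) x = _ from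
      congrFun (S.field_sub hχ.continuous hψ.continuous) x]
    ring
  rw [heq, ← mul_one S.H, mul_assoc, one_mul]
  exact htime.add hfield

variable {S}

theorem exists_isInvariant {u : ℝ → ℝ} (hu : CkBound (k + 4) u S.η) :
    ∃ ρ, IsDensity ρ ∧ IsInvariant (S.perturbed u) ρ := by
  have hT := (S.isContracting u hu).of_le (Nat.le_add_left 1 (k + 2))
  obtain ⟨ρ, hρ⟩ := hT.exists_isInvariant S.lt_one
  obtain ⟨C, -, hC⟩ := exists_ckBound_of_isInvariant 0 S.A_nonneg S.θ_nonneg S.lt_one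
  exact ⟨ρ, ⟨hρ.continuous, hρ.periodic,
    hT.nonneg_of_isInvariant S.lt_one hρ (hC _ _ hT ρ hρ).contDiff_one, hρ.integral⟩, hρ⟩

variable (S)

theorem exists_ckBound_invariant : ∃ C, 0 ≤ C ∧ ∀ u, CkBound (k + 4) u S.η →
    ∀ ρ, IsInvariant (S.perturbed u) ρ → CkBound (k + 3) ρ C := by
  obtain ⟨C, hC, h⟩ := exists_ckBound_of_isInvariant (k + 2) S.A_nonneg S.θ_nonneg S.lt_one
  exact ⟨C, hC, fun u hu => h _ _ (S.isContracting u hu)⟩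

theorem exists_ckBound_P (j : ℕ) (hj : j ≤ k + 3) : ∃ C, 0 ≤ C ∧
    ∀ φ M, CkBound j φ M → CkBound j (S.P φ) (C * M) := by
  obtain ⟨C, hC, h⟩ := exists_ckBound_transfer j S.A_nonneg
  exact ⟨C, hC, h _ _ (S.isBoundedTransfer.of_le hj)⟩

theorem perturbed_sub {u : ℝ → ℝ} (hu : CkBound (k + 4) u S.η) (φ ψ : ℝ → ℝ) :
    S.perturbed u (fun x => φ x - ψ x) = fun x => S.perturbed u φ x - S.perturbed u ψ x :=
  (S.isContracting u hu).toIsTransfer.sub φ ψ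

theorem exists_ckBound_invariant_sub : ∃ C, 0 ≤ C ∧ ∀ u w ζ, CkBound (k + 4) u S.η →
    CkBound (k + 4) w S.η → CkBound (k + 4) (fun x => w x - u x) ζ →
    ∀ ρ ρ', IsInvariant (S.perturbed u) ρ → IsInvariant (S.perturbed w) ρ' →
    CkBound 2 (fun x => ρ' x - ρ x) (C * ζ) := by
  obtain ⟨M, hM, hρM⟩ := S.exists_ckBound_invariant
  obtain ⟨C₁, hC₁, hQ⟩ := exists_ckBound_perturbTransfer_sub_perturbTransfer 2 zero_le_two
  obtain ⟨C₂, hC₂, hP⟩ := S.exists_ckBound_P 2 (by lia)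
  obtain ⟨C₃, hC₃, hsolve⟩ := exists_ckBound_of_sub_transfer 1 S.A_nonneg S.θ_nonneg S.lt_one
  refine ⟨C₃ * (C₂ * (C₁ * M)), by positivity, fun u w ζ hu hw hζ ρ ρ' hρ hρ' => ?_⟩
  have hdiff := hP _ _ (hQ u w ζ ((hu.isPerturbation_two S.le_half).of_le (by lia))
    ((hw.isPerturbation_two S.le_half).of_le (by lia)) (hζ.of_le (by lia)) ρ M
    ((hρM u hu ρ hρ).of_le (by lia)))
  have heq : S.P (fun x => perturbTransfer w ρ x - perturbTransfer u ρ x) =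
      fun x => ρ' x - ρ x - S.perturbed w (fun y => ρ' y - ρ y) x := by
    ext x
    rw [S.perturbed_sub hw, S.isBoundedTransfer.sub, hρ'.eq]
    change S.perturbed w ρ x - S.perturbed u ρ x = _
    rw [hρ.eq]
    ring
  rw [heq] at hdiff
  refine (hsolve _ _ ((S.isContracting w hw).of_le (by lia)) _ _
    (hρ'.continuous.sub hρ.continuous) (hρ'.periodic.sub hρ.periodic) ?_ hdiff).mono (by linarith)
  simp [intervalIntegral.integral_sub (hρ'.continuous.intervalIntegrable _ _)
    (hρ.continuous.intervalIntegrable _ _), hρ'.integral, hρ.integral]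

/-! ### The derivative of the coupled transfer operator in its mean field -/

/-- The operator `Θ g = (Q_u (ρ A_g))'` at the perturbation `u` and the density `ρ`. -/
noncomputable def theta (u ρ g : ℝ → ℝ) : ℝ → ℝ :=
  deriv (perturbTransfer u fun x => ρ x * S.field g x)

theorem exists_ckBound_perturbTransfer_mul_field : ∃ C, 0 ≤ C ∧ ∀ u, CkBound (k + 4) u S.η →
    ∀ ρ, IsInvariant (S.perturbed u) ρ → ∀ g K, Continuous g → Function.Periodic g 1 →
    (∀ x, |g x| ≤ K) → CkBound 2 (perturbTransfer u fun x => ρ x * S.field g x) (C * K) := by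
  obtain ⟨M, hM, hρM⟩ := S.exists_ckBound_invariant
  obtain ⟨C, hC, hQ⟩ := exists_ckBound_perturbTransfer 1 zero_le_two
  have hH := S.H_nonneg
  refine ⟨C * (2 ^ 2 * (M * S.H)), by positivity, fun u hu ρ hρ g K hg hp hK => ?_⟩
  have hmul := ((hρM u hu ρ hρ).of_le (j := 2) (by lia)).mul
    ((S.ckBound_field_of_abs_le hg hp hK).of_le (j := 2) (by lia))
  exact (hQ u ((hu.isPerturbation_two S.le_half).of_le (by lia)) _ _ hmul).mono (by linarith)

theorem exists_ckBound_P_theta : ∃ C, 0 ≤ C ∧ ∀ u, CkBound (k + 4) u S.η →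
    ∀ ρ, IsInvariant (S.perturbed u) ρ → ∀ g K, Continuous g → Function.Periodic g 1 →
    (∀ x, |g x| ≤ K) → CkBound 1 (S.P (S.theta u ρ g)) (C * K) := by
  obtain ⟨C, hC, hP⟩ := S.exists_ckBound_P 1 (by lia)
  obtain ⟨D, hD, hflux⟩ := S.exists_ckBound_perturbTransfer_mul_field
  exact ⟨C * D, by positivity, fun u hu ρ hρ g K hg hp hK =>
    (hP _ _ (hflux u hu ρ hρ g K hg hp hK).deriv).mono (by linarith)⟩

variable {S}

theorem integral_P_theta {u ρ g : ℝ → ℝ} (hu : CkBound (k + 4) u S.η)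
    (hρ : IsInvariant (S.perturbed u) ρ) (hg : Continuous g) (hp : Function.Periodic g 1) :
    ∫ x in (0 : ℝ)..1, S.P (S.theta u ρ g) x = 0 := by
  obtain ⟨K, hK⟩ := exists_forall_abs_le_of_periodic hg one_ne_zero hp
  obtain ⟨C, -, hflux⟩ := S.exists_ckBound_perturbTransfer_mul_field
  have h := hflux u hu ρ hρ g K hg hp hK
  exact (S.isBoundedTransfer.integral _ h.deriv.continuous h.deriv.periodic).trans
    (integral_deriv_eq_zero h.contDiff_one h.periodic)

end MeanFieldSystem

namespace MeanFieldSystem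

variable {k : ℕ} (S : MeanFieldSystem k)

/-! ### Self-consistent densities -/

/-- The times `|t| ≤ ε` are small enough for self-consistent densities to be studied by contraction
arguments. The constant `C` bounds the dependence of the invariant density on the perturbation, and
the operator `P Θ`. -/
structure IsTimeRange (ε C : ℝ) : Prop where
  pos : 0 < ε
  nonneg : 0 ≤ C
  small : ε * S.H ≤ S.η
  half : C * (ε * S.H) ≤ 1 / 2
  mul_le : ε * C ≤ (1 - S.θ) / 2
  ckBound_sub : ∀ u w ζ, CkBound (k + 4) u S.η → CkBound (k + 4) w S.η →
    CkBound (k + 4) (fun x => w x - u x) ζ →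
    ∀ ρ ρ', IsInvariant (S.perturbed u) ρ → IsInvariant (S.perturbed w) ρ' →
    CkBound 2 (fun x => ρ' x - ρ x) (C * ζ)
  ckBound_theta : ∀ u, CkBound (k + 4) u S.η → ∀ ρ, IsInvariant (S.perturbed u) ρ →
    ∀ g K, Continuous g → Function.Periodic g 1 → (∀ x, |g x| ≤ K) →
    CkBound 1 (S.P (S.theta u ρ g)) (C * K)

theorem exists_isTimeRange : ∃ ε C, S.IsTimeRange ε C := by
  obtain ⟨C₁, hC₁, hsub⟩ := S.exists_ckBound_invariant_sub
  obtain ⟨C₂, hC₂, htheta⟩ := S.exists_ckBound_P_theta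
  have hsmall (c : ℝ) {b : ℝ} (hb : 0 < b) : ∀ᶠ ε in nhdsWithin (0 : ℝ) (Ioi 0), ε * c ≤ b :=
    (((continuous_mul_const c).tendsto' 0 0 (zero_mul c)).eventually_le_const hb).filter_mono
      nhdsWithin_le_nhds
  obtain ⟨ε, ⟨⟨⟨h₁, h₂⟩, h₃⟩, hε⟩⟩ := ((((hsmall S.H S.η_pos).and
    (hsmall ((C₁ + C₂) * S.H) one_half_pos)).and
    (hsmall (C₁ + C₂) (half_pos (sub_pos.2 S.lt_one)))).and self_mem_nhdsWithin).exists
  refine ⟨ε, C₁ + C₂, hε, by positivity, h₁, by linarith, h₃, fun u w ζ hu hw hζ ρ ρ' hρ hρ' => ?_,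
    fun u hu ρ hρ g K hg hp hK => ?_⟩
  · exact (hsub u w ζ hu hw hζ ρ ρ' hρ hρ').mono
      (mul_le_mul_of_nonneg_right (by linarith) hζ.nonneg)
  · exact (htheta u hu ρ hρ g K hg hp hK).mono
      (mul_le_mul_of_nonneg_right (by linarith) ((abs_nonneg _).trans (hK 0)))

namespace IsTimeRange

variable {S} {ε C t s : ℝ} {ρ ρ' : ℝ → ℝ}

theorem ckBound_coupling (h : S.IsTimeRange ε C) (ht : |t| ≤ ε) {ψ : ℝ → ℝ}
    (hψ : IsDensity ψ) : CkBound (k + 4) (S.coupling t ψ) S.η := by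
  refine ((S.ckBound_field ψ 1 hψ.continuous hψ.periodic hψ.integral_abs_le).const_mul t).mono ?_
  rw [mul_one]
  exact (mul_le_mul_of_nonneg_right ht S.H_nonneg).trans h.small

theorem mul_abs_mul_le (h : S.IsTimeRange ε C) (ht : |t| ≤ ε) {D : ℝ} (hD : 0 ≤ D) :
    C * (|t| * (S.H * D)) ≤ 1 / 2 * D := by
  have hH := S.H_nonneg
  have hC := h.nonneg
  calc C * (|t| * (S.H * D)) ≤ C * (ε * (S.H * D)) := by gcongr
    _ = C * (ε * S.H) * D := by ring
    _ ≤ 1 / 2 * D := mul_le_mul_of_nonneg_right h.half hD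

theorem exists_isSelfConsistent (h : S.IsTimeRange ε C) (ht : |t| ≤ ε) :
    ∃ ρ, S.IsSelfConsistent t ρ := by
  have hinv (ψ : ℝ → ℝ) (hψ : IsDensity ψ) := exists_isInvariant (h.ckBound_coupling ht hψ)
  choose! R hRdens hRinv using hinv
  have hlip (ψ χ : ℝ → ℝ) (hψ : IsDensity ψ) (hχ : IsDensity χ) (D : ℝ)
      (hD : ∀ x, |χ x - ψ x| ≤ D) (x : ℝ) : |R χ x - R ψ x| ≤ (1 / 2 : NNReal) * D := by
    have hsub := (h.ckBound_sub _ _ _ (h.ckBound_coupling ht hψ) (h.ckBound_coupling ht hχ)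
      (S.ckBound_coupling_sub (s := t) (t := t) hψ hχ hD) _ _ (hRinv ψ hψ) (hRinv χ hχ)).abs_le x
    rw [sub_self, abs_zero, zero_mul, zero_add] at hsub
    simpa using hsub.trans (h.mul_abs_mul_le ht ((abs_nonneg _).trans (hD 0)))
  obtain ⟨ψ, hψ, hfix⟩ := exists_isDensity_eq_self (NNReal.half_lt_self one_ne_zero) hRdens hlip
  have hR := (hRinv ψ hψ).eq
  rw [hfix] at hR
  exact ⟨ψ, hψ, hR⟩

theorem abs_sub_le (h : S.IsTimeRange ε C) (ht : |t| ≤ ε) (hs : |s| ≤ ε)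
    (hρ : S.IsSelfConsistent t ρ) (hρ' : S.IsSelfConsistent s ρ') (x : ℝ) :
    |ρ' x - ρ x| ≤ 2 * C * S.H * |s - t| := by
  have hbdd : BddAbove (range fun y => |ρ' y - ρ y|) := by
    obtain ⟨M, hM⟩ := exists_forall_abs_le_of_periodic
      (hρ'.isDensity.continuous.sub hρ.isDensity.continuous) one_ne_zero
      (hρ'.isDensity.periodic.sub hρ.isDensity.periodic)
    exact ⟨M, forall_mem_range.2 hM⟩
  set D := ⨆ y, |ρ' y - ρ y|
  have hD (y : ℝ) : |ρ' y - ρ y| ≤ D := le_ciSup hbdd y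
  have hself : D ≤ C * (|s - t| * S.H) + 1 / 2 * D := by
    refine ciSup_le fun y => ?_
    have hsub := (h.ckBound_sub _ _ _ (h.ckBound_coupling ht hρ.isDensity)
      (h.ckBound_coupling hs hρ'.isDensity)
      (S.ckBound_coupling_sub hρ.isDensity hρ'.isDensity hD) _ _ hρ.isInvariant
      hρ'.isInvariant).abs_le y
    linarith [h.mul_abs_mul_le ht ((abs_nonneg _).trans (hD 0))]
  linarith [hD x]

theorem ckBound_coupling_sub (h : S.IsTimeRange ε C) (ht : |t| ≤ ε) (hs : |s| ≤ ε)
    (hρ : S.IsSelfConsistent t ρ) (hρ' : S.IsSelfConsistent s ρ') :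
    CkBound (k + 4) (fun x => S.coupling s ρ' x - S.coupling t ρ x) (2 * S.H * |s - t|) := by
  refine (S.ckBound_coupling_sub hρ.isDensity hρ'.isDensity (h.abs_sub_le ht hs hρ hρ')).mono ?_
  have hH := S.H_nonneg
  have hhalf : S.H * (C * (|t| * S.H)) ≤ S.H * (1 / 2) := by
    have := h.mul_abs_mul_le ht zero_le_one
    gcongr
    simpa using this
  linarith [mul_le_mul_of_nonneg_right hhalf (abs_nonneg (s - t))]

theorem isSelfConsistent_unique (h : S.IsTimeRange ε C) (ht : |t| ≤ ε)
    (hρ : S.IsSelfConsistent t ρ) (hρ' : S.IsSelfConsistent t ρ') : ρ' = ρ := by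
  ext x
  simpa [sub_eq_zero] using h.abs_sub_le ht ht hρ hρ' x

theorem contDiff (h : S.IsTimeRange ε C) (ht : |t| ≤ ε) (hρ : S.IsSelfConsistent t ρ) :
    ContDiff ℝ (k + 3 : ℕ) ρ := by
  obtain ⟨_, -, hbound⟩ := S.exists_ckBound_invariant
  exact (hbound _ (h.ckBound_coupling ht hρ.isDensity) ρ hρ.isInvariant).contDiff

theorem density_pos (h : S.IsTimeRange ε C) (ht : |t| ≤ ε) (hρ : S.IsSelfConsistent t ρ)
    (x : ℝ) : 0 < ρ x := by
  obtain ⟨z, hz⟩ := hρ.isDensity.exists_pos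
  have hu := h.ckBound_coupling ht hρ.isDensity
  have hpert : IsPerturbation (k + 4) 2 (S.coupling t ρ) := hu.isPerturbation_two S.le_half
  refine pos_of_expanding S.one_lt (S.continuous_map.comp (continuous_id.add hu.continuous))
    (S.expanding _ hu) hρ.isDensity.continuous hρ.isDensity.periodic (fun x hx => ?_) hz x
  have hQ : 0 < perturbTransfer (S.coupling t ρ) ρ (x + S.coupling t ρ x) := by
    rw [perturbTransfer, hpert.perturbInv_apply]
    exact mul_pos (hpert.weight_pos x) hx
  exact (S.map_pos _ (hpert.isTransfer.map_nonneg ρ hρ.isDensity.nonneg) _ hQ).trans_eq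
    (congrFun hρ.eq _)

end IsTimeRange

end MeanFieldSystem

namespace MeanFieldSystem

variable {k : ℕ} {S : MeanFieldSystem k} {ε C t s : ℝ} {u ρ ρ' : ℝ → ℝ}

/-! ### Linear response on the line -/

theorem theta_add (hu : CkBound (k + 4) u S.η) (hρ : IsInvariant (S.perturbed u) ρ)
    {g g' : ℝ → ℝ} (hg : Continuous g) (hg' : Continuous g') (hp : Function.Periodic g 1)
    (hp' : Function.Periodic g' 1) :
    S.theta u ρ (fun x => g x + g' x) = fun x => S.theta u ρ g x + S.theta u ρ g' x := by
  obtain ⟨C, -, hC⟩ := S.exists_ckBound_perturbTransfer_mul_field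
  have hdiff {g : ℝ → ℝ} (hg : Continuous g) (hp : Function.Periodic g 1) :
      Differentiable ℝ (perturbTransfer u fun x => ρ x * S.field g x) := by
    obtain ⟨K, hK⟩ := exists_forall_abs_le_of_periodic hg one_ne_zero hp
    exact (hC u hu ρ hρ g K hg hp hK).differentiable
  have hpert : IsPerturbation (k + 4) 2 u := hu.isPerturbation_two S.le_half
  ext x
  simp only [theta, S.field_add _ _ hg hg', mul_add]
  rw [hpert.isTransfer.add]
  exact deriv_fun_add (hdiff hg hp x) (hdiff hg' hp' x)

theorem theta_const_mul (hu : CkBound (k + 4) u S.η) (r : ℝ) (ρ g : ℝ → ℝ) :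
    S.theta u ρ (fun x => r * g x) = fun x => r * S.theta u ρ g x := by
  have hpert : IsPerturbation (k + 4) 2 u := hu.isPerturbation_two S.le_half
  ext x
  simp only [theta, S.field_const_mul, mul_left_comm _ r]
  rw [hpert.isTransfer.const_mul, deriv_const_mul_field]

variable (S) in
/-- The linearization `g ↦ P Q_u g - t P Θ g`, with `u` the coupling by `ρ` at time `t`, of the
self-consistent transfer operator at `ρ`. -/
noncomputable def linearized (t : ℝ) (ρ g : ℝ → ℝ) (x : ℝ) : ℝ :=
  S.perturbed (S.coupling t ρ) g x - t * S.P (S.theta (S.coupling t ρ) ρ g) x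

theorem linearized_add (hu : CkBound (k + 4) (S.coupling t ρ) S.η)
    (hρ : IsInvariant (S.perturbed (S.coupling t ρ)) ρ) {g g' : ℝ → ℝ} (hg : Continuous g)
    (hg' : Continuous g') (hp : Function.Periodic g 1) (hp' : Function.Periodic g' 1) :
    S.linearized t ρ (fun x => g x + g' x) =
      fun x => S.linearized t ρ g x + S.linearized t ρ g' x := by
  have hL : S.perturbed (S.coupling t ρ) (fun x => g x + g' x) = _ :=
    (S.isContracting _ hu).add g g'
  ext x
  rw [linearized, hL, theta_add hu hρ hg hg' hp hp', S.isBoundedTransfer.add]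
  simp only [linearized, perturbed]
  ring

theorem linearized_const_mul (hu : CkBound (k + 4) (S.coupling t ρ) S.η) (r : ℝ) (g : ℝ → ℝ) :
    S.linearized t ρ (fun x => r * g x) = fun x => r * S.linearized t ρ g x := by
  have hL : S.perturbed (S.coupling t ρ) (fun x => r * g x) = _ :=
    (S.isContracting _ hu).const_mul r g
  ext x
  rw [linearized, hL, theta_const_mul hu, S.isBoundedTransfer.const_mul]
  simp only [linearized, perturbed]
  ring

theorem deriv_perturbTransfer_coupling_sub (hu : CkBound (k + 4) (S.coupling t ρ) S.η)
    (hρ : IsInvariant (S.perturbed (S.coupling t ρ)) ρ) (hρ' : Continuous ρ')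
    (hp' : Function.Periodic ρ' 1) (x : ℝ) :
    deriv (perturbTransfer (S.coupling t ρ)
        fun y => (S.coupling s ρ' y - S.coupling t ρ y) * ρ y) x =
      (s - t) * S.theta (S.coupling t ρ) ρ ρ x +
        s * S.theta (S.coupling t ρ) ρ (fun y => ρ' y - ρ y) x := by
  have hδ : Continuous fun y => ρ' y - ρ y := hρ'.sub hρ.continuous
  have hδp : Function.Periodic (fun y => ρ' y - ρ y) 1 := hp'.sub hρ.periodic
  have hflux : (fun y => (S.coupling s ρ' y - S.coupling t ρ y) * ρ y) =
      fun y => ρ y * S.field (fun z => (s - t) * ρ z + s * (ρ' z - ρ z)) y := by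
    ext y
    rw [S.field_add _ _ (hρ.continuous.const_mul _) (hδ.const_mul _),
      S.field_const_mul, S.field_const_mul, S.field_sub hρ' hρ.continuous, coupling, coupling]
    ring
  have hp (c : ℝ) {g : ℝ → ℝ} (hg : Function.Periodic g 1) :
      Function.Periodic (fun x => c * g x) 1 := fun x => by simp only [hg x]
  rw [hflux]
  change S.theta _ ρ _ x = _
  rw [theta_add hu hρ (hρ.continuous.const_mul _) (hδ.const_mul _)
    (hp _ hρ.periodic) (hp _ hδp), theta_const_mul hu, theta_const_mul hu]

namespace IsTimeRange

theorem ckBound_linearized (h : S.IsTimeRange ε C) (ht : |t| ≤ ε) (hρ : S.IsSelfConsistent t ρ)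
    {g : ℝ → ℝ} {K : ℝ} (hg : CkBound 1 g K) (h0 : ∫ x in (0 : ℝ)..1, g x = 0) :
    CkBound 1 (S.linearized t ρ g) ((1 + S.θ) / 2 * K) := by
  have hu := h.ckBound_coupling ht hρ.isDensity
  have hL := ((S.isContracting _ hu).of_le (Nat.le_add_left 1 (k + 2))).ckBound_one_transfer hg h0
  have htheta := (h.ckBound_theta _ hu ρ hρ.isInvariant g K hg.continuous hg.periodic
    hg.abs_le).const_mul t
  refine (hL.sub htheta).mono ?_
  have hC := h.nonneg
  have hK := hg.nonneg
  have hsmall : |t| * (C * K) ≤ (1 - S.θ) / 2 * K := by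
    calc |t| * (C * K) ≤ ε * (C * K) := by gcongr
      _ = ε * C * K := by ring
      _ ≤ (1 - S.θ) / 2 * K := mul_le_mul_of_nonneg_right h.mul_le hK
  linarith

theorem integral_linearized (h : S.IsTimeRange ε C) (ht : |t| ≤ ε) (hρ : S.IsSelfConsistent t ρ)
    {g : ℝ → ℝ} {K : ℝ} (hg : CkBound 1 g K) (h0 : ∫ x in (0 : ℝ)..1, g x = 0) :
    ∫ x in (0 : ℝ)..1, S.linearized t ρ g x = 0 := by
  have hu := h.ckBound_coupling ht hρ.isDensity
  have hT := S.isContracting _ hu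
  have htheta := h.ckBound_theta _ hu ρ hρ.isInvariant g K hg.continuous hg.periodic hg.abs_le
  have hLc : Continuous (S.perturbed (S.coupling t ρ) g) := hT.continuous g hg.continuous
  have hL : ∫ x in (0 : ℝ)..1, S.perturbed (S.coupling t ρ) g x = 0 :=
    (hT.integral g hg.continuous hg.periodic).trans h0
  simp only [linearized]
  rw [intervalIntegral.integral_sub (hLc.intervalIntegrable _ _)
    ((htheta.continuous.const_mul t).intervalIntegrable _ _), intervalIntegral.integral_const_mul,
    integral_P_theta hu hρ.isInvariant hg.continuous hg.periodic, hL, mul_zero, sub_zero]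

theorem exists_ckBound_expansion (h : S.IsTimeRange ε C) : ∃ D, 0 ≤ D ∧ ∀ s t, |s| ≤ ε → |t| ≤ ε →
    ∀ ρ ρ', S.IsSelfConsistent t ρ → S.IsSelfConsistent s ρ' →
    CkBound 1 (fun x => S.perturbed (S.coupling s ρ') ρ x - ρ x +
      ((s - t) * S.P (S.theta (S.coupling t ρ) ρ ρ) x +
        s * S.P (S.theta (S.coupling t ρ) ρ (fun y => ρ' y - ρ y)) x)) (D * |s - t| ^ 2) := by
  obtain ⟨M, hM, hρM⟩ := S.exists_ckBound_invariant
  obtain ⟨C₁, hC₁, hP⟩ := S.exists_ckBound_P 1 (by lia)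
  obtain ⟨C₂, hC₂, hexp⟩ := exists_ckBound_perturbTransfer_expansion 1 zero_le_two
  refine ⟨C₁ * (C₂ * ((2 * S.H) ^ 2 * M)), by positivity, fun s t hs ht ρ ρ' hρ hρ' => ?_⟩
  have hu := h.ckBound_coupling ht hρ.isDensity
  have hw := h.ckBound_coupling hs hρ'.isDensity
  have hrem := hP _ _ (hexp _ _ _ (hu.isPerturbation_two S.le_half |>.of_le (by lia))
    (hw.isPerturbation_two S.le_half |>.of_le (by lia))
    ((h.ckBound_coupling_sub ht hs hρ hρ').of_le (by lia)) ρ M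
    ((hρM _ hu ρ hρ.isInvariant).of_le (by lia)))
  simp only [deriv_perturbTransfer_coupling_sub hu hρ.isInvariant hρ'.isDensity.continuous
    hρ'.isDensity.periodic, S.isBoundedTransfer.add, S.isBoundedTransfer.sub,
    S.isBoundedTransfer.const_mul] at hrem
  have hinv : S.P (perturbTransfer (S.coupling t ρ) ρ) = ρ := hρ.eq
  rw [hinv] at hrem
  exact hrem.mono (by rw [mul_pow]; linarith)

theorem exists_ckBound_perturbed_sub (h : S.IsTimeRange ε C) : ∃ D, 0 ≤ D ∧ ∀ s t, |s| ≤ ε →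
    |t| ≤ ε → ∀ ρ ρ', S.IsSelfConsistent t ρ → S.IsSelfConsistent s ρ' →
    CkBound 1 (fun x => S.perturbed (S.coupling s ρ') (fun y => ρ' y - ρ y) x -
      S.perturbed (S.coupling t ρ) (fun y => ρ' y - ρ y) x) (D * |s - t| ^ 2) := by
  obtain ⟨C₁, hC₁, hP⟩ := S.exists_ckBound_P 1 (by lia)
  obtain ⟨C₂, hC₂, hQ⟩ := exists_ckBound_perturbTransfer_sub_perturbTransfer 1 zero_le_two
  have hC := h.nonneg
  refine ⟨C₁ * (C₂ * (C * (2 * S.H) ^ 2)), by positivity, fun s t hs ht ρ ρ' hρ hρ' => ?_⟩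
  have hu := h.ckBound_coupling ht hρ.isDensity
  have hw := h.ckBound_coupling hs hρ'.isDensity
  have hζ := h.ckBound_coupling_sub ht hs hρ hρ'
  have hδ := h.ckBound_sub _ _ _ hu hw hζ _ _ hρ.isInvariant hρ'.isInvariant
  have hdiff := hP _ _ (hQ _ _ _ (hu.isPerturbation_two S.le_half |>.of_le (by lia))
    (hw.isPerturbation_two S.le_half |>.of_le (by lia)) (hζ.of_le (by lia)) _ _ hδ)
  rw [S.isBoundedTransfer.sub] at hdiff
  exact hdiff.mono (by linarith)

theorem exists_ckBound_remainder (h : S.IsTimeRange ε C) : ∃ D, 0 ≤ D ∧ ∀ s t, |s| ≤ ε → |t| ≤ ε →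
    ∀ ρ ρ', S.IsSelfConsistent t ρ → S.IsSelfConsistent s ρ' →
    CkBound 1 (fun x => ρ' x - ρ x - S.linearized t ρ (fun y => ρ' y - ρ y) x +
      (s - t) * S.P (S.theta (S.coupling t ρ) ρ ρ) x) (D * |s - t| ^ 2) := by
  obtain ⟨D₁, hD₁, hexp⟩ := h.exists_ckBound_expansion
  obtain ⟨D₂, hD₂, hsub⟩ := h.exists_ckBound_perturbed_sub
  have hC := h.nonneg
  have hH := S.H_nonneg
  refine ⟨D₂ + D₁ + C * (2 * C * S.H), by positivity, fun s t hs ht ρ ρ' hρ hρ' => ?_⟩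
  have hw := h.ckBound_coupling hs hρ'.isDensity
  have htheta := (h.ckBound_theta _ (h.ckBound_coupling ht hρ.isDensity) ρ hρ.isInvariant _ _
    (hρ'.isDensity.continuous.sub hρ.isDensity.continuous)
    (hρ'.isDensity.periodic.sub hρ.isDensity.periodic)
    (h.abs_sub_le ht hs hρ hρ')).const_mul (s - t)
  have heq : (fun x => ρ' x - ρ x - S.linearized t ρ (fun y => ρ' y - ρ y) x +
      (s - t) * S.P (S.theta (S.coupling t ρ) ρ ρ) x) = fun x =>
      (S.perturbed (S.coupling s ρ') (fun y => ρ' y - ρ y) x -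
        S.perturbed (S.coupling t ρ) (fun y => ρ' y - ρ y) x) +
      (S.perturbed (S.coupling s ρ') ρ x - ρ x +
        ((s - t) * S.P (S.theta (S.coupling t ρ) ρ ρ) x +
          s * S.P (S.theta (S.coupling t ρ) ρ (fun y => ρ' y - ρ y)) x)) -
      (s - t) * S.P (S.theta (S.coupling t ρ) ρ (ρ' - ρ)) x := by
    ext x
    rw [S.perturbed_sub hw, hρ'.eq, linearized]
    change _ = _ - (s - t) * S.P (S.theta (S.coupling t ρ) ρ fun y => ρ' y - ρ y) x
    ring
  rw [heq]
  refine (((hsub s t hs ht ρ ρ' hρ hρ').add (hexp s t hs ht ρ ρ' hρ hρ')).sub htheta).mono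
    (le_of_eq ?_)
  ring

end IsTimeRange

end MeanFieldSystem

/-! ### Functions with a quadratic first order remainder -/

section QuadraticRemainder

variable {E : Type*} [NormedAddCommGroup E] [NormedSpace ℝ E] {f g : ℝ → E} {ε D : ℝ}

theorem hasDerivAt_of_sq_remainder
    (h : ∀ s t, |s| < ε → |t| < ε → ‖f s - f t - (s - t) • g t‖ ≤ D * |s - t| ^ 2)
    {t : ℝ} (ht : |t| < ε) : HasDerivAt f (g t) t := by
  have hbigO : (fun s => f s - f t - (s - t) • g t) =O[nhds t] fun s => ‖s - t‖ ^ 2 := by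
    refine Asymptotics.IsBigO.of_bound D ?_
    filter_upwards [continuous_abs.continuousAt.eventually_lt_const ht] with s hs
    simpa using h s t hs ht
  exact hasDerivAt_iff_isLittleO.2
    (hbigO.trans_isLittleO (Asymptotics.isLittleO_pow_sub_sub t one_lt_two))

theorem norm_sub_le_of_sq_remainder
    (h : ∀ s t, |s| < ε → |t| < ε → ‖f s - f t - (s - t) • g t‖ ≤ D * |s - t| ^ 2) {s t : ℝ}
    (hs : |s| < ε) (ht : |t| < ε) : ‖g s - g t‖ ≤ 2 * D * |s - t| := by
  rcases eq_or_ne s t with rfl | hst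
  · simp
  have hpos : 0 < |s - t| := abs_pos.2 (sub_ne_zero.2 hst)
  have hts := h t s ht hs
  rw [abs_sub_comm t s] at hts
  refine le_of_mul_le_mul_left ?_ hpos
  calc |s - t| * ‖g s - g t‖ = ‖(s - t) • (g s - g t)‖ := by rw [norm_smul, Real.norm_eq_abs]
    _ = ‖(f s - f t - (s - t) • g t) + (f t - f s - (t - s) • g s)‖ := by congr 1; module
    _ ≤ D * |s - t| ^ 2 + D * |s - t| ^ 2 := norm_add_le_of_le (h s t hs ht) hts
    _ = |s - t| * (2 * D * |s - t|) := by ring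

theorem contDiffOn_of_sq_remainder
    (h : ∀ s t, |s| < ε → |t| < ε → ‖f s - f t - (s - t) • g t‖ ≤ D * |s - t| ^ 2) :
    ContDiffOn ℝ 1 f (Ioo (-ε) ε) := by
  have hderiv (t : ℝ) (ht : t ∈ Ioo (-ε) ε) : HasDerivAt f (g t) t :=
    hasDerivAt_of_sq_remainder h (abs_lt.2 ht)
  have hlip : LipschitzOnWith (2 * D).toNNReal g (Ioo (-ε) ε) :=
    LipschitzOnWith.of_dist_le_mul fun s hs t ht => by
      rw [dist_eq_norm, Real.dist_eq]
      exact (norm_sub_le_of_sq_remainder h (abs_lt.2 hs) (abs_lt.2 ht)).trans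
        (mul_le_mul_of_nonneg_right (Real.le_coe_toNNReal _) (abs_nonneg _))
  rw [← zero_add 1, contDiffOn_succ_iff_deriv_of_isOpen isOpen_Ioo, contDiffOn_zero]
  exact ⟨fun t ht => (hderiv t ht).differentiableAt.differentiableWithinAt, by simp,
    hlip.continuousOn.congr fun t ht => (hderiv t ht).deriv⟩

theorem contDiffOn_and_hasDerivAt_of_sq_remainder {g : ∀ t : ℝ, |t| ≤ ε → E}
    (h : ∀ s t, |s| ≤ ε → ∀ ht : |t| ≤ ε, ‖f s - f t - (s - t) • g t ht‖ ≤ D * |s - t| ^ 2) :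
    ContDiffOn ℝ 1 f (Ioo (-ε) ε) ∧ ∀ t (ht : |t| ≤ ε), |t| < ε → HasDerivAt f (g t ht) t := by
  let g' (t : ℝ) : E := if ht : |t| ≤ ε then g t ht else 0
  have hg (t : ℝ) (ht : |t| ≤ ε) : g' t = g t ht := dif_pos ht
  have hrem (s t : ℝ) (hs : |s| < ε) (ht : |t| < ε) :
      ‖f s - f t - (s - t) • g' t‖ ≤ D * |s - t| ^ 2 := by
    rw [hg t ht.le]
    exact h s t hs.le ht.le
  exact ⟨contDiffOn_of_sq_remainder hrem, fun t ht ht' =>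
    hg t ht ▸ hasDerivAt_of_sq_remainder hrem ht'⟩

end QuadraticRemainder

/-! ### The spaces `C¹` and `C¹₀` -/

theorem continuous_of_lift {X : Type*} [TopologicalSpace X] {φ : S1 → X}
    (h : Continuous fun x : ℝ => φ (x : S1)) : Continuous φ :=
  (QuotientAddGroup.isQuotientMap_mk (N := AddSubgroup.zmultiples (1 : ℝ))).continuous_iff.2 h

theorem periodic_lift {X : Type*} (φ : S1 → X) : Function.Periodic (fun x : ℝ => φ (x : S1)) 1 :=
  fun x => by simp only [AddCircle.coe_add_period]

theorem integral_eq_integral_lift (φ : S1 → ℝ) :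
    ∫ x, φ x = ∫ x in (0 : ℝ)..1, φ (x : S1) := by
  rw [← UnitAddCircle.intervalIntegral_preimage 0 φ, zero_add]

namespace C1

/-- The periodic function on the line that represents an element of `C¹(S¹, ℝ)`. -/
def lift (g : C1) (x : ℝ) : ℝ := C1.fn g (x : S1)

theorem hasDerivAt_lift (g : C1) (x : ℝ) : HasDerivAt (lift g) (g.1.2 (x : S1)) x := g.2 x

theorem ckBound_lift (g : C1) : CkBound 1 (lift g) ‖g‖ := by
  refine CkBound.succ_iff.2 ⟨fun x => (hasDerivAt_lift g x).differentiableAt, periodic_lift _,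
    fun x => (g.1.1.norm_coe_le_norm (x : S1)).trans (norm_fst_le g.1), ?_⟩
  rw [show deriv (lift g) = fun x : ℝ => g.1.2 (x : S1) from
    funext fun x => (hasDerivAt_lift g x).deriv]
  exact CkBound.zero_iff.2 ⟨g.1.2.continuous.comp (AddCircle.continuous_mk' 1), periodic_lift _,
    fun x => (g.1.2.norm_coe_le_norm (x : S1)).trans (norm_snd_le g.1)⟩

theorem norm_le {g : C1} {K : ℝ} (h : CkBound 1 (lift g) K) : ‖g‖ ≤ K := by
  have hfst (x : S1) : ‖g.1.1 x‖ ≤ K := by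
    induction x using QuotientAddGroup.induction_on with
    | H y => exact h.abs_le y
  have hsnd (x : S1) : ‖g.1.2 x‖ ≤ K := by
    induction x using QuotientAddGroup.induction_on with
    | H y => exact (hasDerivAt_lift g y).deriv ▸ h.abs_deriv_le y
  exact (max_le ((ContinuousMap.norm_le _ h.nonneg).2 hfst)
    ((ContinuousMap.norm_le _ h.nonneg).2 hsnd) : ‖g.1‖ ≤ K)

theorem ext_lift {g g' : C1} (h : ∀ x, lift g x = lift g' x) : g = g' := by
  rw [← sub_eq_zero, ← norm_le_zero_iff]
  refine norm_le ?_
  rw [show lift (g - g') = fun _ => 0 from funext fun x => sub_eq_zero.2 (h x)]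
  simpa using CkBound.const 1 0

/-- The element of `C¹(S¹, ℝ)` with a given lift. -/
noncomputable def mk (φ : ℝ → ℝ) (h : ContDiff ℝ 1 φ) (hp : Function.Periodic φ 1) : C1 :=
  ⟨(⟨hp.lift, continuous_of_lift (by simpa using h.continuous)⟩,
    ⟨(periodic_deriv hp).lift, continuous_of_lift (by simpa using h.continuous_deriv le_rfl)⟩),
    fun x => by simpa using (h.differentiable one_ne_zero x).hasDerivAt⟩

theorem mem_zeroMean {g : C1} : g ∈ c1ZeroMean ↔ ∫ x in (0 : ℝ)..1, lift g x = 0 :=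
  (integral_eq_integral_lift g.fn).congr_left

theorem sub_mem_zeroMean {g g' : C1} (hg : IsDensity (lift g)) (hg' : IsDensity (lift g')) :
    g' - g ∈ c1ZeroMean := by
  have hsub : ∫ x in (0 : ℝ)..1, lift g' x - lift g x = 0 := by
    rw [intervalIntegral.integral_sub (hg'.continuous.intervalIntegrable _ _)
      (hg.continuous.intervalIntegrable _ _), hg'.integral, hg.integral, sub_self]
  exact mem_zeroMean.2 hsub

end C1

theorem isClosed_c1Submodule : IsClosed (c1Submodule : Set (C(S1, ℝ) × C(S1, ℝ))) := by
  refine IsSeqClosed.isClosed fun p q hp hq x => ?_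
  have hsnd := ContinuousMap.tendsto_iff_tendstoUniformly.1 ((continuous_snd.tendsto q).comp hq)
  have hfst := ContinuousMap.tendsto_iff_tendstoUniformly.1 ((continuous_fst.tendsto q).comp hq)
  exact hasDerivAt_of_tendstoUniformly (l := Filter.atTop)
    (f := fun n (s : ℝ) => (p n).1 (s : S1)) (f' := fun n (s : ℝ) => (p n).2 (s : S1))
    (g' := fun s : ℝ => q.2 (s : S1)) (hsnd.comp fun s : ℝ => (s : S1))
    (Filter.Eventually.of_forall fun n s => hp n s) (fun s => hfst.tendsto_at (s : S1)) x

instance : CompleteSpace C1 := isClosed_c1Submodule.completeSpace_coe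

theorem isClosed_c1ZeroMean : IsClosed (c1ZeroMean : Set C1) := by
  have hint : Continuous fun φ : C(S1, ℝ) => ∫ x, φ x :=
    (continuous_integral.comp (ContinuousMap.toLp 1 volume ℝ).continuous).congr fun φ =>
      integral_congr_ae (ContinuousMap.coeFn_toLp volume φ)
  exact isClosed_eq (hint.comp (continuous_fst.comp continuous_subtype_val)) continuous_const

instance : CompleteSpace c1ZeroMean := isClosed_c1ZeroMean.completeSpace_coe

theorem exists_continuousLinearEquiv_sub {𝕜 E : Type*} [NontriviallyNormedField 𝕜]
    [NormedAddCommGroup E] [NormedSpace 𝕜 E] [CompleteSpace E] (B : E →ₗ[𝕜] E) {q : ℝ}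
    (hq₀ : 0 ≤ q) (hq : q < 1) (hB : ∀ x, ‖B x‖ ≤ q * ‖x‖) :
    ∃ T : E ≃L[𝕜] E, ∀ x, T x = x - B x :=
  ⟨ContinuousLinearEquiv.unitsEquiv 𝕜 E (Units.oneSub (B.mkContinuous q hB)
    ((B.mkContinuous_norm_le hq₀ hB).trans_lt hq)), fun _ => rfl⟩

theorem norm_le_inv_mul_norm_sub {E : Type*} [SeminormedAddCommGroup E] {x y : E} {q : ℝ}
    (hq : q < 1) (h : ‖y‖ ≤ q * ‖x‖) : ‖x‖ ≤ (1 - q)⁻¹ * ‖x - y‖ := by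
  rw [le_inv_mul_iff₀ (sub_pos.2 hq)]
  linarith [norm_sub_norm_le x y]

/-! ### Linear response in `C¹` -/

namespace MeanFieldSystem.IsTimeRange

variable {k : ℕ} {S : MeanFieldSystem k} {ε C t : ℝ} {ρ : ℝ → ℝ}

/-- The linearization `P_t - t P Θ_t` of the self-consistent transfer operator, as an operator on
`C¹₀`. -/
noncomputable def linearizedMap (h : S.IsTimeRange ε C) (ht : |t| ≤ ε)
    (hρ : S.IsSelfConsistent t ρ) : c1ZeroMean →ₗ[ℝ] c1ZeroMean where
  toFun g :=
    have h0 := C1.mem_zeroMean.1 g.2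
    have hb := h.ckBound_linearized ht hρ (C1.ckBound_lift g.1) h0
    ⟨C1.mk (S.linearized t ρ (C1.lift g.1)) hb.contDiff_one hb.periodic,
      C1.mem_zeroMean.2 (h.integral_linearized ht hρ (C1.ckBound_lift g.1) h0)⟩
  map_add' g g' := Subtype.ext (C1.ext_lift fun x =>
    have hg := C1.ckBound_lift g.1
    have hg' := C1.ckBound_lift g'.1
    congrFun (linearized_add (h.ckBound_coupling ht hρ.isDensity) hρ.isInvariant hg.continuous
      hg'.continuous hg.periodic hg'.periodic) x)
  map_smul' r g := Subtype.ext (C1.ext_lift fun x =>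
    congrFun (linearized_const_mul (h.ckBound_coupling ht hρ.isDensity) r (C1.lift g.1)) x)

theorem norm_linearizedMap_le (h : S.IsTimeRange ε C) (ht : |t| ≤ ε)
    (hρ : S.IsSelfConsistent t ρ) (g : c1ZeroMean) :
    ‖h.linearizedMap ht hρ g‖ ≤ (1 + S.θ) / 2 * ‖g‖ :=
  C1.norm_le (h.ckBound_linearized ht hρ (C1.ckBound_lift g.1) (C1.mem_zeroMean.1 g.2))

theorem exists_resolvent (h : S.IsTimeRange ε C) (ht : |t| ≤ ε) (hρ : S.IsSelfConsistent t ρ) :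
    ∃ T : c1ZeroMean ≃L[ℝ] c1ZeroMean, ∀ g, T g = g - h.linearizedMap ht hρ g :=
  exists_continuousLinearEquiv_sub (𝕜 := ℝ) (E := c1ZeroMean) (q := (1 + S.θ) / 2) _
    (by linarith [S.θ_nonneg]) (by linarith [S.lt_one]) (by exact h.norm_linearizedMap_le ht hρ)

/-- The operator `1 - P_t + t P Θ_t` on `C¹₀`. -/
noncomputable def resolvent (h : S.IsTimeRange ε C) (ht : |t| ≤ ε)
    (hρ : S.IsSelfConsistent t ρ) : c1ZeroMean ≃L[ℝ] c1ZeroMean :=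
  (h.exists_resolvent ht hρ).choose

theorem resolvent_apply (h : S.IsTimeRange ε C) (ht : |t| ≤ ε) (hρ : S.IsSelfConsistent t ρ)
    (g : c1ZeroMean) : h.resolvent ht hρ g = g - h.linearizedMap ht hρ g :=
  (h.exists_resolvent ht hρ).choose_spec g

theorem norm_le_norm_resolvent (h : S.IsTimeRange ε C) (ht : |t| ≤ ε)
    (hρ : S.IsSelfConsistent t ρ) (g : c1ZeroMean) :
    ‖g‖ ≤ (1 - (1 + S.θ) / 2)⁻¹ * ‖h.resolvent ht hρ g‖ := by
  rw [resolvent_apply]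
  exact norm_le_inv_mul_norm_sub (by linarith [S.lt_one]) (h.norm_linearizedMap_le ht hρ g)

/-- The function `P Θ_t(ρ(t))`, as an element of `C¹₀`. -/
noncomputable def response (h : S.IsTimeRange ε C) (ht : |t| ≤ ε)
    (hρ : S.IsSelfConsistent t ρ) : c1ZeroMean :=
  have hu := h.ckBound_coupling ht hρ.isDensity
  have hc := hρ.isDensity.continuous
  have hp := hρ.isDensity.periodic
  have hb := h.ckBound_theta _ hu ρ hρ.isInvariant ρ _ hc hp
    (exists_forall_abs_le_of_periodic hc one_ne_zero hp).choose_spec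
  ⟨C1.mk _ hb.contDiff_one hb.periodic,
    C1.mem_zeroMean.2 (integral_P_theta hu hρ.isInvariant hc hp)⟩

theorem exists_sq_remainder (h : S.IsTimeRange ε C) (ρ : ℝ → C1)
    (hρ : ∀ t, |t| ≤ ε → S.IsSelfConsistent t (C1.lift (ρ t))) : ∃ D, ∀ s t, |s| ≤ ε →
      ∀ ht : |t| ≤ ε, ‖ρ s - ρ t - (s - t) • (-((h.resolvent ht (hρ t ht)).symm
        (h.response ht (hρ t ht)) : C1))‖ ≤ D * |s - t| ^ 2 := by
  obtain ⟨D, -, hrem⟩ := h.exists_ckBound_remainder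
  refine ⟨(1 - (1 + S.θ) / 2)⁻¹ * D, fun s t hs ht => ?_⟩
  set T := h.resolvent ht (hρ t ht) with hT
  set r := h.response ht (hρ t ht)
  let δ : c1ZeroMean := ⟨ρ s - ρ t, C1.sub_mem_zeroMean (hρ t ht).isDensity (hρ s hs).isDensity⟩
  have hTδ : T (δ + (s - t) • T.symm r) =
      δ - h.linearizedMap ht (hρ t ht) δ + (s - t) • r := by
    rw [map_add, map_smul, T.apply_symm_apply, hT, resolvent_apply]
  have hbound : ‖T (δ + (s - t) • T.symm r)‖ ≤ D * |s - t| ^ 2 := by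
    rw [hTδ]
    exact C1.norm_le (hrem s t hs ht _ _ (hρ t ht) (hρ s hs))
  calc ‖ρ s - ρ t - (s - t) • (-(T.symm r : C1))‖ = ‖δ + (s - t) • T.symm r‖ := by
        rw [smul_neg, sub_neg_eq_add]; rfl
    _ ≤ (1 - (1 + S.θ) / 2)⁻¹ * ‖T (δ + (s - t) • T.symm r)‖ :=
      h.norm_le_norm_resolvent ht (hρ t ht) _
    _ ≤ (1 - (1 + S.θ) / 2)⁻¹ * (D * |s - t| ^ 2) :=
      mul_le_mul_of_nonneg_left hbound (inv_nonneg.2 (by linarith [S.lt_one]))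
    _ = (1 - (1 + S.θ) / 2)⁻¹ * D * |s - t| ^ 2 := (mul_assoc _ _ _).symm

theorem exists_family (h : S.IsTimeRange ε C) : ∃ (ρ : ℝ → C1)
    (hρ : ∀ t, |t| ≤ ε → S.IsSelfConsistent t (C1.lift (ρ t))),
    ContDiffOn ℝ 1 ρ (Ioo (-ε) ε) ∧ ∀ t (ht : |t| ≤ ε), |t| < ε →
      HasDerivAt ρ (-((h.resolvent ht (hρ t ht)).symm (h.response ht (hρ t ht)) : C1)) t := by
  have hex (t : ℝ) : ∃ g : C1, |t| ≤ ε → S.IsSelfConsistent t (C1.lift g) := by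
    by_cases ht : |t| ≤ ε
    · obtain ⟨φ, hφ⟩ := h.exists_isSelfConsistent ht
      have hdiff : ContDiff ℝ 1 φ := (h.contDiff ht hφ).of_le (by norm_cast; lia)
      exact ⟨C1.mk φ hdiff hφ.isDensity.periodic, fun _ => hφ⟩
    · exact ⟨0, fun h => absurd h ht⟩
  choose ρ hρ using hex
  obtain ⟨D, hD⟩ := h.exists_sq_remainder ρ hρ
  exact ⟨ρ, hρ, contDiffOn_and_hasDerivAt_of_sq_remainder hD⟩

end MeanFieldSystem.IsTimeRange

/-! ### Integral operators with a smooth kernel -/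

/-- A kernel of class `C^n` on the torus, as a function on the plane. -/
structure IsPeriodicKernel (n : ℕ) (κ : ℝ → ℝ → ℝ) : Prop where
  contDiff : ContDiff ℝ n fun p : ℝ × ℝ => κ p.1 p.2
  periodic_left : ∀ y, Function.Periodic (fun x => κ x y) 1
  periodic_right : ∀ x, Function.Periodic (κ x) 1

/-- The integral operator with kernel `κ`, on periodic functions on the line. -/
noncomputable def kernelMean (κ : ℝ → ℝ → ℝ) (ψ : ℝ → ℝ) (x : ℝ) : ℝ :=
  ∫ y in (0 : ℝ)..1, κ x y * ψ y

theorem kernelMean_const_mul (κ : ℝ → ℝ → ℝ) (r : ℝ) (ψ : ℝ → ℝ) :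
    kernelMean κ (fun x => r * ψ x) = fun x => r * kernelMean κ ψ x := by
  ext x
  simp only [kernelMean, mul_left_comm _ r, intervalIntegral.integral_const_mul]

theorem abs_kernelMean_le {κ : ℝ → ℝ → ℝ} {M : ℝ} (hM : ∀ x y, |κ x y| ≤ M) {ψ : ℝ → ℝ}
    (hψ : Continuous ψ) (x : ℝ) : |kernelMean κ ψ x| ≤ M * ∫ y in (0 : ℝ)..1, |ψ y| := by
  rw [← intervalIntegral.integral_const_mul]
  refine intervalIntegral.norm_integral_le_of_norm_le (f := fun y => κ x y * ψ y) zero_le_one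
    (.of_forall fun y _ => ?_) ((hψ.abs.const_mul M).intervalIntegrable _ _)
  rw [Real.norm_eq_abs, abs_mul]
  exact mul_le_mul_of_nonneg_right (hM x y) (abs_nonneg _)

namespace IsPeriodicKernel

variable {n : ℕ} {κ : ℝ → ℝ → ℝ}

theorem of_le {m : ℕ} (h : IsPeriodicKernel n κ) (hmn : m ≤ n) : IsPeriodicKernel m κ :=
  ⟨h.contDiff.of_le (by exact_mod_cast hmn), h.periodic_left, h.periodic_right⟩

theorem continuous_right (h : IsPeriodicKernel n κ) (x : ℝ) : Continuous (κ x) :=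
  h.contDiff.continuous.comp (Continuous.prodMk_right x)

theorem deriv_left (h : IsPeriodicKernel (n + 1) κ) :
    IsPeriodicKernel n fun x y => deriv (fun x => κ x y) x := by
  have hdiff : Differentiable ℝ fun p : ℝ × ℝ => κ p.1 p.2 := h.contDiff.differentiable (by simp)
  have heq : (fun p : ℝ × ℝ => deriv (fun x => κ x p.2) p.1) =
      fun p => fderiv ℝ (fun p : ℝ × ℝ => κ p.1 p.2) p (1, 0) := by
    ext p
    exact ((hdiff p).hasFDerivAt.comp_hasDerivAt p.1
      ((hasDerivAt_id p.1).prodMk (hasDerivAt_const p.1 p.2))).deriv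
  refine ⟨?_, fun y => periodic_deriv (h.periodic_left y), fun x y => ?_⟩
  · rw [heq]
    exact (h.contDiff.fderiv_right (by norm_cast)).clm_apply contDiff_const
  · simp only [h.periodic_right _ y]

theorem exists_forall_abs_le (h : IsPeriodicKernel n κ) : ∃ M, 0 ≤ M ∧ ∀ x y, |κ x y| ≤ M := by
  obtain ⟨p, -, hp⟩ := (isCompact_Icc.prod isCompact_Icc).exists_isMaxOn
    (s := Icc (0 : ℝ) 1 ×ˢ Icc (0 : ℝ) 1) ⟨(0, 0), by simp⟩ h.contDiff.continuous.abs.continuousOn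
  refine ⟨|κ p.1 p.2|, abs_nonneg _, fun x y => ?_⟩
  obtain ⟨x', hx', hxx'⟩ := (h.periodic_left y).exists_mem_Ico₀ one_pos x
  obtain ⟨y', hy', hyy'⟩ := (h.periodic_right x').exists_mem_Ico₀ one_pos y
  rw [show κ x y = κ x' y from hxx', hyy']
  exact hp (show (x', y') ∈ _ from ⟨Ico_subset_Icc_self hx', Ico_subset_Icc_self hy'⟩)

theorem hasDerivAt_kernelMean (h : IsPeriodicKernel 1 κ) {ψ : ℝ → ℝ} (hψ : Continuous ψ) (x : ℝ) :
    HasDerivAt (kernelMean κ ψ) (kernelMean (fun x y => deriv (fun x => κ x y) x) ψ x) x := by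
  obtain ⟨M, -, hM⟩ := h.deriv_left.exists_forall_abs_le
  have hdiff (y : ℝ) : Differentiable ℝ fun x => κ x y :=
    (h.contDiff.differentiable one_ne_zero).comp
      (differentiable_id.prodMk (differentiable_const y))
  refine (intervalIntegral.hasDerivAt_integral_of_dominated_loc_of_deriv_le (μ := volume)
    (s := univ) (bound := fun y => M * |ψ y|)
    (F' := fun x y => deriv (fun x => κ x y) x * ψ y) Filter.univ_mem
    (.of_forall fun x => ((h.continuous_right x).mul hψ).aestronglyMeasurable)
    (((h.continuous_right x).mul hψ).intervalIntegrable _ _)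
    ((h.deriv_left.continuous_right x).mul hψ).aestronglyMeasurable
    (.of_forall fun y _ x _ => ?_) ((hψ.abs.const_mul M).intervalIntegrable _ _)
    (.of_forall fun y _ x _ => (hdiff y x).hasDerivAt.mul_const _)).2
  rw [Real.norm_eq_abs, abs_mul]
  exact mul_le_mul_of_nonneg_right (hM x y) (abs_nonneg _)

theorem exists_ckBound_kernelMean (h : IsPeriodicKernel n κ) :
    ∃ H, 0 ≤ H ∧ ∀ (ψ : ℝ → ℝ) (B : ℝ), Continuous ψ → ∫ x in (0 : ℝ)..1, |ψ x| ≤ B →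
      CkBound n (kernelMean κ ψ) (H * B) := by
  have hperiodic (ψ : ℝ → ℝ) : Function.Periodic (kernelMean κ ψ) 1 := fun x => by
    simp only [kernelMean, h.periodic_left _ x]
  induction n generalizing κ with
  | zero =>
    obtain ⟨M, hM, hκ⟩ := h.exists_forall_abs_le
    refine ⟨M, hM, fun ψ B hψ hB => CkBound.zero_iff.2 ⟨?_, hperiodic ψ, fun x =>
      (abs_kernelMean_le hκ hψ x).trans (mul_le_mul_of_nonneg_left hB hM)⟩⟩
    exact intervalIntegral.continuous_parametric_intervalIntegral_of_continuous'
      (h.contDiff.continuous.mul (hψ.comp continuous_snd)) 0 1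
  | succ n ih =>
    obtain ⟨H, hH, hbound⟩ := ih (h.of_le n.le_succ) hperiodic
    obtain ⟨H', hH', hbound'⟩ := ih h.deriv_left fun ψ x => by
      simp only [kernelMean, h.deriv_left.periodic_left _ x]
    refine ⟨H + H', add_nonneg hH hH', fun ψ B hψ hB => ?_⟩
    have hB0 : 0 ≤ B :=
      (intervalIntegral.integral_nonneg zero_le_one fun _ _ => abs_nonneg _).trans hB
    have hderiv := (h.of_le (Nat.le_add_left 1 n)).hasDerivAt_kernelMean hψ
    refine CkBound.succ_iff.2 ⟨fun x => (hderiv x).differentiableAt, hperiodic ψ, fun x =>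
      ((hbound ψ B hψ hB).abs_le x).trans (mul_le_mul_of_nonneg_right (by linarith) hB0), ?_⟩
    rw [funext fun x => (hderiv x).deriv]
    exact (hbound' ψ B hψ hB).mono (mul_le_mul_of_nonneg_right (by linarith) hB0)

theorem kernelMean_add (h : IsPeriodicKernel n κ) {ψ χ : ℝ → ℝ} (hψ : Continuous ψ)
    (hχ : Continuous χ) :
    kernelMean κ (fun x => ψ x + χ x) = fun x => kernelMean κ ψ x + kernelMean κ χ x := by
  ext x
  simp only [kernelMean, mul_add]
  exact intervalIntegral.integral_add (((h.continuous_right x).mul hψ).intervalIntegrable _ _)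
    (((h.continuous_right x).mul hχ).intervalIntegrable _ _)

end IsPeriodicKernel

/-! ### Expanding lifts -/

/-- `F` is the lift of a circle map of class `C^{k+1}` with derivative at least `ω > 1` in absolute
value; `s` is its orientation and `n` the number of its inverse branches. -/
structure IsExpandingLift (k : ℕ) (F : ℝ → ℝ) (ω s : ℝ) (n : ℕ) : Prop where
  contDiff : ContDiff ℝ (k + 1) F
  sign : s = 1 ∨ s = -1
  one_lt : 1 < ω
  le_deriv : ∀ x, ω ≤ s * deriv F x
  add_one : ∀ x, F (x + 1) = F x + s * n

/-- The transfer operator of the circle map with lift `F` and `n` inverse branches, on functions on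
the line. -/
noncomputable def branchSum (F : ℝ → ℝ) (n : ℕ) (φ : ℝ → ℝ) (x : ℝ) : ℝ :=
  ∑ m ∈ Finset.range n, φ (Function.invFun F (x + m)) / |deriv F (Function.invFun F (x + m))|

theorem periodic_sum_range_add {w : ℝ → ℝ} {n : ℕ} (hw : Function.Periodic w n) :
    Function.Periodic (fun x => ∑ m ∈ Finset.range n, w (x + m)) 1 := fun x => by
  have hshift : ∑ m ∈ Finset.range n, w (x + 1 + m) = ∑ m ∈ Finset.range n, w (x + (m + 1 : ℕ)) :=
    Finset.sum_congr rfl fun m _ => by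
      push_cast
      ring_nf
  have htelescope := Finset.sum_range_succ (fun m : ℕ => w (x + m)) n
  rw [Finset.sum_range_succ', Nat.cast_zero, add_zero, hw x] at htelescope
  exact hshift.trans (add_right_cancel htelescope)

theorem integral_sum_range_add {w : ℝ → ℝ} (hw : Continuous w) (n : ℕ) :
    ∫ x in (0 : ℝ)..1, ∑ m ∈ Finset.range n, w (x + m) = ∫ x in (0 : ℝ)..n, w x := by
  have hadjacent := intervalIntegral.sum_integral_adjacent_intervals (μ := volume) (f := w)
    (a := fun m : ℕ => (m : ℝ)) (n := n) fun m _ => hw.intervalIntegrable _ _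
  rw [Nat.cast_zero] at hadjacent
  have hintegrable (m : ℕ) : IntervalIntegrable (fun x => w (x + m)) volume 0 1 :=
    (hw.comp (continuous_add_const (m : ℝ))).intervalIntegrable _ _
  rw [← hadjacent, intervalIntegral.integral_finsetSum fun m _ => hintegrable m]
  refine Finset.sum_congr rfl fun m _ => ?_
  rw [intervalIntegral.integral_comp_add_right, zero_add, add_comm, Nat.cast_succ]

namespace IsExpandingLift

variable {k n : ℕ} {F φ : ℝ → ℝ} {ω s : ℝ}

theorem sign_mul_self (h : IsExpandingLift k F ω s n) : s * s = 1 := by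
  rcases h.sign with rfl | rfl <;> norm_num

theorem abs_sign (h : IsExpandingLift k F ω s n) : |s| = 1 := by
  rcases h.sign with rfl | rfl <;> simp

theorem pos (h : IsExpandingLift k F ω s n) : 0 < ω := zero_lt_one.trans h.one_lt

theorem abs_deriv (h : IsExpandingLift k F ω s n) (x : ℝ) : |deriv F x| = s * deriv F x := by
  rw [← abs_of_pos (h.pos.trans_le (h.le_deriv x)), abs_mul, h.abs_sign, one_mul]

theorem le_abs_deriv (h : IsExpandingLift k F ω s n) (x : ℝ) : ω ≤ |deriv F x| :=
  (h.le_deriv x).trans_eq (h.abs_deriv x).symm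

theorem deriv_ne_zero (h : IsExpandingLift k F ω s n) (x : ℝ) : deriv F x ≠ 0 :=
  abs_pos.1 (h.pos.trans_le (h.le_abs_deriv x))

theorem differentiable (h : IsExpandingLift k F ω s n) : Differentiable ℝ F :=
  h.contDiff.differentiable (by simp)

theorem contDiff_deriv (h : IsExpandingLift k F ω s n) : ContDiff ℝ k (deriv F) :=
  (contDiff_succ_iff_deriv.1 h.contDiff).2.2

theorem mul_sub_le (h : IsExpandingLift k F ω s n) {x y : ℝ} (hxy : x ≤ y) :
    ω * (y - x) ≤ s * F y - s * F x := by
  have hdiff : Differentiable ℝ fun x => s * F x := h.differentiable.const_mul s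
  refine Convex.mul_sub_le_image_sub_of_le_deriv convex_univ hdiff.continuous.continuousOn
    hdiff.differentiableOn (fun x _ => ?_) x (mem_univ _) y (mem_univ _) hxy
  rw [deriv_const_mul _ (h.differentiable x)]
  exact h.le_deriv x

theorem mul_abs_sub_le (h : IsExpandingLift k F ω s n) (x y : ℝ) : ω * |x - y| ≤ |F x - F y| := by
  wlog hxy : y ≤ x generalizing x y
  · rw [abs_sub_comm, abs_sub_comm (F x)]
    exact this y x (le_of_not_ge hxy)
  calc ω * |x - y| = ω * (x - y) := by rw [abs_of_nonneg (sub_nonneg.2 hxy)]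
    _ ≤ s * F x - s * F y := h.mul_sub_le hxy
    _ ≤ |s * (F x - F y)| := mul_sub s _ _ ▸ le_abs_self _
    _ = |F x - F y| := by rw [abs_mul, h.abs_sign, one_mul]

theorem injective (h : IsExpandingLift k F ω s n) : Function.Injective F := fun x y hxy => by
  have hle := h.mul_abs_sub_le x y
  rw [hxy, sub_self, abs_zero] at hle
  exact sub_eq_zero.1 (abs_nonpos_iff.1 (nonpos_of_mul_nonpos_right hle h.pos))

theorem surjective (h : IsExpandingLift k F ω s n) : Function.Surjective F := by
  have hsurj : Function.Surjective fun x => s * F x := by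
    refine Continuous.surjective (by have := h.contDiff.continuous; fun_prop) ?_ ?_
    · refine Filter.tendsto_atTop_mono' _ (f₁ := fun x => s * F 0 + ω * x) ?_
        (Filter.tendsto_atTop_add_const_left _ _ (Filter.tendsto_id.const_mul_atTop h.pos))
      filter_upwards [Filter.eventually_ge_atTop 0] with x hx
      linarith [h.mul_sub_le hx]
    · refine Filter.tendsto_atBot_mono' _ (f₁ := fun x => s * F 0 + ω * x) ?_
        (Filter.tendsto_atBot_add_const_left _ _ (Filter.tendsto_id.const_mul_atBot h.pos))
      filter_upwards [Filter.eventually_le_atBot 0] with x hx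
      linarith [h.mul_sub_le hx]
  intro y
  obtain ⟨x, hx⟩ := hsurj (s * y)
  exact ⟨x, mul_left_cancel₀ (left_ne_zero_of_mul_eq_one h.sign_mul_self) hx⟩

theorem right_inv (h : IsExpandingLift k F ω s n) (x : ℝ) : F (Function.invFun F x) = x :=
  Function.rightInverse_invFun h.surjective x

theorem left_inv (h : IsExpandingLift k F ω s n) (x : ℝ) : Function.invFun F (F x) = x :=
  Function.leftInverse_invFun h.injective x

theorem continuous_inv (h : IsExpandingLift k F ω s n) : Continuous (Function.invFun F) := by
  refine LipschitzWith.continuous (K := ω⁻¹.toNNReal) <|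
    LipschitzWith.of_dist_le_mul fun y y' => ?_
  have hle := h.mul_abs_sub_le (Function.invFun F y) (Function.invFun F y')
  rw [h.right_inv, h.right_inv] at hle
  rwa [Real.dist_eq, Real.dist_eq, Real.coe_toNNReal _ (inv_nonneg.2 h.pos.le),
    le_inv_mul_iff₀ h.pos]

theorem hasDerivAt_inv (h : IsExpandingLift k F ω s n) (x : ℝ) :
    HasDerivAt (Function.invFun F) (1 / deriv F (Function.invFun F x)) x := by
  rw [one_div]
  exact HasDerivAt.of_local_left_inverse h.continuous_inv.continuousAt
    (h.differentiable _).hasDerivAt (h.deriv_ne_zero _) (.of_forall h.right_inv)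

theorem inv_add (h : IsExpandingLift k F ω s n) (x : ℝ) :
    Function.invFun F (x + s * n) = Function.invFun F x + 1 :=
  h.injective (by rw [h.right_inv, h.add_one, h.right_inv])

theorem periodic_deriv (h : IsExpandingLift k F ω s n) : Function.Periodic (deriv F) 1 :=
  fun x => by
    rw [← deriv_comp_add_const F 1 x]
    simp only [h.add_one, deriv_add_const]

theorem contDiff_weight (h : IsExpandingLift k F ω s n) : ContDiff ℝ k fun x => 1 / deriv F x :=
  contDiff_const.div h.contDiff_deriv h.deriv_ne_zero

theorem periodic_comp_inv (h : IsExpandingLift k F ω s n) {X : Type*} {w : ℝ → X}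
    (hw : Function.Periodic w 1) : Function.Periodic (fun x => w (Function.invFun F x)) n := by
  have hsign : Function.Periodic (fun x => w (Function.invFun F x)) (s * n) := fun x => by
    simp only [h.inv_add, hw _]
  rcases h.sign with rfl | rfl
  · simpa using hsign
  · simpa using hsign.neg

theorem branchSum_eq (h : IsExpandingLift k F ω s n) (φ : ℝ → ℝ) : branchSum F n φ = fun x =>
    ∑ m ∈ Finset.range n, s * (1 / deriv F (Function.invFun F (x + m)) *
      φ (Function.invFun F (x + m))) := by
  ext x
  refine Finset.sum_congr rfl fun m _ => ?_
  have hderiv := h.deriv_ne_zero (Function.invFun F (x + m))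
  rcases h.sign with hs | hs <;> rw [h.abs_deriv, hs] <;> field_simp

theorem integral_comp_inv (h : IsExpandingLift k F ω s n) (hφ : Continuous φ)
    (hp : Function.Periodic φ 1) :
    ∫ x in (0 : ℝ)..n, s * (1 / deriv F (Function.invFun F x) * φ (Function.invFun F x)) =
      ∫ x in (0 : ℝ)..1, φ x := by
  have hsubst := intervalIntegral.integral_comp_mul_deriv (a := 0) (b := n)
    (fun x _ => h.hasDerivAt_inv x)
    ((h.contDiff_weight.continuous.comp h.continuous_inv).continuousOn) hφ
  simp only [Function.comp_apply, mul_comm (φ _)] at hsubst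
  have hperiod (b : ℝ) : ∫ x in b..b + 1, φ x = ∫ x in (0 : ℝ)..1, φ x := by
    simpa using hp.intervalIntegral_add_eq b 0
  rw [intervalIntegral.integral_const_mul, hsubst]
  rcases h.sign with hs | hs
  · have hinv := h.inv_add 0
    rw [hs, one_mul, zero_add] at hinv
    rw [hs, one_mul, hinv, hperiod]
  · have hinv := h.inv_add n
    rw [hs, neg_one_mul, add_neg_cancel] at hinv
    rw [hs, neg_one_mul, ← intervalIntegral.integral_symm, hinv, hperiod]

theorem periodic_branchSum (h : IsExpandingLift k F ω s n) (hφ : Function.Periodic φ 1) :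
    Function.Periodic (branchSum F n φ) 1 :=
  periodic_sum_range_add <| h.periodic_comp_inv (w := fun x => φ x / |deriv F x|) fun x => by
    simp only [hφ x, h.periodic_deriv x]

theorem continuous_branchSum (h : IsExpandingLift k F ω s n) (hφ : Continuous φ) :
    Continuous (branchSum F n φ) := by
  have hinv := h.continuous_inv
  have hderiv := h.contDiff_deriv.continuous
  exact continuous_finsetSum _ fun m _ => (hφ.comp (hinv.comp (continuous_add_const _))).div
    (hderiv.comp (hinv.comp (continuous_add_const _))).abs
    fun x => abs_ne_zero.2 (h.deriv_ne_zero _)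

theorem hasDerivAt_branchSum (h : IsExpandingLift (k + 1) F ω s n) (hφ : Differentiable ℝ φ)
    (x : ℝ) :
    HasDerivAt (branchSum F n φ) (branchSum F n (deriv fun y => 1 / deriv F y * φ y) x) x := by
  rw [h.branchSum_eq, h.branchSum_eq]
  refine HasDerivAt.fun_sum fun m _ => HasDerivAt.const_mul s ?_
  have hdiff : Differentiable ℝ fun y => 1 / deriv F y * φ y :=
    (h.contDiff_weight.differentiable (by simp)).mul hφ
  have hcomp := (hdiff (Function.invFun F (x + m))).hasDerivAt.comp x
    ((h.hasDerivAt_inv (x + m)).comp_add_const x m)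
  rwa [mul_comm] at hcomp

theorem integral_branchSum (h : IsExpandingLift k F ω s n) (hφ : Continuous φ)
    (hp : Function.Periodic φ 1) :
    ∫ x in (0 : ℝ)..1, branchSum F n φ x = ∫ x in (0 : ℝ)..1, φ x := by
  rw [h.branchSum_eq, ← h.integral_comp_inv hφ hp]
  exact integral_sum_range_add (continuous_const.mul
    ((h.contDiff_weight.continuous.comp h.continuous_inv).mul (hφ.comp h.continuous_inv))) n

theorem isTransfer (h : IsExpandingLift (k + 1) F ω s n) :
    IsTransfer (fun x => 1 / deriv F x) (branchSum F n) where
  add φ ψ := by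
    ext x
    simp only [branchSum, add_div, Finset.sum_add_distrib]
  const_mul c φ := by
    ext x
    simp only [branchSum, mul_div_assoc, Finset.mul_sum]
  map_nonneg φ hφ x := Finset.sum_nonneg fun m _ => div_nonneg (hφ _) (abs_nonneg _)
  periodic φ hφ := h.periodic_branchSum hφ
  continuous φ hφ := h.continuous_branchSum hφ
  hasDerivAt φ hφ := h.hasDerivAt_branchSum (hφ.differentiable one_ne_zero)
  integral φ hφ hp := h.integral_branchSum hφ hp

theorem card_pos (h : IsExpandingLift k F ω s n) : 0 < n := Nat.pos_of_ne_zero fun hn => by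
  have hle := h.mul_sub_le (zero_le_one' ℝ)
  have hone := h.add_one 0
  rw [zero_add, hn, Nat.cast_zero, mul_zero, add_zero] at hone
  rw [hone] at hle
  linarith [h.pos]

theorem branchSum_pos (h : IsExpandingLift k F ω s n) (hφ : ∀ x, 0 ≤ φ x) {x : ℝ}
    (hx : 0 < φ x) : 0 < branchSum F n φ (F x) := by
  refine Finset.sum_pos' (fun m _ => div_nonneg (hφ _) (abs_nonneg _))
    ⟨0, Finset.mem_range.2 h.card_pos, ?_⟩
  rw [Nat.cast_zero, add_zero, h.left_inv]
  exact div_pos hx (abs_pos.2 (h.deriv_ne_zero x))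

theorem abs_weight_le (h : IsExpandingLift k F ω s n) (x : ℝ) : |1 / deriv F x| ≤ ω⁻¹ := by
  rw [one_div, abs_inv]
  exact inv_anti₀ h.pos (h.le_abs_deriv x)

theorem abs_deriv_weight (h : IsExpandingLift (k + 1) F ω s n) (x : ℝ) :
    |deriv (fun x => 1 / deriv F x) x| = |deriv (deriv F) x| / deriv F x ^ 2 := by
  simp only [one_div]
  rw [deriv_fun_inv'' (h.contDiff_deriv.differentiable (by simp) x) (h.deriv_ne_zero x), abs_div,
    abs_neg, abs_pow, sq_abs]

theorem exists_ckBound_weight (h : IsExpandingLift k F ω s n) :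
    ∃ A, CkBound k (fun x => 1 / deriv F x) A :=
  exists_ckBound h.contDiff_weight fun x => by simp only [h.periodic_deriv x]

end IsExpandingLift

/-! ### Expanding maps of the circle -/

theorem coe_eq_coe_iff {x y : ℝ} : (x : S1) = (y : S1) ↔ ∃ j : ℤ, x = y + j := by
  rw [← sub_eq_zero, ← AddCircle.coe_sub, AddCircle.coe_eq_zero_iff]
  simp only [zsmul_eq_mul, mul_one]
  exact exists_congr fun j => ⟨fun h => by linarith, fun h => by linarith⟩

theorem exists_degree {f : S1 → S1} {F : ℝ → ℝ} (hF : Continuous F)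
    (hfF : ∀ x : ℝ, f (x : S1) = (F x : S1)) : ∃ d : ℤ, ∀ x, F (x + 1) = F x + d := by
  have hshift (x : ℝ) : ∃ m : ℤ, F (x + 1) = F x + m :=
    coe_eq_coe_iff.1 (by rw [← hfF, ← hfF, AddCircle.coe_add_period])
  choose m hm using hshift
  have hcont : Continuous m := by
    rw [Int.isClosedEmbedding_coe_real.isInducing.continuous_iff]
    have heq : (Int.cast ∘ m : ℝ → ℝ) = fun x => F (x + 1) - F x := by
      ext x
      simp only [Function.comp_apply, hm x, add_sub_cancel_left]
    rw [heq]
    fun_prop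
  exact ⟨m 0, fun x => by
    rw [hm x, PreconnectedSpace.constant inferInstance hcont (x := x) (y := 0)]⟩

theorem exists_lt_forall_le_of_periodic {φ : ℝ → ℝ} {b : ℝ} (hφ : Continuous φ)
    (hp : Function.Periodic φ 1) (hb : ∀ x, φ x < b) : ∃ c < b, ∀ x, φ x ≤ c := by
  obtain ⟨x₀, -, hx₀⟩ := (isCompact_Icc (a := (0 : ℝ)) (b := 1)).exists_isMaxOn ⟨0, by simp⟩
    hφ.continuousOn
  refine ⟨φ x₀, hb x₀, fun x => ?_⟩
  obtain ⟨y, hy, hxy⟩ := hp.exists_mem_Ico₀ one_pos x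
  rw [hxy]
  exact hx₀ (Ico_subset_Icc_self hy)

theorem exists_sign_mul_eq_abs {φ : ℝ → ℝ} (hφ : Continuous φ) (h : ∀ x, φ x ≠ 0) :
    ∃ s : ℝ, (s = 1 ∨ s = -1) ∧ ∀ x, s * φ x = |φ x| := by
  rcases isPreconnected_univ.eq_or_eq_neg_of_sq_eq hφ.abs.continuousOn hφ.continuousOn
    (fun x _ => sq_abs (φ x)) (fun {x} _ => h x) with heq | heq
  · exact ⟨1, .inl rfl, fun x => (one_mul _).trans (heq (mem_univ x)).symm⟩
  · exact ⟨-1, .inr rfl, fun x => (neg_one_mul _).trans (heq (mem_univ x)).symm⟩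

theorem exists_natCast_mul_eq {F : ℝ → ℝ} {s : ℝ} {d : ℤ} (hF : Differentiable ℝ F)
    (hs : s = 1 ∨ s = -1) (hpos : ∀ x, 0 < s * deriv F x) (hd : ∀ x, F (x + 1) = F x + d) :
    ∃ n : ℕ, s * n = d := by
  have hsd : 0 < s * d := by
    obtain ⟨c, -, hc⟩ := exists_deriv_eq_slope F (zero_lt_one' ℝ) hF.continuous.continuousOn
      hF.differentiableOn
    have hone := hd 0
    rw [zero_add] at hone
    rw [hone, sub_zero, div_one, add_sub_cancel_left] at hc
    exact hc ▸ hpos c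
  refine ⟨d.natAbs, ?_⟩
  rw [Nat.cast_natAbs, Int.cast_abs]
  rcases hs with rfl | rfl
  · rw [one_mul, abs_of_pos (by linarith)]
  · rw [neg_one_mul, abs_of_neg (by linarith), neg_neg]

theorem exists_isExpandingLift {k : ℕ} {f : S1 → S1} (hf : MapContDiff (k + 1) f)
    (hexp : ∀ x, 1 < |mapDeriv f x|) : ∃ F ω s n, IsExpandingLift k F ω s n ∧
      ∀ x : ℝ, f (x : S1) = (F x : S1) := by
  obtain ⟨F, hF, hfF⟩ := hf
  have hdiff : Differentiable ℝ F := hF.differentiable (by simp)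
  have hcont : Continuous (deriv F) := hF.continuous_deriv (by simp)
  have habs (x : ℝ) : 1 < |deriv F x| := mapDeriv_coe hfF (hdiff x) ▸ hexp x
  obtain ⟨d, hd⟩ := exists_degree hF.continuous hfF
  obtain ⟨s, hs, hsign⟩ :=
    exists_sign_mul_eq_abs hcont fun x => abs_pos.1 (zero_lt_one.trans (habs x))
  obtain ⟨n, hn⟩ := exists_natCast_mul_eq hdiff hs
    (fun x => hsign x ▸ zero_lt_one.trans (habs x)) hd
  have hperiodic : Function.Periodic (deriv F) 1 := fun x => by
    rw [← deriv_comp_add_const F 1 x]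
    simp only [hd, deriv_add_const]
  obtain ⟨c, hc, hle⟩ := exists_lt_forall_le_of_periodic (φ := fun x => -|deriv F x|) (b := -1)
    hcont.abs.neg (fun x => by simp only [hperiodic x]) fun x => neg_lt_neg (habs x)
  exact ⟨F, -c, s, n, ⟨hF, hs, by linarith, fun x => hsign x ▸ neg_le.1 (hle x),
    fun x => hn ▸ hd x⟩, hfF⟩

namespace IsExpandingLift

variable {k n : ℕ} {F : ℝ → ℝ} {ω s : ℝ} {f : S1 → S1}

theorem coe_inv_add_mul (h : IsExpandingLift k F ω s n) (x : ℝ) (j : ℤ) :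
    ((Function.invFun F (x + j * n) : ℝ) : S1) = ((Function.invFun F x : ℝ) : S1) :=
  (h.periodic_comp_inv (w := fun x : ℝ => (x : S1))
    fun x => AddCircle.coe_add_period 1 x).int_mul j x

theorem add_intCast (h : IsExpandingLift k F ω s n) (x : ℝ) (j : ℤ) :
    F (x + j) = F x + s * (j * n) := by
  have hp : Function.Periodic (fun x => F x - x * (s * n)) 1 := fun x => by
    simp only [h.add_one]
    ring
  have hint := hp.int_mul j x
  simp only [mul_one] at hint
  linear_combination hint

theorem injective_branch (h : IsExpandingLift k F ω s n) (x : ℝ) :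
    Function.Injective fun m : Fin n => ((Function.invFun F (x + (m : ℕ)) : ℝ) : S1) := by
  intro m m' hm
  obtain ⟨j, hj⟩ := coe_eq_coe_iff.1 hm
  have hF := congrArg F hj
  rw [h.right_inv, h.add_intCast, h.right_inv] at hF
  have hdvd : (n : ℤ) ∣ (m : ℤ) - (m' : ℤ) := by
    rcases h.sign with rfl | rfl
    · refine ⟨j, ?_⟩
      have hsub : ((m : ℕ) : ℝ) - (m' : ℕ) = n * j := by linear_combination hF
      exact_mod_cast hsub
    · refine ⟨-j, ?_⟩
      have hsub : ((m : ℕ) : ℝ) - (m' : ℕ) = n * -j := by linear_combination hF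
      exact_mod_cast hsub
  have hzero := Int.eq_zero_of_abs_lt_dvd hdvd (abs_lt.2 ⟨by omega, by omega⟩)
  exact Fin.ext (by lia)

theorem range_branch (h : IsExpandingLift k F ω s n)
    (hfF : ∀ x : ℝ, f (x : S1) = (F x : S1)) (x : ℝ) :
    range (fun m : Fin n => ((Function.invFun F (x + (m : ℕ)) : ℝ) : S1)) = f ⁻¹' {(x : S1)} := by
  ext y
  induction y using QuotientAddGroup.induction_on with | H y => ?_
  constructor
  · rintro ⟨m, hm⟩
    rw [← hm, mem_preimage, hfF, h.right_inv]
    exact coe_eq_coe_iff.2 ⟨m, rfl⟩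
  · intro hy
    obtain ⟨j, hj⟩ := coe_eq_coe_iff.1 ((hfF y).symm.trans hy)
    have hn : (0 : ℤ) < n := by exact_mod_cast h.card_pos
    obtain ⟨m, hm⟩ := Int.eq_ofNat_of_zero_le (Int.emod_nonneg j hn.ne')
    refine ⟨⟨m, by have := Int.emod_lt_of_pos j hn; lia⟩, ?_⟩
    have hdiv : x + m + (j / n : ℤ) * n = F y := by
      have hcast : ((m : ℤ) : ℝ) + (j / n : ℤ) * n = j := by
        exact_mod_cast hm ▸ Int.emod_add_ediv_mul j n
      rw [hj, ← hcast, Int.cast_natCast, add_assoc]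
    have hcoe := h.coe_inv_add_mul (x + m) (j / n)
    rw [hdiv, h.left_inv] at hcoe
    exact hcoe.symm

theorem coveringNumber_eq (h : IsExpandingLift k F ω s n)
    (hfF : ∀ x : ℝ, f (x : S1) = (F x : S1)) : coveringNumber f = n := by
  have hrange := h.range_branch hfF 0
  rw [AddCircle.coe_zero] at hrange
  rw [coveringNumber, ← hrange, ← Nat.card_coe_set_eq,
    Nat.card_range_of_injective (h.injective_branch 0), Nat.card_fin]

theorem transfer_coe (h : IsExpandingLift k F ω s n)
    (hfF : ∀ x : ℝ, f (x : S1) = (F x : S1)) (φ : S1 → ℝ) (x : ℝ) :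
    transfer f φ (x : S1) = branchSum F n (fun y => φ (y : S1)) x := by
  rw [transfer,
    finsum_set_coe_eq_finsum_mem (f ⁻¹' {(x : S1)}) (f := fun y => φ y / |mapDeriv f y|),
    ← h.range_branch hfF, finsum_mem_range (h.injective_branch x), finsum_eq_sum_of_fintype,
    branchSum, ← Fin.sum_univ_eq_sum_range fun m : ℕ => φ ((Function.invFun F (x + m) : ℝ) : S1) /
      |deriv F (Function.invFun F (x + m))|]
  simp only [mapDeriv_coe hfF (h.differentiable _)]

theorem mapDeriv_eq (h : IsExpandingLift k F ω s n) (hfF : ∀ x : ℝ, f (x : S1) = (F x : S1))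
    (x : ℝ) : mapDeriv f (x : S1) = deriv F x :=
  mapDeriv_coe hfF (h.differentiable x)

theorem funDeriv_mapDeriv_eq (h : IsExpandingLift k F ω s n)
    (hfF : ∀ x : ℝ, f (x : S1) = (F x : S1)) (x : ℝ) :
    funDeriv (mapDeriv f) (x : S1) = deriv (deriv F) x := by
  rw [funDeriv_coe, funext fun y => h.mapDeriv_eq hfF y]

theorem transfer_le (h : IsExpandingLift k F ω s n)
    (hfF : ∀ x : ℝ, f (x : S1) = (F x : S1)) {φ : S1 → ℝ} {B : ℝ}
    (hB : ∀ y, φ y / |mapDeriv f y| ≤ B) (x : S1) : transfer f φ x ≤ coveringNumber f * B := by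
  induction x using QuotientAddGroup.induction_on with | H x => ?_
  refine (h.transfer_coe hfF φ x).trans_le ?_
  refine (Finset.sum_le_card_nsmul (Finset.range n) _ B fun m _ => ?_).trans_eq
    (by rw [Finset.card_range, nsmul_eq_mul, h.coveringNumber_eq hfF])
  rw [← h.mapDeriv_eq hfF]
  exact hB _

end IsExpandingLift

/-! ### The mean field system of a coupled map -/

theorem IsExpandingLift.exists_isContracting {k n : ℕ} {F : ℝ → ℝ} {ω s : ℝ} {f : S1 → S1}
    (h : IsExpandingLift (k + 1) F ω s n) (hfF : ∀ x : ℝ, f (x : S1) = (F x : S1))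
    (hdist : ∀ x, transfer f
      (fun y => 1 / |mapDeriv f y| + |funDeriv (mapDeriv f) y| / mapDeriv f y ^ 2) x < 1) :
    ∃ A θ, θ < 1 ∧ IsContracting (k + 1) A θ (fun x => 1 / deriv F x) (branchSum F n) := by
  obtain ⟨A₁, hA₁⟩ := h.exists_ckBound_weight
  obtain ⟨A₂, hA₂⟩ := exists_forall_abs_le_of_periodic
    (h.continuous_branchSum (φ := fun _ => 1) continuous_const) one_ne_zero
    (h.periodic_branchSum fun _ => rfl)
  have hcont : Continuous fun y => |1 / deriv F y| + |deriv (fun x => 1 / deriv F x) y| :=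
    hA₁.continuous.abs.add hA₁.deriv.continuous.abs
  have hperiodic : Function.Periodic
      (fun y => |1 / deriv F y| + |deriv (fun x => 1 / deriv F x) y|) 1 := fun y => by
    simp only [SelfConsistent.periodic_deriv hA₁.periodic y, h.periodic_deriv y]
  have hlt (x : ℝ) : branchSum F n
      (fun y => |1 / deriv F y| + |deriv (fun x => 1 / deriv F x) y|) x < 1 := by
    simpa only [h.transfer_coe hfF, h.mapDeriv_eq hfF, h.funDeriv_mapDeriv_eq hfF,
      ← h.abs_deriv_weight, ← abs_one_div] using hdist (x : S1)
  obtain ⟨θ, hθ, hle⟩ := exists_lt_forall_le_of_periodic (h.continuous_branchSum hcont)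
    (h.periodic_branchSum hperiodic) hlt
  exact ⟨max A₁ A₂, θ, hθ,
    ⟨⟨h.isTransfer, fun x => (le_abs_self _).trans ((hA₂ x).trans (le_max_right _ _)),
      hA₁.mono (le_max_left _ _)⟩,
    fun x => (h.abs_weight_le x).trans (inv_le_one_of_one_le₀ h.one_lt.le), hle⟩⟩

theorem IsExpandingLift.mul_abs_sub_le_comp {k m n : ℕ} {F u : ℝ → ℝ} {ω s η : ℝ}
    (h : IsExpandingLift k F ω s n) (hu : CkBound (m + 1) u η) (x y : ℝ) :
    (1 - η) * ω * |x - y| ≤ |F (x + u x) - F (y + u y)| := by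
  have hsub := abs_sub_abs_le_abs_sub (x - y) (u y - u x)
  rw [show x - y - (u y - u x) = x + u x - (y + u y) by ring] at hsub
  calc (1 - η) * ω * |x - y| = ω * (|x - y| - η * |x - y|) := by ring
    _ ≤ ω * |x + u x - (y + u y)| := mul_le_mul_of_nonneg_left
      (by linarith [abs_sub_comm x y ▸ hu.abs_sub_le y x]) h.pos.le
    _ ≤ |F (x + u x) - F (y + u y)| := h.mul_abs_sub_le _ _

theorem isPeriodicKernel_lift {n : ℕ} {h : S1 → S1 → ℝ} (hh : TorusContDiff n h) :
    IsPeriodicKernel n fun x y : ℝ => h (x : S1) (y : S1) :=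
  ⟨hh, fun y => periodic_lift fun x => h x (y : S1), fun x => periodic_lift (h (x : S1))⟩

/-- `S` is the mean field system on lifts of the map `f` and the coupling `h`. -/
structure MeanFieldSystem.Models {k : ℕ} (S : MeanFieldSystem k) (f : S1 → S1)
    (h : S1 → S1 → ℝ) : Prop where
  transfer_coe : ∀ (φ : S1 → ℝ) (x : ℝ), transfer f φ (x : S1) = S.P (fun y => φ (y : S1)) x
  meanField_coe : ∀ (ψ : S1 → ℝ) (x : ℝ),
    meanField h ψ (x : S1) = S.field (fun y => ψ (y : S1)) x

theorem exists_models {k : ℕ} {f : S1 → S1} {h : S1 → S1 → ℝ}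
    (hf : MapContDiff ((k + 3 : ℕ) + 1) f) (hh : TorusContDiff (k + 4 : ℕ) h)
    (hexp : ∀ x, 1 < |mapDeriv f x|)
    (hdist : ∀ x, transfer f
      (fun y => 1 / |mapDeriv f y| + |funDeriv (mapDeriv f) y| / mapDeriv f y ^ 2) x < 1) :
    ∃ S : MeanFieldSystem k, S.Models f h := by
  obtain ⟨F, ω, s, n, hF, hfF⟩ := exists_isExpandingLift hf hexp
  obtain ⟨A, θ, hθ, hP⟩ := hF.exists_isContracting hfF hdist
  obtain ⟨η, A', θ', hη, hhalf, hωη, hθ', hcomp⟩ :=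
    exists_isContracting_comp (k + 2) hP.weight.nonneg (inv_lt_one_of_one_lt₀ hF.one_lt) hθ
  have hker := isPeriodicKernel_lift hh
  obtain ⟨H, -, hfield⟩ := hker.exists_ckBound_kernelMean
  exact ⟨{
    P := branchSum F n
    field := kernelMean fun x y => h (x : S1) (y : S1)
    a := fun x => 1 / deriv F x
    F := F
    A := max A A'
    θ := θ'
    η := η
    ω := (1 - η) * ω
    H := H
    lt_one := hθ'
    η_pos := hη
    le_half := hhalf
    one_lt := (inv_lt_iff_one_lt_mul₀ hF.pos).1 hωη
    continuous_map := hF.contDiff.continuous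
    isBoundedTransfer := ⟨hP.toIsTransfer, fun x => (hP.map_one_le x).trans (le_max_left _ _),
      hP.weight.mono (le_max_left _ _)⟩
    isContracting u hu :=
      have hc := hcomp _ _ hP hF.abs_weight_le u hu
      ⟨⟨hc.toIsTransfer, fun x => (hc.map_one_le x).trans (le_max_right _ _),
        hc.weight.mono (le_max_right _ _)⟩, hc.abs_weight_le_one, hc.distortion⟩
    expanding u hu := hF.mul_abs_sub_le_comp hu
    map_pos φ hφ x hx := hF.branchSum_pos hφ hx
    field_add ψ χ hψ hχ := hker.kernelMean_add hψ hχ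
    field_const_mul := kernelMean_const_mul _
    ckBound_field ψ B hψ _ hB := hfield ψ B hψ hB },
    hF.transfer_coe hfF, fun ψ x => integral_eq_integral_lift _⟩

namespace MeanFieldSystem.Models

variable {k : ℕ} {S : MeanFieldSystem k} {f : S1 → S1} {h : S1 → S1 → ℝ} {t : ℝ} {ψ : S1 → ℝ}

theorem couplingMap_coe (hS : S.Models f h) (t : ℝ) (ψ : S1 → ℝ) (x : ℝ) :
    couplingMap h t ψ (x : S1) = ((x + S.coupling t (fun y => ψ (y : S1)) x : ℝ) : S1) := by
  rw [couplingMap, hS.meanField_coe, ← AddCircle.coe_add, coupling]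

theorem couplingDeriv_coe (hS : S.Models f h) (t : ℝ) (ψ : S1 → ℝ) (x : ℝ) :
    couplingDeriv h t ψ (x : S1) = 1 + deriv (S.coupling t fun y => ψ (y : S1)) x := by
  rw [couplingDeriv, funDeriv_coe, funext (hS.meanField_coe ψ)]
  unfold coupling
  rw [deriv_const_mul_field]

theorem injective_couplingMap (hS : S.Models f h)
    (hu : CkBound (k + 4) (S.coupling t fun y => ψ (y : S1)) S.η) :
    Function.Injective (couplingMap h t ψ) := by
  have hpert := hu.isPerturbation_two S.le_half
  intro p q hpq
  induction p using QuotientAddGroup.induction_on with | H x => ?_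
  induction q using QuotientAddGroup.induction_on with | H y => ?_
  obtain ⟨j, hj⟩ := coe_eq_coe_iff.1
    ((hS.couplingMap_coe t ψ x).symm.trans (hpq.trans (hS.couplingMap_coe t ψ y)))
  have hperiodic := hu.periodic.int_mul j y
  rw [mul_one] at hperiodic
  refine coe_eq_coe_iff.2 ⟨j, hpert.strictMono.injective ?_⟩
  simp only [hperiodic]
  linarith

theorem couplingInv_coe (hS : S.Models f h)
    (hu : CkBound (k + 4) (S.coupling t fun y => ψ (y : S1)) S.η) (x : ℝ) :
    couplingInv h t ψ (x : S1) =
      ((perturbInv (S.coupling t fun y => ψ (y : S1)) x : ℝ) : S1) := by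
  have hcoe := hS.couplingMap_coe t ψ (perturbInv (S.coupling t fun y => ψ (y : S1)) x)
  rw [(hu.isPerturbation_two S.le_half).perturbInv_add] at hcoe
  rw [← hcoe]
  exact Function.leftInverse_invFun (hS.injective_couplingMap hu) _

theorem couplingTransfer_coe (hS : S.Models f h)
    (hu : CkBound (k + 4) (S.coupling t fun y => ψ (y : S1)) S.η) (φ : S1 → ℝ) (x : ℝ) :
    couplingTransfer h t ψ φ (x : S1) =
      perturbTransfer (S.coupling t fun y => ψ (y : S1)) (fun y => φ (y : S1)) x := by
  rw [couplingTransfer, hS.couplingInv_coe hu, hS.couplingDeriv_coe, perturbTransfer, perturbWeight,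
    one_div_mul_eq_div]

theorem coupledTransfer_coe (hS : S.Models f h)
    (hu : CkBound (k + 4) (S.coupling t fun y => ψ (y : S1)) S.η) (φ : S1 → ℝ) (x : ℝ) :
    coupledTransfer f h t ψ φ (x : S1) =
      S.perturbed (S.coupling t fun y => ψ (y : S1)) (fun y => φ (y : S1)) x := by
  rw [coupledTransfer, hS.transfer_coe, funext (hS.couplingTransfer_coe hu φ), perturbed]

theorem transfer_theta_coe (hS : S.Models f h)
    (hu : CkBound (k + 4) (S.coupling t fun y => ψ (y : S1)) S.η) (g : S1 → ℝ) (x : ℝ) :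
    transfer f (SelfConsistent.theta h t ψ g) (x : S1) =
      S.P (S.theta (S.coupling t fun y => ψ (y : S1)) (fun y => ψ (y : S1))
        fun y => g (y : S1)) x := by
  have htransfer (x : ℝ) := hS.couplingTransfer_coe hu (fun y => ψ y * meanField h g y) x
  simp only [couplingTransfer, hS.meanField_coe] at htransfer
  rw [hS.transfer_coe]
  congr 1
  ext y
  rw [SelfConsistent.theta, funDeriv_coe, MeanFieldSystem.theta, ← funext htransfer]
  simp only [hS.couplingInv_coe hu, hS.meanField_coe, div_mul_eq_mul_div]

theorem isDiffeo (hS : S.Models f h)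
    (hu : CkBound (k + 4) (S.coupling t fun y => ψ (y : S1)) S.η) :
    IsDiffeo ((k + 3 : ℕ) + 1) (couplingMap h t ψ) := by
  have hpert := hu.isPerturbation_two S.le_half
  have hc : ContDiff ℝ ((k + 3 : ℕ) + 1) (S.coupling t fun y => ψ (y : S1)) := hu.contDiff
  refine ⟨couplingInv h t ψ, Function.leftInverse_invFun (hS.injective_couplingMap hu),
    fun p => ?_, ⟨_, contDiff_id.add hc, hS.couplingMap_coe t ψ⟩,
    ⟨_, hpert.contDiff_perturbInv hc, hS.couplingInv_coe hu⟩⟩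
  induction p using QuotientAddGroup.induction_on with | H x => ?_
  refine (congrArg _ (hS.couplingInv_coe hu x)).trans ((hS.couplingMap_coe t ψ _).trans ?_)
  rw [hpert.perturbInv_add]

theorem couplingDeriv_pos (hS : S.Models f h)
    (hu : CkBound (k + 4) (S.coupling t fun y => ψ (y : S1)) S.η) (x : S1) :
    0 < couplingDeriv h t ψ x := by
  induction x using QuotientAddGroup.induction_on with | H x => ?_
  exact ((hu.isPerturbation_two S.le_half).pos x).trans_eq (hS.couplingDeriv_coe t ψ x).symm

end MeanFieldSystem.Models

theorem isDensity_lift {ψ : S1 → ℝ} (hc : Continuous ψ) (hψ : ∀ x, 0 ≤ ψ x)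
    (hint : ∫ x, ψ x = 1) : IsDensity fun x : ℝ => ψ (x : S1) :=
  ⟨hc.comp (AddCircle.continuous_mk' 1), periodic_lift ψ, fun x => hψ x,
    (integral_eq_integral_lift ψ).symm.trans hint⟩

theorem exists_coe_abs_sub_eq_dist (p q : S1) :
    ∃ x y : ℝ, (x : S1) = p ∧ (y : S1) = q ∧ |x - y| = dist p q := by
  induction p using QuotientAddGroup.induction_on with | H x => ?_
  induction q using QuotientAddGroup.induction_on with | H y => ?_
  refine ⟨x - round (x - y), y, coe_eq_coe_iff.2 ⟨-round (x - y), by push_cast; ring⟩, rfl, ?_⟩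
  rw [show dist _ _ = ‖((x - y : ℝ) : S1)‖ from dist_eq_norm (x : S1) (y : S1),
    UnitAddCircle.norm_eq, sub_right_comm]

theorem C1.lipschitzWith_fn (g : C1) : LipschitzWith ‖g‖₊ (C1.fn g) :=
  LipschitzWith.of_dist_le_mul fun p q => by
    obtain ⟨x, y, rfl, rfl, hdist⟩ := exists_coe_abs_sub_eq_dist p q
    rw [← hdist]
    exact (C1.ckBound_lift g).abs_sub_le x y

namespace MeanFieldSystem.IsTimeRange

variable {k : ℕ} {S : MeanFieldSystem k} {f : S1 → S1} {h : S1 → S1 → ℝ} {ε C t : ℝ} {g : C1}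

theorem isFixedDensity (hT : S.IsTimeRange ε C) (hS : S.Models f h) (ht : |t| ≤ ε)
    (hg : S.IsSelfConsistent t (C1.lift g)) : IsFixedDensity f h t (C1.fn g) := by
  refine ⟨⟨_, C1.lipschitzWith_fn g⟩, fun p => ?_,
    (integral_eq_integral_lift _).trans hg.isDensity.integral, funext fun p => ?_⟩ <;>
  induction p using QuotientAddGroup.induction_on with | H x => ?_
  · exact hT.density_pos ht hg x
  · exact (hS.coupledTransfer_coe (hT.ckBound_coupling ht hg.isDensity) _ x).trans
      (congrFun hg.eq x)

theorem eq_fn (hT : S.IsTimeRange ε C) (hS : S.Models f h) (ht : |t| ≤ ε)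
    (hg : S.IsSelfConsistent t (C1.lift g)) {φ : S1 → ℝ} (hc : Continuous φ)
    (hφ : ∀ x, 0 ≤ φ x) (hint : ∫ x, φ x = 1) (hfix : selfConsistentTransfer f h t φ = φ) :
    φ = C1.fn g := by
  have hd := isDensity_lift hc hφ hint
  have heq := hT.isSelfConsistent_unique ht hg ⟨hd, funext fun x =>
    (hS.coupledTransfer_coe (hT.ckBound_coupling ht hd) φ x).symm.trans (congrFun hfix x)⟩
  ext p
  induction p using QuotientAddGroup.induction_on with | H x => ?_
  exact congrFun heq x

theorem resolvent_apply_coe (hT : S.IsTimeRange ε C) (hS : S.Models f h) (ht : |t| ≤ ε)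
    (hg : S.IsSelfConsistent t (C1.lift g)) (φ : c1ZeroMean) (x : S1) :
    C1.fn (hT.resolvent ht hg φ) x = C1.fn φ x - coupledTransfer f h t (C1.fn g) (C1.fn φ) x
      + t * transfer f (SelfConsistent.theta h t (C1.fn g) (C1.fn φ)) x := by
  have hu := hT.ckBound_coupling ht hg.isDensity
  induction x using QuotientAddGroup.induction_on with | H x => ?_
  rw [hT.resolvent_apply]
  refine Eq.trans ?_ (congrArg₂ (fun a b => C1.lift φ x - a + t * b)
    (hS.coupledTransfer_coe hu (C1.fn φ) x) (hS.transfer_theta_coe hu (C1.fn φ) x)).symm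
  exact (sub_sub_eq_add_sub _ _ _).trans (add_sub_right_comm _ _ _)

theorem response_coe (hT : S.IsTimeRange ε C) (hS : S.Models f h) (ht : |t| ≤ ε)
    (hg : S.IsSelfConsistent t (C1.lift g)) (x : S1) :
    C1.fn (hT.response ht hg) x =
      transfer f (SelfConsistent.theta h t (C1.fn g) (C1.fn g)) x := by
  induction x using QuotientAddGroup.induction_on with | H x => ?_
  exact (hS.transfer_theta_coe (hT.ckBound_coupling ht hg.isDensity) (C1.fn g) x).symm

end MeanFieldSystem.IsTimeRange

/-! ### The uncoupled system -/

section Zero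

variable (f : S1 → S1) (h : S1 → S1 → ℝ) (ψ : S1 → ℝ)

theorem couplingMap_zero : couplingMap h 0 ψ = id := by
  ext x
  simp [couplingMap]

theorem couplingInv_zero (x : S1) : couplingInv h 0 ψ x = x := by
  rw [couplingInv, couplingMap_zero]
  exact Function.leftInverse_invFun Function.injective_id x

theorem couplingDeriv_zero (x : S1) : couplingDeriv h 0 ψ x = 1 := by
  simp [couplingDeriv]

theorem coupledTransfer_zero (φ : S1 → ℝ) : coupledTransfer f h 0 ψ φ = transfer f φ := by
  unfold coupledTransfer
  congr 1
  ext x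
  simp only [couplingTransfer, couplingInv_zero, couplingDeriv_zero, div_one]

theorem theta_zero (g : S1 → ℝ) :
    theta h 0 ψ g = funDeriv fun y => ψ y * meanField h g y := by
  simp only [theta, couplingInv_zero, couplingDeriv_zero, div_one]

end Zero

/-! ### Linear response -/

theorem MeanFieldSystem.IsTimeRange.exists_response {k : ℕ} {S : MeanFieldSystem k} {f : S1 → S1}
    {h : S1 → S1 → ℝ} {ε C : ℝ} (hT : S.IsTimeRange ε C) (hS : S.Models f h) :
    ∃ ρ : ℝ → C1, (∀ t, |t| ≤ ε → S.IsSelfConsistent t (C1.lift (ρ t))) ∧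
      ContDiffOn ℝ 1 ρ (Ioo (-ε) ε) ∧
      ∀ t, |t| < ε → ∃ (T : c1ZeroMean ≃L[ℝ] c1ZeroMean) (r : c1ZeroMean),
        (∀ (g : c1ZeroMean) (x : S1), C1.fn (T g) x =
          C1.fn g x - coupledTransfer f h t (C1.fn (ρ t)) (C1.fn g) x
            + t * transfer f (SelfConsistent.theta h t (C1.fn (ρ t)) (C1.fn g)) x) ∧
        (∀ x, C1.fn r x =
          transfer f (SelfConsistent.theta h t (C1.fn (ρ t)) (C1.fn (ρ t))) x) ∧
        HasDerivAt ρ (-(T.symm r : C1)) t := by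
  obtain ⟨ρ, hρ, hsmooth, hderiv⟩ := hT.exists_family
  exact ⟨ρ, hρ, hsmooth, fun t ht => ⟨hT.resolvent ht.le (hρ t ht.le),
    hT.response ht.le (hρ t ht.le), hT.resolvent_apply_coe hS ht.le (hρ t ht.le),
    hT.response_coe hS ht.le (hρ t ht.le), hderiv t ht.le ht⟩⟩

theorem MapContDiff.of_le {m n : WithTop ℕ∞} {f : S1 → S1} (hf : MapContDiff n f) (hmn : m ≤ n) :
    MapContDiff m f :=
  let ⟨F, hF, hfF⟩ := hf
  ⟨F, hF.of_le hmn, hfF⟩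

theorem bddAbove_abs_funDeriv_mapDeriv {f : S1 → S1} (hf : MapContDiff 2 f)
    (hexp : ∀ x, 1 < |mapDeriv f x|) : BddAbove (range fun x => |funDeriv (mapDeriv f) x|) := by
  obtain ⟨F, ω, s, n, hF, hfF⟩ := exists_isExpandingLift (k := 1) hf hexp
  obtain ⟨M, hM⟩ := exists_forall_abs_le_of_periodic
    (hF.contDiff_deriv.continuous_deriv le_rfl) one_ne_zero (periodic_deriv hF.periodic_deriv)
  refine ⟨M, forall_mem_range.2 fun x => ?_⟩
  induction x using QuotientAddGroup.induction_on with | H x => ?_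
  exact (congrArg abs (hF.funDeriv_mapDeriv_eq hfF x)).trans_le (hM x)

theorem transfer_distortion_le {f : S1 → S1} {ω : ℝ} (hf : MapContDiff 2 f) (hω : 1 < ω)
    (hexp : ∀ x, ω ≤ |mapDeriv f x|) (x : S1) :
    transfer f (fun y => 1 / |mapDeriv f y| + |funDeriv (mapDeriv f) y| / mapDeriv f y ^ 2) x ≤
      coveringNumber f * ((⨆ x, |funDeriv (mapDeriv f) x|) / ω ^ 3 + 1 / ω ^ 2) := by
  have hexp' (x : S1) : 1 < |mapDeriv f x| := hω.trans_le (hexp x)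
  have hbdd := bddAbove_abs_funDeriv_mapDeriv hf hexp'
  obtain ⟨F, _, s, n, hF, hfF⟩ := exists_isExpandingLift (k := 1) hf hexp'
  refine hF.transfer_le hfF (fun y => ?_) x
  have hpos : 0 < |mapDeriv f y| := zero_lt_one.trans (hexp' y)
  have hle : |funDeriv (mapDeriv f) y| ≤ ⨆ x, |funDeriv (mapDeriv f) x| := le_ciSup hbdd y
  calc (1 / |mapDeriv f y| + |funDeriv (mapDeriv f) y| / mapDeriv f y ^ 2) / |mapDeriv f y|
      = |funDeriv (mapDeriv f) y| / |mapDeriv f y| ^ 3 + 1 / |mapDeriv f y| ^ 2 := by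
        rw [← sq_abs (mapDeriv f y)]; field_simp; ring
    _ ≤ (⨆ x, |funDeriv (mapDeriv f) x|) / ω ^ 3 + 1 / ω ^ 2 := by
        gcongr
        exacts [(abs_nonneg _).trans hle, hexp y, hexp y]

end SelfConsistent

open SelfConsistent in
theorem theorem2_general (f : S1 → S1) (h : S1 → S1 → ℝ) (r : ℕ) (hr : 3 ≤ r)
    (hf : MapContDiff (r + 1) f) (hh : TorusContDiff (r + 1) h)
    (hexp : ∀ x, 1 < |mapDeriv f x|)
    (hdist : ∀ x, transfer f
      (fun y => 1 / |mapDeriv f y| + |funDeriv (mapDeriv f) y| / mapDeriv f y ^ 2) x < 1) :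
    ∃ ε₀ : ℝ, 0 < ε₀ ∧
      (∀ t : ℝ, |t| ≤ ε₀ → ∀ ψ : S1 → ℝ, Continuous ψ → (∀ x, 0 ≤ ψ x) → ∫ x, ψ x = 1 →
        IsDiffeo (r + 1) (couplingMap h t ψ) ∧ ∀ x, 0 < couplingDeriv h t ψ x) ∧
      ∃ ρ : ℝ → C1,
        (∀ t : ℝ, |t| ≤ ε₀ → IsFixedDensity f h t (C1.fn (ρ t)) ∧
          ∀ φ : S1 → ℝ, Continuous φ → (∀ x, 0 ≤ φ x) → ∫ x, φ x = 1 →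
            selfConsistentTransfer f h t φ = φ → φ = C1.fn (ρ t)) ∧
        (∀ t : ℝ, |t| ≤ ε₀ → FunContDiff r (C1.fn (ρ t))) ∧
        ∃ ε₂ : ℝ, 0 < ε₂ ∧ ε₂ ≤ ε₀ ∧ ContDiffOn ℝ 1 ρ (Set.Icc (-ε₂) ε₂) ∧
        ∃ ε₃ : ℝ, 0 < ε₃ ∧ ε₃ ≤ ε₂ ∧
          (∀ t : ℝ, |t| < ε₃ →
            ∃ (T : c1ZeroMean ≃L[ℝ] c1ZeroMean) (q : c1ZeroMean),
              (∀ g : c1ZeroMean, ∀ x : S1, C1.fn (T g) x =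
                C1.fn g x - coupledTransfer f h t (C1.fn (ρ t)) (C1.fn g) x
                  + t * transfer f (theta h t (C1.fn (ρ t)) (C1.fn g)) x) ∧
              (∀ x : S1, C1.fn q x =
                transfer f (theta h t (C1.fn (ρ t)) (C1.fn (ρ t))) x) ∧
              HasDerivAt ρ (-(T.symm q : C1)) t) ∧
          ∃ (T : c1ZeroMean ≃L[ℝ] c1ZeroMean) (q : c1ZeroMean),
            (∀ g : c1ZeroMean, ∀ x : S1, C1.fn (T g) x =
              C1.fn g x - transfer f (C1.fn g) x) ∧
            (∀ x : S1, C1.fn q x = transfer f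
              (funDeriv (fun y => C1.fn (ρ 0) y * meanField h (C1.fn (ρ 0)) y)) x) ∧
            HasDerivAt ρ (-(T.symm q : C1)) 0 := by
  obtain ⟨k, rfl⟩ := Nat.exists_eq_add_of_le' hr
  obtain ⟨S, hS⟩ := exists_models hf hh hexp hdist
  obtain ⟨ε, C, hT⟩ := S.exists_isTimeRange
  obtain ⟨ρ, hρ, hsmooth, hresponse⟩ := hT.exists_response hS
  have hε := hT.pos
  refine ⟨ε, hε, fun t ht ψ hc hψ hint => ?_, ρ, fun t ht => ⟨hT.isFixedDensity hS ht (hρ t ht),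
    fun φ => hT.eq_fn hS ht (hρ t ht)⟩, fun t ht => hT.contDiff ht (hρ t ht),
    ε / 2, half_pos hε, half_le_self hε.le,
    hsmooth.mono (Icc_subset_Ioo (neg_lt_neg (half_lt_self hε)) (half_lt_self hε)),
    ε / 2, half_pos hε, le_rfl, fun t ht => hresponse t (ht.trans (half_lt_self hε)), ?_⟩
  · have hu := hT.ckBound_coupling ht (isDensity_lift hc hψ hint)
    exact ⟨hS.isDiffeo hu, hS.couplingDeriv_pos hu⟩
  · simpa only [coupledTransfer_zero, theta_zero, zero_mul, add_zero]
      using hresponse 0 (abs_zero.trans_lt hε)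

open SelfConsistent in
theorem theorem2 (f : S1 → S1) (h : S1 → S1 → ℝ) (ω : ℝ)
    (hf : MapContDiff 5 f) (hh : TorusContDiff 5 h)
    (hω : 1 < ω) (hexp : ∀ x, ω < |mapDeriv f x|)
    (hdist : (coveringNumber f : ℝ) *
      ((⨆ x, |funDeriv (mapDeriv f) x|) / ω ^ 3 + 1 / ω ^ 2) < 1) :
    ∃ ε₀ : ℝ, 0 < ε₀ ∧
      -- for `|t| ≤ ε₀` the coupling maps are diffeomorphisms
      (∀ t : ℝ, |t| ≤ ε₀ → ∀ ψ : S1 → ℝ, Continuous ψ → (∀ x, 0 ≤ ψ x) → ∫ x, ψ x = 1 →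
        IsDiffeo 5 (couplingMap h t ψ) ∧ ∀ x, 0 < couplingDeriv h t ψ x) ∧
      ∃ ρ : ℝ → C1,
        -- `ρ(t)` is the unique fixed density
        (∀ t : ℝ, |t| ≤ ε₀ → IsFixedDensity f h t (C1.fn (ρ t)) ∧
          ∀ φ : S1 → ℝ, IsFixedDensity f h t φ → φ = C1.fn (ρ t)) ∧
        -- (i)
        (∀ t : ℝ, |t| ≤ ε₀ → FunContDiff 3 (C1.fn (ρ t))) ∧
        -- (ii)
        ∃ ε₂ : ℝ, 0 < ε₂ ∧ ε₂ ≤ ε₀ ∧ ContDiffOn ℝ 1 ρ (Set.Icc (-ε₂) ε₂) ∧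
        -- (iii)
        ∃ ε₃ : ℝ, 0 < ε₃ ∧ ε₃ ≤ ε₂ ∧
          (∀ t : ℝ, |t| < ε₃ →
            ∃ (T : c1ZeroMean ≃L[ℝ] c1ZeroMean) (r : c1ZeroMean),
              (∀ g : c1ZeroMean, ∀ x : S1, C1.fn (T g) x =
                C1.fn g x - coupledTransfer f h t (C1.fn (ρ t)) (C1.fn g) x
                  + t * transfer f (theta h t (C1.fn (ρ t)) (C1.fn g)) x) ∧
              (∀ x : S1, C1.fn r x =
                transfer f (theta h t (C1.fn (ρ t)) (C1.fn (ρ t))) x) ∧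
              HasDerivAt ρ (-(T.symm r : C1)) t) ∧
          -- the case `t = 0`
          ∃ (T : c1ZeroMean ≃L[ℝ] c1ZeroMean) (r : c1ZeroMean),
            (∀ g : c1ZeroMean, ∀ x : S1, C1.fn (T g) x =
              C1.fn g x - transfer f (C1.fn g) x) ∧
            (∀ x : S1, C1.fn r x = transfer f
              (funDeriv (fun y => C1.fn (ρ 0) y * meanField h (C1.fn (ρ 0)) y)) x) ∧
            HasDerivAt ρ (-(T.symm r : C1)) 0 := by
  obtain ⟨ε₀, hε₀, hdiffeo, ρ, hfixed, hsmooth, hresponse⟩ :=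
    theorem2_general f h 4 (by norm_num) hf hh (fun x => hω.trans (hexp x)) fun x =>
      (transfer_distortion_le (hf.of_le (by norm_num)) hω (fun x => (hexp x).le) x).trans_lt hdist
  exact ⟨ε₀, hε₀, hdiffeo, ρ, fun t ht => ⟨(hfixed t ht).1, fun φ ⟨⟨_, hK⟩, hpos, hint, hfix⟩ =>
      (hfixed t ht).2 φ hK.continuous (fun x => (hpos x).le) hint hfix⟩,
    fun t ht => (hsmooth t ht).of_le (by norm_num), hresponse⟩
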